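/- **Setting.** Let $f(\theta;\xi)$, $\theta\in\mathbb R^d$, be a random loss, differentiable in $\theta$, and $F(\theta)=\mathbb E_\xi[f(\theta;\xi)]$. Let $\Theta\subseteq\mathbb R^d$ be closed and convex and let $F$ have a unique global minimizer $\theta^*\in\Theta$. Let $C_\rho\in\mathbb N$, $C_\rho\ge1$, $\rho\in[0,1)$, $C_\gamma,C_\sigma>0$, $\beta\in[0,1]$, $\alpha\in\mathbb R$, $\nu>0$, $\sigma\in[0,1/2]$, $\sigma'\in(0,1/2]$, $C_\sigma',D_\nu,B_\nu\ge0$, and put, for $t\ge1$, $$n_t=\lceil C_\rho t^\rho\rceil,\quad N_t=\sum_{i=1}^t n_i,\quad \gamma_t=C_\gamma n_t^\beta t^{-\alpha},\quad \nu_t=n_t^{-\nu},\quad \sigma_t=C_\sigma n_t^{-\sigma}.$$ At time $t$ a mini-batch $\xi_{t,1},\dots,\xi_{t,n_t}$ arrives; $f_t(\theta)=n_t^{-1}\sum_{i=1}^{n_t}f(\theta;\xi_{t,i})$. Let $(\mathcal F_t)_{t\ge0}$ be a filtration to which $(f_t)_{t\geq 1}$ is adapted (e.g. the natural one), and let $\theta_0$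 be $\mathcal F_0$-measurable with finite fourth moment. The iterates $(\theta_t)$ follow either * (SSG) $\theta_t=\theta_{t-1}-\gamma_t\nabla f_t(\theta_{t-1})$, with $\Theta=\mathbb R^d$, or * (PSSG) $\theta_t=\mathcal P_\Theta\big(\theta_{t-1}-\gamma_t\nabla f_t(\theta_{t-1})\big)$, with $\theta_0\in\Theta$ and $\mathcal P_\Theta$ the Euclidean projection onto $\Theta$, and $\bar\theta_t=N_t^{-1}\sum_{i=0}^{t-1}n_{i+1}\theta_i$, $\bar\delta_t=\mathbb E\|\bar\theta_t-\theta^*\|^2$. **Assumptions.** 1. $F$ is differentiable, $\nabla F(\theta^*)=0$, and for some $\mu>0$ and all $\theta\in\Theta$: $F(\theta^*)\ge F(\theta)+\langle\nabla F(\theta),\theta^*-\theta\rangle+\frac\mu2\|\theta^*-\theta\|^2$. 2. $\nabla F$ is differentiable on $\Theta$, and for some $C_\nabla>0$, $C_\nabla'\ge0$ and all $\theta\in\Theta$: $\|\nabla F(\theta)-\nabla F(\theta^*)\|\le C_\nabla\|\theta-\theta^*\|$ and $\|\nabla^2F(\theta)-\nabla^2F(\theta^*)\|\le C_\nabla'\|\theta-\theta^*\|$.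 3. For every $t\ge1$ and every $\mathcal F_{t-1}$-measurable $\Theta$-valued random vector $\vartheta$ with finite fourth moment, $\nabla f_t(\vartheta)$ is square-integrable and, for some $C_\kappa>0$, $$\mathbb E\big\|\mathbb E[\nabla f_t(\vartheta)\mid\mathcal F_{t-1}]-\nabla F(\vartheta)\big\|^4\le\nu_t^4\big(D_\nu^4\,\mathbb E\|\vartheta-\theta^*\|^4+B_\nu^4\big),$$ $$\mathbb E\|\nabla f_t(\vartheta)-\nabla f_t(\theta^*)\|^4\le C_\kappa^4\,\mathbb E\|\vartheta-\theta^*\|^4,\qquad \mathbb E\|\nabla f_t(\theta^*)\|^4\le\sigma_t^4 .$$ 4. There are symmetric positive semidefinite matrices $\Sigma$, $\Sigma_t$ with $\operatorname{Tr}\Sigma_t=C_\sigma'n_t^{-2\sigma'}$ and $n_t^{2\sigma}\,\mathbb E[\nabla f_t(\theta^*)\nabla f_t(\theta^*)^\top]\preceq\Sigma+\Sigma_t$ for all $t\ge1$. 5. In the case of PSSG: $D_\Theta=\inf_{\theta\in\partial\Theta}\|\theta-\theta^*\|>0$, and for some $G_\Theta>0$ and all $t\ge1$, $\sup_{\theta\in\Theta}\|\nabla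 f_t(\theta)\|^2\le G_\Theta^2$ almost surely. **Theorem.** Suppose that $\mu_\nu=\mu-\mathbb 1_{\{\rho=0\}}2D_\nu C_\rho^{-\nu}>0$ and $\alpha-\rho\beta\in(1/2,1)$. Put $\Lambda=\operatorname{Tr}(\nabla^2F(\theta^*)^{-1}\Sigma\nabla^2F(\theta^*)^{-1})$ and $\delta=\rho(2\sigma-\beta)+\alpha$ if $B_\nu=0$, $\delta=\min\{\rho(2\sigma-\beta)+\alpha,\,2\rho\nu\}$ if $B_\nu\ne0$. Then, for all $t\ge1$, $\bar\theta_t$ is square-integrable and $$\begin{aligned}\bar\delta_t^{1/2}\le{}&\frac{\Lambda^{1/2}}{N_t^{1/2}}\mathbb 1_{\{\sigma=1/2\}}+\frac{2^{1/2}\Lambda^{1/2}C_\rho^{\frac{1-2\sigma}{2(1+\rho)}}}{N_t^{\frac{1+2\rho\sigma}{2(1+\rho)}}}\mathbb 1_{\{\sigma<1/2\}}+\frac{2^{1/2}C_\sigma'^{1/2}C_\rho^{\frac{1-2(\sigma+\sigma')}{2(1+\rho)}}}{\mu N_t^{\frac{1+2\rho(\sigma+\sigma')}{2(1+\rho)}}}\\&+\tilde{\mathcal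 O}\Big(\max\Big\{N_t^{-\frac{2+\rho(2\sigma+\beta)-\alpha}{2(1+\rho)}},N_t^{-\frac{\rho(2\sigma-\beta)+\alpha}{1+\rho}}\Big\}\Big)+\mathbb 1_{\{D_\nu\ne0\}}\tilde{\mathcal O}\Big(N_t^{-\frac{\delta+\rho\nu}{2(1+\rho)}}\Big)+\mathbb 1_{\{B_\nu\ne0\}}\Psi_t,\end{aligned}$$ $$\Psi_t=\tilde{\mathcal O}\Big(\max\Big\{N_t^{-\frac{\rho(\sigma+\nu)}{2(1+\rho)}},N_t^{-\frac{1+\rho(\beta+\nu)-\alpha}{1+\rho}},N_t^{-\frac{1+2\rho\nu}{2(1+\rho)}},N_t^{-\frac{\delta/2+\rho\nu}{2(1+\rho)}},N_t^{-\frac{2\rho\nu}{1+\rho}}\Big\}\Big).$$ Here $u_t=\tilde{\mathcal O}(v_t)$ means $|u_t|\le K(1+\log N_t)^k v_t$ for all $t\ge1$, where $K$ and $k$ depend only on $\mu,C_\nabla,C_\nabla',C_\kappa,C_\sigma,\sigma,C_\sigma',\sigma',D_\nu,B_\nu,\nu,C_\gamma,\alpha,\beta,C_\rho,\rho$, on an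 upper bound for $\mathbb E\|\theta_0-\theta^*\|^4$ and, for PSSG, on $G_\Theta$ and (a positive lower bound for) $D_\Theta$. -/

import Mathlib

open MeasureTheory

noncomputable section

namespace Streaming

/-- The numerical constants of the problem and of the algorithm.
`Delta0` bounds the fourth moment of the initial error; `G` and `DTheta` (gradient bound and
distance from the minimizer to the boundary of the constraint set) matter only with projection. -/
structure Params where
  mu : ℝ
  Cgrad : ℝ
  Chess : ℝ
  Ckappa : ℝ
  Csigma : ℝ
  sigma : ℝ
  Csigma' : ℝ
  sigma' : ℝ
  Dnu : ℝ
  Bnu : ℝ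
  nu : ℝ
  Cgamma : ℝ
  alpha : ℝ
  beta : ℝ
  Crho : ℕ
  rho : ℝ
  Delta0 : ℝ
  G : ℝ
  DTheta : ℝ

namespace Params

variable (p : Params)

/-- Size of the `t`-th mini-batch, `n_t = ⌈C_ρ t^ρ⌉`. -/
def batch (t : ℕ) : ℕ := ⌈(p.Crho : ℝ) * (t : ℝ) ^ p.rho⌉₊

/-- `N_t = n_1 + ⋯ + n_t`. -/
def total (t : ℕ) : ℕ := ∑ i ∈ Finset.Icc 1 t, p.batch i

/-- Learning rate `γ_t = C_γ n_t^β t^{-α}`. -/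
def rate (t : ℕ) : ℝ := p.Cgamma * (p.batch t : ℝ) ^ p.beta * (t : ℝ) ^ (-p.alpha)

/-- `ν_t = n_t^{-ν}`. -/
def depRate (t : ℕ) : ℝ := (p.batch t : ℝ) ^ (-p.nu)

/-- `σ_t = C_σ n_t^{-σ}`. -/
def noiseRate (t : ℕ) : ℝ := p.Csigma * (p.batch t : ℝ) ^ (-p.sigma)

/-- `μ_ν = μ - 1_{ρ = 0} 2 D_ν C_ρ^{-ν}`. -/
def muNu : ℝ := p.mu - if p.rho = 0 then 2 * p.Dnu * (p.Crho : ℝ) ^ (-p.nu) else 0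

/-- The decay exponent `δ` of the mean squared error of the non-averaged iterates. -/
def delta : ℝ :=
  if p.Bnu = 0 then p.rho * (2 * p.sigma - p.beta) + p.alpha
  else min (p.rho * (2 * p.sigma - p.beta) + p.alpha) (2 * p.rho * p.nu)

/-- The ranges of the constants. -/
structure Valid : Prop where
  mu_pos : 0 < p.mu
  Cgrad_pos : 0 < p.Cgrad
  Chess_nonneg : 0 ≤ p.Chess
  Ckappa_pos : 0 < p.Ckappa
  Csigma_pos : 0 < p.Csigma
  sigma_mem : p.sigma ∈ Set.Icc (0 : ℝ) (1 / 2)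
  Csigma'_nonneg : 0 ≤ p.Csigma'
  sigma'_mem : p.sigma' ∈ Set.Ioc (0 : ℝ) (1 / 2)
  Dnu_nonneg : 0 ≤ p.Dnu
  Bnu_nonneg : 0 ≤ p.Bnu
  nu_pos : 0 < p.nu
  Cgamma_pos : 0 < p.Cgamma
  beta_mem : p.beta ∈ Set.Icc (0 : ℝ) 1
  Crho_pos : 0 < p.Crho
  rho_mem : p.rho ∈ Set.Ico (0 : ℝ) 1

/-- `u_t = Õ(v_t)`: bounded by `v_t` up to a constant and a power of `log N_t`, for all `t ≥ 1`. -/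
def IsSoftO (u v : ℕ → ℝ) : Prop :=
  ∃ (K : ℝ) (k : ℕ), ∀ t : ℕ, 1 ≤ t →
    |u t| ≤ K * (1 + Real.log (p.total t : ℝ)) ^ k * v t

end Params

section Problem

variable {d : ℕ} {Ξ Ω : Type*}

/-- The objective `F(θ) = E_ξ[f(θ; ξ)]`, with `π` the law of `ξ`. -/
def objective [MeasurableSpace Ξ] (f : EuclideanSpace ℝ (Fin d) → Ξ → ℝ) (π : Measure Ξ)
    (θ : EuclideanSpace ℝ (Fin d)) : ℝ :=
  ∫ x, f θ x ∂π

/-- The loss of the `t`-th mini-batch, `f_t(θ) = n_t⁻¹ ∑_{i=1}^{n_t} f(θ; ξ_{t,i})`. -/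
def batchLoss (p : Params) (f : EuclideanSpace ℝ (Fin d) → Ξ → ℝ) (ξ : ℕ → ℕ → Ω → Ξ)
    (t : ℕ) (ω : Ω) (θ : EuclideanSpace ℝ (Fin d)) : ℝ :=
  (p.batch t : ℝ)⁻¹ * ∑ i ∈ Finset.Icc 1 (p.batch t), f θ (ξ t i ω)

/-- The gradient estimate `∇f_t(θ) = n_t⁻¹ ∑_{i=1}^{n_t} ∇f_{t,i}(θ)`. -/
def batchGrad (p : Params) (f : EuclideanSpace ℝ (Fin d) → Ξ → ℝ) (ξ : ℕ → ℕ → Ω → Ξ)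
    (t : ℕ) (ω : Ω) (θ : EuclideanSpace ℝ (Fin d)) : EuclideanSpace ℝ (Fin d) :=
  (p.batch t : ℝ)⁻¹ • ∑ i ∈ Finset.Icc 1 (p.batch t), gradient (fun η => f η (ξ t i ω)) θ

/-- The recursion `θ_t = θ_{t-1} - γ_t ∇f_t(θ_{t-1})`; `g` stands for the gradient estimates. -/
def IsSSG (p : Params) (g : ℕ → Ω → EuclideanSpace ℝ (Fin d) → EuclideanSpace ℝ (Fin d))
    (θ : ℕ → Ω → EuclideanSpace ℝ (Fin d)) : Prop :=
  ∀ (t : ℕ) (ω : Ω), θ (t + 1) ω = θ t ω - p.rate (t + 1) • g (t + 1) ω (θ t ω)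

/-- `y` is a Euclidean projection of `x` onto `Θ`, i.e. a point of `Θ` closest to `x`. -/
def IsProjection (Θ : Set (EuclideanSpace ℝ (Fin d))) (x y : EuclideanSpace ℝ (Fin d)) : Prop :=
  y ∈ Θ ∧ ∀ z ∈ Θ, ‖x - y‖ ≤ ‖x - z‖

/-- The projected recursion `θ_t = P_Θ(θ_{t-1} - γ_t ∇f_t(θ_{t-1}))`, started in `Θ`. -/
def IsPSSG (p : Params) (Θ : Set (EuclideanSpace ℝ (Fin d)))
    (g : ℕ → Ω → EuclideanSpace ℝ (Fin d) → EuclideanSpace ℝ (Fin d))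
    (θ : ℕ → Ω → EuclideanSpace ℝ (Fin d)) : Prop :=
  (∀ ω, θ 0 ω ∈ Θ) ∧
  ∀ (t : ℕ) (ω : Ω),
    IsProjection Θ (θ t ω - p.rate (t + 1) • g (t + 1) ω (θ t ω)) (θ (t + 1) ω)

/-- The Polyak–Ruppert average `θ̄_t = N_t⁻¹ ∑_{i=0}^{t-1} n_{i+1} θ_i`. -/
def average (p : Params) (θ : ℕ → Ω → EuclideanSpace ℝ (Fin d)) (t : ℕ) (ω : Ω) :
    EuclideanSpace ℝ (Fin d) :=
  (p.total t : ℝ)⁻¹ • ∑ i ∈ Finset.range t, (p.batch (i + 1) : ℝ) • θ i ω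

/-- `μ`-quasi-strong convexity on `Θ`. -/
structure QuasiStronglyConvex (p : Params) (Θ : Set (EuclideanSpace ℝ (Fin d)))
    (F : EuclideanSpace ℝ (Fin d) → ℝ) (θs : EuclideanSpace ℝ (Fin d)) : Prop where
  differentiable : Differentiable ℝ F
  gradient_eq_zero : gradient F θs = 0
  le : ∀ θ ∈ Θ,
    F θ + inner ℝ (gradient F θ) (θs - θ) + p.mu / 2 * ‖θs - θ‖ ^ 2 ≤ F θs

/-- Gradient and Hessian of `F` are Lipschitz around the minimizer, on `Θ`. -/
structure Smooth (p : Params) (Θ : Set (EuclideanSpace ℝ (Fin d)))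
    (F : EuclideanSpace ℝ (Fin d) → ℝ) (θs : EuclideanSpace ℝ (Fin d)) : Prop where
  gradient_lipschitz : ∀ θ ∈ Θ, ‖gradient F θ - gradient F θs‖ ≤ p.Cgrad * ‖θ - θs‖
  twice_differentiable : ∀ θ ∈ Θ, DifferentiableAt ℝ (gradient F) θ
  hessian_lipschitz : ∀ θ ∈ Θ,
    ‖fderiv ℝ (gradient F) θ - fderiv ℝ (gradient F) θs‖ ≤ p.Chess * ‖θ - θs‖

/-- The Hessian matrix of `F` at `θ`. -/
def hessianMatrix (F : EuclideanSpace ℝ (Fin d) → ℝ) (θ : EuclideanSpace ℝ (Fin d)) :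
    Matrix (Fin d) (Fin d) ℝ :=
  Matrix.of fun i j => (fderiv ℝ (gradient F) θ (EuclideanSpace.single j (1 : ℝ))) i

/-- `Λ = Tr(∇²F(θ*)⁻¹ Σ ∇²F(θ*)⁻¹)`. -/
def Lam (F : EuclideanSpace ℝ (Fin d) → ℝ) (θs : EuclideanSpace ℝ (Fin d))
    (S : Matrix (Fin d) (Fin d) ℝ) : ℝ :=
  ((hessianMatrix F θs)⁻¹ * S * (hessianMatrix F θs)⁻¹).trace

variable [mΩ : MeasurableSpace Ω]

/-- Dependence and bias, with moment order `q`: for every random parameter `ϑ` known at time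
`t - 1`, with values in `Θ` and a finite moment of order `q`,
`E‖E[∇f_t(ϑ) | ℱ_{t-1}] - ∇F(ϑ)‖^q ≤ ν_t^q (D_ν^q E‖ϑ - θ*‖^q + B_ν^q)`. -/
def DependenceBias (p : Params) (q : ℕ) (P : Measure Ω) (𝓕 : Filtration ℕ mΩ)
    (Θ : Set (EuclideanSpace ℝ (Fin d)))
    (g : ℕ → Ω → EuclideanSpace ℝ (Fin d) → EuclideanSpace ℝ (Fin d))
    (F : EuclideanSpace ℝ (Fin d) → ℝ) (θs : EuclideanSpace ℝ (Fin d)) : Prop :=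
  ∀ t : ℕ, 1 ≤ t → ∀ ϑ : Ω → EuclideanSpace ℝ (Fin d),
    Measurable[𝓕 (t - 1)] ϑ → (∀ ω, ϑ ω ∈ Θ) → MemLp ϑ (q : ENNReal) P →
      MemLp (fun ω => g t ω (ϑ ω)) 2 P ∧
      Integrable (fun ω =>
        ‖(P[fun ω => g t ω (ϑ ω) | 𝓕 (t - 1)]) ω - gradient F (ϑ ω)‖ ^ q) P ∧
      ∫ ω, ‖(P[fun ω => g t ω (ϑ ω) | 𝓕 (t - 1)]) ω - gradient F (ϑ ω)‖ ^ q ∂P ≤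
        p.depRate t ^ q * (p.Dnu ^ q * ∫ ω, ‖ϑ ω - θs‖ ^ q ∂P + p.Bnu ^ q)

/-- Expected smoothness, with moment order `q`, for the same random parameters `ϑ`. -/
def ExpectedSmooth (p : Params) (q : ℕ) (P : Measure Ω) (𝓕 : Filtration ℕ mΩ)
    (Θ : Set (EuclideanSpace ℝ (Fin d)))
    (g : ℕ → Ω → EuclideanSpace ℝ (Fin d) → EuclideanSpace ℝ (Fin d))
    (θs : EuclideanSpace ℝ (Fin d)) : Prop :=
  ∀ t : ℕ, 1 ≤ t → ∀ ϑ : Ω → EuclideanSpace ℝ (Fin d),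
    Measurable[𝓕 (t - 1)] ϑ → (∀ ω, ϑ ω ∈ Θ) → MemLp ϑ (q : ENNReal) P →
      Integrable (fun ω => ‖g t ω (ϑ ω) - g t ω θs‖ ^ q) P ∧
      ∫ ω, ‖g t ω (ϑ ω) - g t ω θs‖ ^ q ∂P ≤ p.Ckappa ^ q * ∫ ω, ‖ϑ ω - θs‖ ^ q ∂P

/-- Gradient noise at the minimizer, with moment order `q`. -/
def GradientNoise (p : Params) (q : ℕ) (P : Measure Ω)
    (g : ℕ → Ω → EuclideanSpace ℝ (Fin d) → EuclideanSpace ℝ (Fin d))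
    (θs : EuclideanSpace ℝ (Fin d)) : Prop :=
  ∀ t : ℕ, 1 ≤ t →
    Integrable (fun ω => ‖g t ω θs‖ ^ q) P ∧ ∫ ω, ‖g t ω θs‖ ^ q ∂P ≤ p.noiseRate t ^ q

/-- `E[∇f_t(θ*) ∇f_t(θ*)ᵀ]`. -/
def scoreMatrix (P : Measure Ω)
    (g : ℕ → Ω → EuclideanSpace ℝ (Fin d) → EuclideanSpace ℝ (Fin d))
    (θs : EuclideanSpace ℝ (Fin d)) (t : ℕ) : Matrix (Fin d) (Fin d) ℝ :=
  Matrix.of fun i j => ∫ ω, g t ω θs i * g t ω θs j ∂P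

/-- Covariance of the scores: `n_t^{2σ} E[∇f_t(θ*) ∇f_t(θ*)ᵀ] ≼ Σ + Σ_t` with `Σ`, `Σ_t`
positive semidefinite and `Tr Σ_t = C_σ' n_t^{-2σ'}`. -/
structure ScoreCovariance (p : Params) (P : Measure Ω)
    (g : ℕ → Ω → EuclideanSpace ℝ (Fin d) → EuclideanSpace ℝ (Fin d))
    (θs : EuclideanSpace ℝ (Fin d)) (S : Matrix (Fin d) (Fin d) ℝ)
    (St : ℕ → Matrix (Fin d) (Fin d) ℝ) : Prop where
  posSemidef : S.PosSemidef
  posSemidef_t : ∀ t : ℕ, 1 ≤ t → (St t).PosSemidef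
  trace_t : ∀ t : ℕ, 1 ≤ t →
    (St t).trace = p.Csigma' * (p.batch t : ℝ) ^ (-(2 * p.sigma'))
  le : ∀ t : ℕ, 1 ≤ t →
    (S + St t - (p.batch t : ℝ) ^ (2 * p.sigma) • scoreMatrix P g θs t).PosSemidef

/-- Bounded gradients on `Θ`, with the minimizer at distance at least `D_Θ > 0` from `∂Θ`. -/
structure BoundedGradients (p : Params) (P : Measure Ω) (Θ : Set (EuclideanSpace ℝ (Fin d)))
    (g : ℕ → Ω → EuclideanSpace ℝ (Fin d) → EuclideanSpace ℝ (Fin d))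
    (θs : EuclideanSpace ℝ (Fin d)) : Prop where
  DTheta_pos : 0 < p.DTheta
  le_dist : ∀ θ ∈ frontier Θ, p.DTheta ≤ ‖θ - θs‖
  G_pos : 0 < p.G
  bounded : ∀ t : ℕ, 1 ≤ t → ∀ᵐ ω ∂P, ∀ θ ∈ Θ, ‖g t ω θ‖ ^ 2 ≤ p.G ^ 2

end Problem

end Streaming

end

/-! Write `H` for the Hessian of `F` at `θ*`. One step of the recursion, multiplied by `n_{i+1} /
γ_{i+1}`, expresses `n_{i+1} H (θ_i - θ*)` as a weighted increment `θ_i - θ_{i+1}` plus errors: the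
displacement due to the projection, the linearization error of `∇F`, the conditional bias of the
gradient estimate, and the centred gradient estimate, which splits into the centred score at `θ*`
and a fluctuation. Summing over `i` and applying `H⁻¹` gives `N_t (θ̄_t - θ*)`
(`Model.average_sub_eq`); `H` is invertible with `‖H⁻¹‖ ≤ 1 / μ` by
`QuasiStronglyConvex.mu_le_hessian`.

The centred scores are martingale differences, so the squared `L²` norm of their weighted sum is a
sum of second moments. Centring does not increase these, and the covariance assumption turns them
into `Λ` and `Tr Σ_t` (`Model.score_second_moment_le`, `Model.leading_le`). The scores need not have
conditional mean zero, but only the conditional bias at `θ_i` enters the decomposition, so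
dependence between batches adds no correlation terms to the leading part. The explicit constants
rest on a careful comparison of powers of `n_i` with powers of `N_t`
(`Params.Valid.sum_batch_rpow_le`).

Everything else is small because the non-averaged iterates converge. Their fourth moment obeys a
linear recursion (`fourth_moment_step`) with contraction `1 - c t^(-(α - ρβ))`, and
`exists_bound_of_recursion` gives the `L⁴` rate `errRate`. The linearization error is quadratic in
the error. So is the displacement: a projection that acts lands on `∂Θ`, where the error is at least
`D_Θ`. The dependent part of the bias is linear in the error, with the extra factor `ν_t`. The
fluctuation is linear too, but its sum benefits from orthogonality. The increments are summed by
parts against the monotone weight `n / γ`. `Model.rest_le` collects these bounds, and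
`Params.Valid.exists_remainder_le` converts powers of `t` into powers of `N_t`, which is of order
`t^(1+ρ)`.

Both algorithms are instances of `Model`: without projection, every point is its own projection onto
the whole space. -/

namespace Streaming

open Filter Topology

/-! ### Growth of the batch sizes and of `N_t` -/

namespace Params

variable {p : Params}

lemma batch_ge (p : Params) (t : ℕ) : (p.Crho : ℝ) * (t : ℝ) ^ p.rho ≤ p.batch t :=
  Nat.le_ceil _

lemma Valid.one_le_Crho (hp : p.Valid) : (1 : ℝ) ≤ p.Crho := by
  exact_mod_cast hp.Crho_pos

lemma Valid.rho_nonneg (hp : p.Valid) : 0 ≤ p.rho := hp.rho_mem.1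

lemma Valid.one_le_rpow_rho (hp : p.Valid) {t : ℕ} (ht : 1 ≤ t) : (1 : ℝ) ≤ (t : ℝ) ^ p.rho :=
  Real.one_le_rpow (by exact_mod_cast ht) hp.rho_nonneg

lemma Valid.Crho_le_batch (hp : p.Valid) {t : ℕ} (ht : 1 ≤ t) : (p.Crho : ℝ) ≤ p.batch t :=
  (le_mul_of_one_le_right (by positivity) (hp.one_le_rpow_rho ht)).trans (p.batch_ge t)

lemma Valid.one_le_batch (hp : p.Valid) {t : ℕ} (ht : 1 ≤ t) : (1 : ℝ) ≤ p.batch t :=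
  hp.one_le_Crho.trans (hp.Crho_le_batch ht)

lemma Valid.batch_pos (hp : p.Valid) {t : ℕ} (ht : 1 ≤ t) : (0 : ℝ) < p.batch t :=
  zero_lt_one.trans_le (hp.one_le_batch ht)

lemma batch_lt (p : Params) (t : ℕ) :
    (p.batch t : ℝ) < (p.Crho : ℝ) * (t : ℝ) ^ p.rho + 1 :=
  Nat.ceil_lt_add_one (by positivity)

lemma Valid.batch_le (hp : p.Valid) {t : ℕ} (ht : 1 ≤ t) :
    (p.batch t : ℝ) ≤ 2 * p.Crho * (t : ℝ) ^ p.rho := by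
  have h1 := p.batch_lt t
  have h2 : (1 : ℝ) ≤ p.Crho * (t : ℝ) ^ p.rho :=
    one_le_mul_of_one_le_of_one_le hp.one_le_Crho (hp.one_le_rpow_rho ht)
  linarith

lemma Valid.batch_mono (hp : p.Valid) : Monotone p.batch := fun i j hij =>
  Nat.ceil_mono (mul_le_mul_of_nonneg_left
    (Real.rpow_le_rpow (by positivity) (by exact_mod_cast hij) hp.rho_nonneg) (by positivity))

lemma total_succ (p : Params) (t : ℕ) : p.total (t + 1) = p.total t + p.batch (t + 1) := by
  unfold total
  rw [Finset.sum_Icc_succ_top (by omega)]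

lemma cast_total (p : Params) (t : ℕ) :
    (p.total t : ℝ) = ∑ i ∈ Finset.Icc 1 t, (p.batch i : ℝ) := by
  simp [total]

/-- Bernoulli's inequality for `(1 - 1/x)^(1+r)` at `x = t + 1`. Telescoped, it replaces the
comparison of `N_t` with an integral. -/
lemma rpow_succ_sub_le {r : ℝ} (hr : 0 ≤ r) (t : ℕ) :
    ((t + 1 : ℕ) : ℝ) ^ (1 + r) - (t : ℝ) ^ (1 + r) ≤ (1 + r) * ((t + 1 : ℕ) : ℝ) ^ r := by
  have hpos : (0 : ℝ) < ((t + 1 : ℕ) : ℝ) := by positivity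
  set x : ℝ := ((t + 1 : ℕ) : ℝ) with hx
  have hx1 : 1 ≤ x := by rw [hx]; push_cast; linarith [(Nat.cast_nonneg t : (0 : ℝ) ≤ t)]
  have htx : (t : ℝ) = x * (1 + -(1 / x)) := by
    have : (t : ℝ) = x - 1 := by rw [hx]; push_cast; ring
    rw [this]; field_simp; ring
  have hb := one_add_mul_self_le_rpow_one_add (s := -(1 / x))
    (by rw [neg_le_neg_iff, div_le_one hpos]; exact hx1) (p := 1 + r) (by linarith)
  have h0 : 0 ≤ 1 + -(1 / x) := by
    have : 1 / x ≤ 1 := by rw [div_le_one hpos]; exact hx1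
    linarith
  rw [htx, Real.mul_rpow hpos.le h0]
  have h2 : x ^ (1 + r) = x * x ^ r := by rw [Real.rpow_add hpos, Real.rpow_one]
  rw [h2]
  have h3 : 0 ≤ x ^ r := by positivity
  have h4 : x * x ^ r * (1 + (1 + r) * -(1 / x)) ≤ x * x ^ r * (1 + -(1 / x)) ^ (1 + r) :=
    mul_le_mul_of_nonneg_left hb (by positivity)
  have h5 : x * x ^ r * (1 + (1 + r) * -(1 / x)) = x * x ^ r - (1 + r) * x ^ r := by
    field_simp
    ring
  linarith

lemma Valid.total_ge (hp : p.Valid) (t : ℕ) :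
    (p.Crho : ℝ) * (t : ℝ) ^ (1 + p.rho) ≤ (1 + p.rho) * p.total t := by
  have hr := hp.rho_nonneg
  induction t with
  | zero => simp [Real.zero_rpow (by linarith : 1 + p.rho ≠ 0), total]
  | succ t ih =>
    rw [total_succ]
    push_cast
    have h1 := rpow_succ_sub_le hr t
    have h2 := p.batch_ge (t + 1)
    have h3 := mul_le_mul_of_nonneg_left h1 (Nat.cast_nonneg p.Crho : (0 : ℝ) ≤ p.Crho)
    have h4 := mul_le_mul_of_nonneg_left h2 (by linarith : 0 ≤ 1 + p.rho)
    push_cast at h3 h4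
    linarith

lemma Valid.total_le (hp : p.Valid) {t : ℕ} (ht : 1 ≤ t) :
    (p.total t : ℝ) ≤ 2 * p.Crho * (t : ℝ) ^ (1 + p.rho) := by
  have ht0 : (0 : ℝ) < t := by exact_mod_cast ht
  rw [cast_total]
  calc ∑ i ∈ Finset.Icc 1 t, (p.batch i : ℝ)
      ≤ ∑ i ∈ Finset.Icc 1 t, 2 * p.Crho * (t : ℝ) ^ p.rho := by
        refine Finset.sum_le_sum fun i hi => ?_
        have hi := Finset.mem_Icc.1 hi
        exact le_trans (by exact_mod_cast hp.batch_mono hi.2) (hp.batch_le ht)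
    _ = 2 * p.Crho * (t : ℝ) ^ (1 + p.rho) := by
        rw [Finset.sum_const, Nat.card_Icc, nsmul_eq_mul, Real.rpow_add ht0, Real.rpow_one]
        push_cast [Nat.add_sub_cancel]
        ring

lemma Valid.Crho_mul_le_total (hp : p.Valid) (t : ℕ) : (p.Crho : ℝ) * t ≤ p.total t := by
  rw [cast_total]
  calc (p.Crho : ℝ) * t = ∑ i ∈ Finset.Icc 1 t, (p.Crho : ℝ) := by simp [mul_comm]
    _ ≤ _ := Finset.sum_le_sum fun i hi => hp.Crho_le_batch (Finset.mem_Icc.1 hi).1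

lemma Valid.total_pos (hp : p.Valid) {t : ℕ} (ht : 1 ≤ t) : (0 : ℝ) < p.total t := by
  have h1 := hp.Crho_mul_le_total t
  have h2 := hp.one_le_Crho
  have h3 : (1 : ℝ) ≤ t := by exact_mod_cast ht
  nlinarith

lemma Valid.natCast_le_total (hp : p.Valid) (t : ℕ) : (t : ℝ) ≤ p.total t := by
  have h1 := hp.Crho_mul_le_total t
  have h2 := hp.one_le_Crho
  have h3 : (0 : ℝ) ≤ t := by positivity
  nlinarith

/-- `(1 + r)^{r / (1 + r)} ≤ √2` for `r ∈ [0, 1]`. -/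
lemma one_add_rpow_le_sqrt_two {r : ℝ} (h0 : 0 ≤ r) (h1 : r ≤ 1) :
    (1 + r) ^ (r / (1 + r)) ≤ Real.sqrt 2 := by
  rw [Real.sqrt_eq_rpow]
  calc (1 + r) ^ (r / (1 + r)) ≤ (1 + r) ^ (1 / 2 : ℝ) := by
        refine Real.rpow_le_rpow_of_exponent_le (by linarith) ?_
        rw [div_le_div_iff₀ (by linarith) (by norm_num)]; linarith
    _ ≤ 2 ^ (1 / 2 : ℝ) := Real.rpow_le_rpow (by linarith) (by linarith) (by norm_num)

/-- The constant `2` becomes the `√2` of the leading term, so the rounding in the ceiling has to fit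
into it. If `n_t ≤ 2 C_ρ`, then `C_ρ ≤ N_t` suffices. If `n_t ≥ 4`, then `y = C_ρ t^ρ > 3`;
comparing `N_t` with an integral loses at most a factor `√2`, and `y + 1 ≤ √2 y` pays for the
ceiling. What is left is `n_t = 3` with `C_ρ = 1`. -/
lemma Valid.batch_le_total_rpow (hp : p.Valid) {t : ℕ} (ht : 1 ≤ t) :
    (p.batch t : ℝ) ≤ 2 * ((p.Crho : ℝ) ^ (1 / (1 + p.rho)) *
      (p.total t : ℝ) ^ (p.rho / (1 + p.rho))) := by
  have hr := hp.rho_nonneg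
  have hr1 := hp.rho_mem.2
  have hC := hp.one_le_Crho
  have hC0 : (0 : ℝ) < p.Crho := by linarith
  have ht0 : (0 : ℝ) < t := by exact_mod_cast ht
  have ht1 : (1 : ℝ) ≤ t := by exact_mod_cast ht
  have hN := hp.total_pos ht
  have h1r : (0 : ℝ) < 1 + p.rho := by linarith
  have hq : 0 ≤ p.rho / (1 + p.rho) := by positivity
  have hsplit : ∀ y : ℝ, 0 < y → y ^ (1 / (1 + p.rho)) * y ^ (p.rho / (1 + p.rho)) = y := by
    intro y hy
    rw [← Real.rpow_add hy, ← add_div, div_self h1r.ne', Real.rpow_one]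
  have hbase : (p.Crho : ℝ) ≤ (p.Crho : ℝ) ^ (1 / (1 + p.rho)) *
      (p.total t : ℝ) ^ (p.rho / (1 + p.rho)) := by
    calc (p.Crho : ℝ) = _ := (hsplit _ hC0).symm
      _ ≤ _ := mul_le_mul_of_nonneg_left (Real.rpow_le_rpow hC0.le
        ((le_mul_of_one_le_right hC0.le ht1).trans (hp.Crho_mul_le_total t)) hq) (by positivity)
  by_cases hsmall : p.batch t ≤ 2 * p.Crho
  · have : (p.batch t : ℝ) ≤ 2 * p.Crho := by exact_mod_cast hsmall
    linarith
  have hCpos := hp.Crho_pos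
  have hlt := p.batch_lt t
  by_cases h4 : 4 ≤ p.batch t
  · have h4' : (4 : ℝ) ≤ p.batch t := by exact_mod_cast h4
    set y : ℝ := p.Crho * (t : ℝ) ^ p.rho with hy
    have hy3 : 3 < y := by linarith
    have hge : (p.Crho : ℝ) * (t : ℝ) ^ (1 + p.rho) / (1 + p.rho) ≤ p.total t := by
      rw [div_le_iff₀ h1r, mul_comm]; linarith [hp.total_ge t, mul_comm (1 + p.rho) (p.total t : ℝ)]
    have h5 := Real.rpow_le_rpow (by positivity) hge hq
    have h6 : ((p.Crho : ℝ) * (t : ℝ) ^ (1 + p.rho) / (1 + p.rho)) ^ (p.rho / (1 + p.rho))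
        = (p.Crho : ℝ) ^ (p.rho / (1 + p.rho)) * (t : ℝ) ^ p.rho /
          (1 + p.rho) ^ (p.rho / (1 + p.rho)) := by
      rw [Real.div_rpow (by positivity) h1r.le, Real.mul_rpow hC0.le (by positivity),
        ← Real.rpow_mul ht0.le, mul_div_cancel₀ _ h1r.ne']
    rw [h6] at h5
    have h7 := mul_le_mul_of_nonneg_left h5
      (by positivity : 0 ≤ (p.Crho : ℝ) ^ (1 / (1 + p.rho)))
    rw [← mul_div_assoc, ← mul_assoc, hsplit _ hC0, ← hy] at h7
    have h8 := one_add_rpow_le_sqrt_two hr hr1.le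
    have h9 : y / Real.sqrt 2 ≤ y / (1 + p.rho) ^ (p.rho / (1 + p.rho)) :=
      div_le_div_of_nonneg_left (by linarith) (by positivity) h8
    have h10 : y + 1 ≤ 2 * (y / Real.sqrt 2) := by
      have hs : Real.sqrt 2 * Real.sqrt 2 = 2 := Real.mul_self_sqrt (by norm_num)
      have hs0 : 0 < Real.sqrt 2 := by positivity
      have : 2 * (y / Real.sqrt 2) = y * Real.sqrt 2 := by
        rw [eq_comm, mul_div_assoc', eq_div_iff hs0.ne', mul_assoc, hs, mul_comm]
      rw [this]
      have hs1 : (1.4 : ℝ) ≤ Real.sqrt 2 := Real.le_sqrt_of_sq_le (by norm_num)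
      nlinarith
    linarith
  -- Here `t^ρ > 2`, and `N_t ≥ 2t`: all batches after the first have at least two elements, and the
  -- third element of the last batch makes up for the first one.
  · have h3 : p.batch t = 3 := by omega
    have hC1 : p.Crho = 1 := by omega
    have htr : 2 < (t : ℝ) ^ p.rho := by
      have := hlt; rw [h3, hC1] at this; push_cast at this; linarith
    have hN2 : (2 : ℝ) * t ≤ p.total t := by
      obtain ⟨s, rfl⟩ : ∃ s, t = s + 1 := ⟨t - 1, by omega⟩
      have hs1 : 1 ≤ s := by
        by_contra h
        have : s = 0 := by omega
        subst this
        norm_num at htr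
      have hb2 : ∀ i, 2 ≤ i → 2 ≤ p.batch i := by
        intro i hi
        have h0 : (1 : ℝ) < (i : ℝ) ^ p.rho := by
          refine Real.one_lt_rpow (by exact_mod_cast hi) ?_
          rcases hr.lt_or_eq with h | h
          · exact h
          · rw [← h] at htr; norm_num at htr
        have := (p.batch_ge i)
        rw [hC1] at this
        have h' : (1 : ℝ) < p.batch i := by push_cast at this; linarith
        exact_mod_cast h'
      have key : ∀ m, 1 ≤ m → 2 * m ≤ p.total m + 1 := by
        intro m hm
        induction m, hm using Nat.le_induction with
        | base =>
          have h1 := hp.one_le_batch (le_refl 1)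
          have h1 : 1 ≤ p.batch 1 := by exact_mod_cast h1
          simp [total]; omega
        | succ m hm ih => rw [total_succ]; have := hb2 (m + 1) (by omega); omega
      have h := key s hs1
      have : 2 * (s + 1) ≤ p.total (s + 1) := by rw [total_succ, h3]; omega
      exact_mod_cast this
    have h5 : (2 : ℝ) ≤ (p.total t : ℝ) ^ (p.rho / (1 + p.rho)) := by
      calc (2 : ℝ) = 2 ^ (1 / (1 + p.rho)) * 2 ^ (p.rho / (1 + p.rho)) :=
            (hsplit 2 (by norm_num)).symm
        _ ≤ ((t : ℝ) ^ p.rho) ^ (1 / (1 + p.rho)) * 2 ^ (p.rho / (1 + p.rho)) := by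
            gcongr
        _ = (2 * t) ^ (p.rho / (1 + p.rho)) := by
            rw [Real.mul_rpow (by norm_num) ht0.le, ← Real.rpow_mul ht0.le, mul_one_div, mul_comm]
        _ ≤ _ := Real.rpow_le_rpow (by positivity) hN2 hq
    rw [h3, hC1]
    norm_num
    linarith

/-- Hölder's inequality for `∑ y_i^{1-e}`. -/
lemma sum_rpow_one_sub_le (s : Finset ℕ) (y : ℕ → ℝ) (hy : ∀ i ∈ s, 0 < y i) {e : ℝ}
    (he0 : 0 ≤ e) (he1 : e ≤ 1) (hs : s.Nonempty) :
    ∑ i ∈ s, y i ^ (1 - e) ≤ (s.card : ℝ) ^ e * (∑ i ∈ s, y i) ^ (1 - e) := by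
  have hc : (0 : ℝ) < s.card := by exact_mod_cast hs.card_pos
  have hconc : ConcaveOn ℝ (Set.Ici 0) fun x : ℝ => x ^ (1 - e) :=
    Real.concaveOn_rpow (by linarith) (by linarith)
  have h := hconc.le_map_sum (t := s) (w := fun _ => (s.card : ℝ)⁻¹) (p := y)
    (fun i _ => by positivity) (by rw [Finset.sum_const, nsmul_eq_mul, mul_inv_cancel₀ hc.ne'])
    (fun i hi => (hy i hi).le)
  simp only [smul_eq_mul, ← Finset.mul_sum] at h
  have hsum : 0 ≤ ∑ i ∈ s, y i := Finset.sum_nonneg fun i hi => (hy i hi).le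
  rw [Real.mul_rpow (by positivity) hsum, inv_mul_le_iff₀ hc, ← mul_assoc] at h
  refine h.trans_eq ?_
  congr 1
  rw [Real.inv_rpow hc.le, ← Real.rpow_neg hc.le]
  nth_rewrite 1 [← Real.rpow_one (s.card : ℝ)]
  rw [← Real.rpow_add hc]
  congr 1; ring

/-- For `s ≤ 1/2`, split off one factor `n_i` and bound `n_i^(1-2s)` by its value at `t`. For `s >
1/2` that exponent is negative, and Hölder's inequality gives `t^e N_t^(1-e)` with `e = 2s - 1`
instead. Values of `s` up to `1` occur because `s = σ + σ'` is needed. -/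
lemma Valid.sum_batch_rpow_le (hp : p.Valid) {s : ℝ} (hs0 : 0 ≤ s) (hs1 : s ≤ 1) {t : ℕ}
    (ht : 1 ≤ t) :
    ∑ i ∈ Finset.Icc 1 t, (p.batch i : ℝ) ^ (2 - 2 * s) ≤
      2 * (p.Crho : ℝ) ^ ((1 - 2 * s) / (1 + p.rho)) *
        (p.total t : ℝ) ^ (2 - (1 + 2 * p.rho * s) / (1 + p.rho)) := by
  have hr := hp.rho_nonneg
  have h1r : (0 : ℝ) < 1 + p.rho := by linarith
  have hN := hp.total_pos ht
  have hC0 : (0 : ℝ) < p.Crho := by linarith [hp.one_le_Crho]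
  have ht0 : (0 : ℝ) < t := by exact_mod_cast ht
  rcases le_total s (1 / 2) with hs | hs
  · have he : 0 ≤ 1 - 2 * s := by linarith
    have hx : 2 - (1 + 2 * p.rho * s) / (1 + p.rho) =
        1 + p.rho / (1 + p.rho) * (1 - 2 * s) := by field_simp; ring
    rw [hx, Real.rpow_add hN, Real.rpow_one]
    have hmax : (p.batch t : ℝ) ^ (1 - 2 * s) ≤ 2 * (p.Crho : ℝ) ^ ((1 - 2 * s) / (1 + p.rho)) *
        (p.total t : ℝ) ^ (p.rho / (1 + p.rho) * (1 - 2 * s)) := by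
      have h := Real.rpow_le_rpow (by positivity) (hp.batch_le_total_rpow ht) he
      rw [Real.mul_rpow (by norm_num) (by positivity), Real.mul_rpow (by positivity)
        (by positivity), ← Real.rpow_mul hC0.le, ← Real.rpow_mul hN.le, one_div_mul_eq_div] at h
      refine h.trans ?_
      rw [mul_assoc]
      refine mul_le_mul_of_nonneg_right ?_ (by positivity)
      calc (2 : ℝ) ^ (1 - 2 * s) ≤ 2 ^ (1 : ℝ) :=
            Real.rpow_le_rpow_of_exponent_le (by norm_num) (by linarith)
        _ = 2 := Real.rpow_one 2
    calc ∑ i ∈ Finset.Icc 1 t, (p.batch i : ℝ) ^ (2 - 2 * s)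
        ≤ ∑ i ∈ Finset.Icc 1 t, (p.batch i : ℝ) * (p.batch t : ℝ) ^ (1 - 2 * s) := by
          refine Finset.sum_le_sum fun i hi => ?_
          have hi := Finset.mem_Icc.1 hi
          have hbi := hp.batch_pos hi.1
          rw [show 2 - 2 * s = 1 + (1 - 2 * s) by ring, Real.rpow_add hbi, Real.rpow_one]
          exact mul_le_mul_of_nonneg_left (Real.rpow_le_rpow hbi.le
            (by exact_mod_cast hp.batch_mono hi.2) he) hbi.le
      _ = p.total t * (p.batch t : ℝ) ^ (1 - 2 * s) := by rw [← Finset.sum_mul, cast_total]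
      _ ≤ p.total t * (2 * (p.Crho : ℝ) ^ ((1 - 2 * s) / (1 + p.rho)) *
        (p.total t : ℝ) ^ (p.rho / (1 + p.rho) * (1 - 2 * s))) :=
          mul_le_mul_of_nonneg_left hmax hN.le
      _ = _ := by ring
  · set e : ℝ := 2 * s - 1 with he
    have he0 : 0 ≤ e := by rw [he]; linarith
    have he1 : e ≤ 1 := by rw [he]; linarith
    have h := sum_rpow_one_sub_le (Finset.Icc 1 t) (fun i => (p.batch i : ℝ))
      (fun i hi => hp.batch_pos (Finset.mem_Icc.1 hi).1) he0 he1
      (by simpa using ht)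
    rw [Nat.card_Icc, Nat.add_sub_cancel, ← cast_total] at h
    rw [show 2 - 2 * s = 1 - e by rw [he]; ring, show 1 - 2 * s = -e by rw [he]; ring,
      show 2 - (1 + 2 * p.rho * s) / (1 + p.rho) = (1 - e) + e / (1 + p.rho) by
        rw [he]; field_simp; ring, Real.rpow_add hN]
    refine h.trans ?_
    have hkey : (t : ℝ) ^ e ≤ 2 * (p.Crho : ℝ) ^ (-e / (1 + p.rho)) *
        (p.total t : ℝ) ^ (e / (1 + p.rho)) := by
      have h1 := Real.rpow_le_rpow (by positivity) (hp.total_ge t)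
        (by positivity : 0 ≤ e / (1 + p.rho))
      rw [Real.mul_rpow hC0.le (by positivity), Real.mul_rpow h1r.le hN.le,
        ← Real.rpow_mul ht0.le, mul_div_cancel₀ _ h1r.ne'] at h1
      have h2 : (1 + p.rho) ^ (e / (1 + p.rho)) ≤ 2 := by
        calc (1 + p.rho) ^ (e / (1 + p.rho)) ≤ (1 + p.rho) ^ (1 : ℝ) := by
              refine Real.rpow_le_rpow_of_exponent_le (by linarith) ?_
              rw [div_le_one h1r]; linarith
          _ ≤ 2 := by rw [Real.rpow_one]; linarith [hp.rho_mem.2]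
      have h3 : (p.Crho : ℝ) ^ (e / (1 + p.rho)) * (t : ℝ) ^ e ≤
          2 * (p.total t : ℝ) ^ (e / (1 + p.rho)) :=
        h1.trans (mul_le_mul_of_nonneg_right h2 (by positivity))
      rw [neg_div, Real.rpow_neg hC0.le]
      rw [mul_assoc, mul_comm (_⁻¹), ← mul_assoc, ← div_eq_mul_inv, le_div_iff₀ (by positivity)]
      linarith
    calc (t : ℝ) ^ e * (p.total t : ℝ) ^ (1 - e)
        ≤ _ := mul_le_mul_of_nonneg_right hkey (by positivity)
      _ = _ := by ring

end Params

/-! ### Power sums, summation by parts and linear recursions -/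

lemma sum_inv_le_one_add_log (t : ℕ) :
    ∑ i ∈ Finset.Icc 1 t, (i : ℝ)⁻¹ ≤ 1 + Real.log t := by
  have h := harmonic_le_one_add_log t
  rw [harmonic_eq_sum_Icc] at h
  push_cast at h
  exact h

/-- Each term is `i⁻¹` times `i^(s+1)`, and the latter is at most `t^(s+1) + 1` whatever the sign of
`s + 1`. Losing a logarithm avoids distinguishing `s < -1`, `s = -1` and `s > -1`. -/
lemma sum_rpow_le (s : ℝ) {t : ℕ} (ht : 1 ≤ t) :
    ∑ i ∈ Finset.Icc 1 t, (i : ℝ) ^ s ≤ (1 + Real.log t) * ((t : ℝ) ^ (s + 1) + 1) := by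
  have ht0 : (0 : ℝ) < t := by exact_mod_cast ht
  have h : ∀ i ∈ Finset.Icc 1 t, (i : ℝ) ^ s ≤ (i : ℝ)⁻¹ * ((t : ℝ) ^ (s + 1) + 1) := by
    intro i hi
    have hi := Finset.mem_Icc.1 hi
    have hi0 : (0 : ℝ) < i := by exact_mod_cast hi.1
    have : (i : ℝ) ^ s = (i : ℝ)⁻¹ * (i : ℝ) ^ (s + 1) := by
      rw [Real.rpow_add hi0, Real.rpow_one]; field_simp
    rw [this]
    refine mul_le_mul_of_nonneg_left ?_ (by positivity)
    rcases le_total 0 (s + 1) with h | h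
    · have := Real.rpow_le_rpow hi0.le (by exact_mod_cast hi.2 : (i : ℝ) ≤ t) h
      linarith
    · have := Real.rpow_le_one_of_one_le_of_nonpos (by exact_mod_cast hi.1 : (1 : ℝ) ≤ i) h
      have : 0 ≤ (t : ℝ) ^ (s + 1) := by positivity
      linarith
  refine (Finset.sum_le_sum h).trans ?_
  rw [← Finset.sum_mul]
  exact mul_le_mul_of_nonneg_right (sum_inv_le_one_add_log t) (by positivity)

/-- Convexity bound for the increments of `x ↦ x^{-s}`. -/
lemma rpow_neg_sub_succ_le {s : ℝ} (hs : 0 ≤ s) {i : ℕ} (hi : 1 ≤ i) :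
    (i : ℝ) ^ (-s) - ((i + 1 : ℕ) : ℝ) ^ (-s) ≤ s * (i : ℝ) ^ (-s - 1) := by
  have hi0 : (0 : ℝ) < i := by exact_mod_cast hi
  have hx : ((i + 1 : ℕ) : ℝ) = i * (1 + 1 / i) := by push_cast; field_simp
  have h1 : 1 - s * (1 / i : ℝ) ≤ (1 + 1 / i : ℝ) ^ (-s) := by
    have h2 : Real.log (1 + 1 / i : ℝ) ≤ 1 / i := by
      have := Real.log_le_sub_one_of_pos (x := (1 + 1 / i : ℝ)) (by positivity)
      linarith
    rw [Real.rpow_def_of_pos (by positivity)]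
    have h3 := Real.add_one_le_exp (Real.log (1 + 1 / i : ℝ) * -s)
    nlinarith
  rw [hx, Real.mul_rpow hi0.le (by positivity), Real.rpow_sub_one hi0.ne']
  have h3 : 0 ≤ (i : ℝ) ^ (-s) := by positivity
  have := mul_le_mul_of_nonneg_left h1 h3
  calc _ ≤ (i : ℝ) ^ (-s) - (i : ℝ) ^ (-s) * (1 - s * (1 / i : ℝ)) := by linarith
    _ = _ := by ring

/-- Summation by parts for a nonnegative nondecreasing weight with polynomial growth against
`(i + 1)^{-s}`. -/
lemma sum_sub_mul_rpow_le {w : ℕ → ℝ} {b s W : ℝ} (hw0 : w 0 = 0)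
    (hw : ∀ i, 1 ≤ i → w i ≤ W * (i : ℝ) ^ b) (hW : 0 ≤ W) (hs : 0 ≤ s) {t : ℕ} (ht : 1 ≤ t) :
    ∑ i ∈ Finset.range t, (w (i + 1) - w i) * ((i + 1 : ℕ) : ℝ) ^ (-s) +
        w t * ((t + 1 : ℕ) : ℝ) ^ (-s) ≤
      W * (s + 2) * ((1 + Real.log t) * ((t : ℝ) ^ (b - s) + 1)) := by
  -- The boundary term at `0` vanishes with `w 0`. The one at `t` coincides with the extra term of
  -- the statement, so it is counted twice: hence `s + 2`.
  have hparts : ∀ t : ℕ, ∑ i ∈ Finset.range t, (w (i + 1) - w i) * ((i + 1 : ℕ) : ℝ) ^ (-s) =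
      ∑ i ∈ Finset.Icc 1 t, w i * ((i : ℝ) ^ (-s) - ((i + 1 : ℕ) : ℝ) ^ (-s)) +
        w t * ((t + 1 : ℕ) : ℝ) ^ (-s) := by
    intro t
    induction t with
    | zero => simp [hw0]
    | succ t ih =>
      rw [Finset.sum_range_succ, ih, Finset.sum_Icc_succ_top (by omega)]
      ring
  have ht0 : (0 : ℝ) < t := by exact_mod_cast ht
  have hlog : 0 ≤ Real.log t := Real.log_nonneg (by exact_mod_cast ht)
  have hterm : ∀ i ∈ Finset.Icc 1 t,
      w i * ((i : ℝ) ^ (-s) - ((i + 1 : ℕ) : ℝ) ^ (-s)) ≤ W * s * (i : ℝ) ^ (b - s - 1) := by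
    intro i hi
    have hi1 := (Finset.mem_Icc.1 hi).1
    have hi0 : (0 : ℝ) < i := by exact_mod_cast hi1
    have hd : 0 ≤ (i : ℝ) ^ (-s) - ((i + 1 : ℕ) : ℝ) ^ (-s) := by
      rw [sub_nonneg]
      exact Real.rpow_le_rpow_of_nonpos hi0 (by push_cast; linarith) (by linarith)
    calc _ ≤ W * (i : ℝ) ^ b * ((i : ℝ) ^ (-s) - ((i + 1 : ℕ) : ℝ) ^ (-s)) :=
          mul_le_mul_of_nonneg_right (hw i hi1) hd
      _ ≤ W * (i : ℝ) ^ b * (s * (i : ℝ) ^ (-s - 1)) :=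
          mul_le_mul_of_nonneg_left (rpow_neg_sub_succ_le hs hi1) (by positivity)
      _ = W * s * ((i : ℝ) ^ b * (i : ℝ) ^ (-s - 1)) := by ring
      _ = _ := by rw [← Real.rpow_add hi0]; congr 2; ring
  have hlast : w t * ((t + 1 : ℕ) : ℝ) ^ (-s) ≤ W * (t : ℝ) ^ (b - s) := by
    calc _ ≤ W * (t : ℝ) ^ b * ((t + 1 : ℕ) : ℝ) ^ (-s) :=
          mul_le_mul_of_nonneg_right (hw t ht) (by positivity)
      _ ≤ W * (t : ℝ) ^ b * (t : ℝ) ^ (-s) := by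
          refine mul_le_mul_of_nonneg_left ?_ (by positivity)
          exact Real.rpow_le_rpow_of_nonpos ht0 (by push_cast; linarith) (by linarith)
      _ = _ := by rw [mul_assoc, ← Real.rpow_add ht0, sub_eq_add_neg]
  have hsum := Finset.sum_le_sum hterm
  rw [← Finset.mul_sum] at hsum
  have hpow := sum_rpow_le (b - s - 1) ht
  rw [sub_add_cancel] at hpow
  have h1 := mul_le_mul_of_nonneg_left hpow (by positivity : 0 ≤ W * s)
  have h2 : (t : ℝ) ^ (b - s) ≤ (1 + Real.log t) * ((t : ℝ) ^ (b - s) + 1) := by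
    have : 0 ≤ (t : ℝ) ^ (b - s) := by positivity
    nlinarith
  have h3 := mul_le_mul_of_nonneg_left h2 hW
  rw [hparts]
  linarith

/-- Solution of a linear recursion with contraction `1 - c t^{-a}`, `a < 1`, and a forcing term of
order `t^{-a} r_t`, where `r` decays at most polynomially. -/
lemma exists_bound_of_recursion {b f r : ℕ → ℝ} {a c C m : ℝ} (ha : a < 1) (hc : 0 < c)
    (hC : 0 ≤ C) (hr : ∀ t, 0 < r t)
    (hrm : ∀ t : ℕ, r t ≤ r (t + 1) * (1 + m / ((t + 1 : ℕ) : ℝ)))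
    (hb0 : ∀ t, 0 ≤ b t)
    (hb : ∀ᶠ t : ℕ in atTop, b t ≤ 1 - c * (t : ℝ) ^ (-a))
    (hf : ∀ᶠ t : ℕ in atTop, f t ≤ C * (t : ℝ) ^ (-a) * r t) (u0 : ℝ) :
    ∃ K : ℝ, 0 ≤ K ∧ ∀ u : ℕ → ℝ, u 0 ≤ u0 →
      (∀ t, u (t + 1) ≤ b (t + 1) * u t + f (t + 1)) → ∀ t, u t ≤ K * r t := by
  -- As `a < 1`, the relative variation `m / t` of `r` is eventually at most half of the contraction
  -- `c t^(-a)`.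
  have hsmall : ∀ᶠ t : ℕ in atTop, |m| * (t : ℝ) ^ (a - 1) ≤ c / 2 := by
    have h1 : Tendsto (fun t : ℕ => |m| * (t : ℝ) ^ (a - 1)) atTop (𝓝 (|m| * 0)) := by
      have := (tendsto_rpow_neg_atTop (by linarith : 0 < 1 - a)).comp tendsto_natCast_atTop_atTop
      simp only [neg_sub] at this
      exact this.const_mul _
    rw [mul_zero] at h1
    exact h1.eventually_le_const (by positivity)
  obtain ⟨T, hT⟩ := eventually_atTop.1 (hb.and (hf.and hsmall))
  -- the extremal solution of the recursion
  let v : ℕ → ℝ := fun t => Nat.rec u0 (fun t vt => b (t + 1) * vt + f (t + 1)) t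
  have hv : ∀ t, v (t + 1) = b (t + 1) * v t + f (t + 1) := fun t => rfl
  -- The first summand drives the induction beyond `T`; the sum covers the times up to `T`, where no
  -- asymptotic bound is available. Only the coefficients and `u0` enter, so `K` is uniform in `u`.
  let K : ℝ := 2 * C / c + ∑ i ∈ Finset.range (T + 1), |v i| / r i
  have hK0 : 0 ≤ K := by
    have : 0 ≤ ∑ i ∈ Finset.range (T + 1), |v i| / r i :=
      Finset.sum_nonneg fun i _ => div_nonneg (abs_nonneg _) (hr i).le
    positivity
  refine ⟨K, hK0, fun u hu0 hu t => ?_⟩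
  have huv : ∀ t, u t ≤ v t := by
    intro t
    induction t with
    | zero => exact hu0
    | succ t ih =>
      rw [hv]
      exact (hu t).trans (by linarith [mul_le_mul_of_nonneg_left ih (hb0 (t + 1))])
  refine (huv t).trans ?_
  have hstart : ∀ i ∈ Finset.range (T + 1), v i ≤ K * r i := by
    intro i hi
    have h1 : |v i| / r i ≤ ∑ i ∈ Finset.range (T + 1), |v i| / r i :=
      Finset.single_le_sum (f := fun i => |v i| / r i)
        (fun i _ => div_nonneg (abs_nonneg _) (hr i).le) hi
    have h2 : |v i| / r i ≤ K := h1.trans (by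
      have : 0 ≤ 2 * C / c := by positivity
      simp only [K]; linarith)
    rw [div_le_iff₀ (hr i)] at h2
    exact (le_abs_self _).trans h2
  rcases lt_or_ge t (T + 1) with h | h
  · exact hstart t (Finset.mem_range.2 h)
  have h' : T ≤ t := by omega
  clear h
  induction t, h' using Nat.le_induction with
  | base => exact hstart T (by simp)
  | succ t hTt ih =>
    obtain ⟨h1, h2, h3⟩ := hT (t + 1) (by omega)
    rw [hv]
    set x : ℝ := ((t + 1 : ℕ) : ℝ) with hx
    have hx0 : 0 < x := by rw [hx]; positivity
    set y : ℝ := x ^ (-a) with hy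
    have hy0 : 0 < y := by positivity
    have hmx : m / x ≤ c / 2 * y := by
      have hxa : x ^ (a - 1) * y = x⁻¹ := by
        rw [hy, ← Real.rpow_add hx0, ← Real.rpow_neg_one]; congr 1; ring
      have := mul_le_mul_of_nonneg_right h3 hy0.le
      rw [mul_assoc, hxa] at this
      refine le_trans ?_ this
      rw [div_eq_mul_inv]
      exact mul_le_mul_of_nonneg_right (le_abs_self m) (by positivity)
    have hrt := hrm t
    rw [← hx] at hrt
    have hr1 := hr (t + 1)
    have hcy : c * y ≤ 1 := by linarith [hb0 (t + 1)]
    have hCK : C ≤ c / 2 * K := by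
      have : 0 ≤ ∑ i ∈ Finset.range (T + 1), |v i| / r i :=
        Finset.sum_nonneg fun i _ => div_nonneg (abs_nonneg _) (hr i).le
      have h4 : c / 2 * (2 * C / c) = C := by field_simp
      calc C = c / 2 * (2 * C / c) := h4.symm
        _ ≤ c / 2 * K := mul_le_mul_of_nonneg_left (by simp only [K]; linarith) (by positivity)
    calc b (t + 1) * v t + f (t + 1)
        ≤ b (t + 1) * (K * r t) + C * y * r (t + 1) :=
          add_le_add (mul_le_mul_of_nonneg_left (ih) (hb0 _)) h2
      _ ≤ (1 - c * y) * (K * r t) + C * y * r (t + 1) := by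
          gcongr
          exact mul_nonneg hK0 (hr t).le
      _ ≤ (1 - c * y) * (K * (r (t + 1) * (1 + c / 2 * y))) + C * y * r (t + 1) := by
          have : r t ≤ r (t + 1) * (1 + c / 2 * y) := hrt.trans (by gcongr)
          have h5 : 0 ≤ 1 - c * y := by linarith
          gcongr
      _ ≤ (1 - c * y) * (K * (r (t + 1) * (1 + c / 2 * y))) + c / 2 * K * y * r (t + 1) := by
          gcongr
      -- `(1 - cy)(1 + cy/2) + cy/2 = 1 - (cy)²/2`.
      _ = K * r (t + 1) * (1 - c * y * (c / 2 * y)) := by ring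
      _ ≤ K * r (t + 1) * 1 := by
          refine mul_le_mul_of_nonneg_left ?_ (by positivity)
          have : 0 ≤ c * y * (c / 2 * y) := by positivity
          linarith
      _ = _ := mul_one _

/-! ### Rates of the coefficients and decay of the fourth moment -/

namespace Params

variable {p : Params}

/-- The exponent of the learning rate in `t`. -/
noncomputable def decay (p : Params) : ℝ := p.alpha - p.rho * p.beta

/-- The `L⁴` decay rate of the error of the non-averaged iterates. -/
noncomputable def errRate (p : Params) (i : ℕ) : ℝ :=
  ((i + 1 : ℕ) : ℝ) ^ (-(p.rho * p.sigma + p.decay / 2)) +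
    if p.Bnu ≠ 0 then ((i + 1 : ℕ) : ℝ) ^ (-(p.rho * p.nu)) else 0

/-- The multiplicative coefficient of the fourth moment recursion. -/
noncomputable def contraction (p : Params) (t : ℕ) : ℝ :=
  1 - p.rate t * (2 * p.mu - 4 * p.depRate t * p.Dnu - 12 * (p.muNu / 32)) +
    8 * p.rate t ^ 2 * (1 + p.Ckappa ^ 4) + 24 * p.rate t ^ 4 * p.Ckappa ^ 4

/-- The additive term of the fourth moment recursion. -/
noncomputable def forcing (p : Params) (t : ℕ) : ℝ :=
  p.rate t * ((p.muNu / 32)⁻¹ ^ 3 * p.depRate t ^ 4 * p.Bnu ^ 4) +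
    8 * p.rate t ^ 3 * p.noiseRate t ^ 4 / (p.muNu / 32) +
    24 * p.rate t ^ 4 * p.noiseRate t ^ 4

lemma errRate_nonneg (p : Params) (i : ℕ) : 0 ≤ p.errRate i := by
  unfold errRate
  split_ifs <;> positivity

lemma Valid.rpow_rho_le_batch (hp : p.Valid) (t : ℕ) : (t : ℝ) ^ p.rho ≤ p.batch t :=
  (le_mul_of_one_le_left (by positivity) hp.one_le_Crho).trans (p.batch_ge t)

lemma Valid.batch_rpow_neg_le (hp : p.Valid) {s : ℝ} (hs : 0 ≤ s) {t : ℕ} (ht : 1 ≤ t) :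
    (p.batch t : ℝ) ^ (-s) ≤ (t : ℝ) ^ (-(p.rho * s)) := by
  have ht0 : (0 : ℝ) < t := by exact_mod_cast ht
  rw [show -(p.rho * s) = p.rho * -s by ring, Real.rpow_mul ht0.le]
  exact Real.rpow_le_rpow_of_nonpos (by positivity) (hp.rpow_rho_le_batch t) (by linarith)

lemma Valid.rate_pos (hp : p.Valid) {t : ℕ} (ht : 1 ≤ t) : 0 < p.rate t := by
  have ht0 : (0 : ℝ) < t := by exact_mod_cast ht
  have := hp.batch_pos ht
  have := hp.Cgamma_pos
  unfold rate
  positivity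

lemma Valid.rate_ge (hp : p.Valid) {t : ℕ} (ht : 1 ≤ t) :
    p.Cgamma * (t : ℝ) ^ (-p.decay) ≤ p.rate t := by
  have ht0 : (0 : ℝ) < t := by exact_mod_cast ht
  have hb := hp.beta_mem.1
  have hg := hp.Cgamma_pos
  have h : (t : ℝ) ^ (p.rho * p.beta) ≤ (p.batch t : ℝ) ^ p.beta := by
    rw [Real.rpow_mul ht0.le]
    exact Real.rpow_le_rpow (by positivity) (hp.rpow_rho_le_batch t) hb
  have h2 : (t : ℝ) ^ (-p.decay) = (t : ℝ) ^ (p.rho * p.beta) * (t : ℝ) ^ (-p.alpha) := by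
    rw [← Real.rpow_add ht0]; congr 1; unfold decay; ring
  rw [h2, rate, mul_assoc]
  gcongr

lemma Valid.rate_le (hp : p.Valid) {t : ℕ} (ht : 1 ≤ t) :
    p.rate t ≤ p.Cgamma * (2 * p.Crho) ^ p.beta * (t : ℝ) ^ (-p.decay) := by
  have ht0 : (0 : ℝ) < t := by exact_mod_cast ht
  have hb := hp.beta_mem.1
  have hg := hp.Cgamma_pos
  have h : (p.batch t : ℝ) ^ p.beta ≤ (2 * p.Crho) ^ p.beta * (t : ℝ) ^ (p.rho * p.beta) := by
    rw [Real.rpow_mul ht0.le, ← Real.mul_rpow (by positivity) (by positivity)]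
    exact Real.rpow_le_rpow (by positivity) (hp.batch_le ht) hb
  have h2 : (t : ℝ) ^ (-p.decay) = (t : ℝ) ^ (p.rho * p.beta) * (t : ℝ) ^ (-p.alpha) := by
    rw [← Real.rpow_add ht0]; congr 1; unfold decay; ring
  rw [h2, rate]
  calc _ ≤ p.Cgamma * ((2 * p.Crho) ^ p.beta * (t : ℝ) ^ (p.rho * p.beta)) *
        (t : ℝ) ^ (-p.alpha) := by gcongr
    _ = _ := by ring

lemma Valid.depRate_le (hp : p.Valid) {t : ℕ} (ht : 1 ≤ t) :
    p.depRate t ≤ (t : ℝ) ^ (-(p.rho * p.nu)) :=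
  hp.batch_rpow_neg_le hp.nu_pos.le ht

lemma depRate_nonneg (p : Params) (t : ℕ) : 0 ≤ p.depRate t := by unfold depRate; positivity

lemma Valid.noiseRate_nonneg (hp : p.Valid) (t : ℕ) : 0 ≤ p.noiseRate t := by
  have := hp.Csigma_pos
  unfold noiseRate; positivity

lemma Valid.noiseRate_le (hp : p.Valid) {t : ℕ} (ht : 1 ≤ t) :
    p.noiseRate t ≤ p.Csigma * (t : ℝ) ^ (-(p.rho * p.sigma)) :=
  mul_le_mul_of_nonneg_left (hp.batch_rpow_neg_le hp.sigma_mem.1 ht) hp.Csigma_pos.le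

lemma tendsto_natCast_rpow_neg {s : ℝ} (hs : 0 < s) :
    Tendsto (fun t : ℕ => (t : ℝ) ^ (-s)) atTop (𝓝 0) :=
  (tendsto_rpow_neg_atTop hs).comp tendsto_natCast_atTop_atTop

lemma Valid.tendsto_rate (hp : p.Valid) (ha : 0 < p.decay) : Tendsto p.rate atTop (𝓝 0) := by
  have h := (tendsto_natCast_rpow_neg ha).const_mul (p.Cgamma * (2 * p.Crho) ^ p.beta)
  rw [mul_zero] at h
  refine tendsto_of_tendsto_of_tendsto_of_le_of_le' tendsto_const_nhds h ?_ ?_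
  · filter_upwards [eventually_ge_atTop 1] with t ht using (hp.rate_pos ht).le
  · filter_upwards [eventually_ge_atTop 1] with t ht using hp.rate_le ht

/-- The term `12 (μ_ν / 32)` takes only `3/8` of `μ_ν`. If `ρ = 0`, then `ν_t = C_ρ^(-ν)` for all `t
≥ 1` and `2μ - 4 ν_t D_ν` is exactly `2 μ_ν`. If `ρ > 0`, then `ν_t` tends to `0` and the dependence
is eventually negligible against `μ_ν = μ`. -/
lemma Valid.eventually_muNu_le (hp : p.Valid) (hmu : 0 < p.muNu) :
    ∀ᶠ t : ℕ in atTop, p.muNu ≤ 2 * p.mu - 4 * p.depRate t * p.Dnu - 12 * (p.muNu / 32) := by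
  by_cases h0 : p.rho = 0
  · filter_upwards [eventually_ge_atTop 1] with t ht
    have hb : p.batch t = p.Crho := by simp [batch, h0]
    have h1 : p.muNu = p.mu - 2 * p.Dnu * p.depRate t := by
      simp [muNu, h0, depRate, hb]
    linarith
  · have hr : 0 < p.rho := lt_of_le_of_ne hp.rho_nonneg (Ne.symm h0)
    have h1 : p.muNu = p.mu := by simp [muNu, h0]
    have h2 : Tendsto (fun t : ℕ => 4 * (t : ℝ) ^ (-(p.rho * p.nu)) * p.Dnu) atTop (𝓝 0) := by
      have := ((tendsto_natCast_rpow_neg (mul_pos hr hp.nu_pos)).const_mul 4).mul_const p.Dnu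
      simpa using this
    filter_upwards [eventually_ge_atTop 1, h2.eventually_le_const (by positivity : 0 < p.muNu / 2)]
      with t ht h3
    have h4 := hp.depRate_le ht
    have h5 : 4 * p.depRate t * p.Dnu ≤ 4 * (t : ℝ) ^ (-(p.rho * p.nu)) * p.Dnu := by
      have := hp.Dnu_nonneg
      gcongr
    linarith

/-- The terms of order `γ²` and `γ⁴` eventually cost at most half of the drift `γ μ_ν`. The
truncation at `0` is there because `exists_bound_of_recursion` compares solutions through a
nonnegative coefficient. -/
lemma Valid.eventually_contraction_le (hp : p.Valid) (hmu : 0 < p.muNu) (ha : 0 < p.decay) :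
    ∀ᶠ t : ℕ in atTop, max (p.contraction t) 0 ≤
      1 - p.Cgamma * p.muNu / 2 * (t : ℝ) ^ (-p.decay) := by
  have hg := hp.tendsto_rate ha
  have h1 : Tendsto (fun t => 8 * p.rate t * (1 + p.Ckappa ^ 4) +
      24 * p.rate t ^ 3 * p.Ckappa ^ 4) atTop (𝓝 0) := by
    have := ((hg.const_mul 8).mul_const (1 + p.Ckappa ^ 4)).add
      (((hg.pow 3).const_mul 24).mul_const (p.Ckappa ^ 4))
    simpa using this
  have h2 : Tendsto (fun t : ℕ => p.Cgamma * p.muNu / 2 * (t : ℝ) ^ (-p.decay)) atTop (𝓝 0) := by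
    simpa using (tendsto_natCast_rpow_neg ha).const_mul (p.Cgamma * p.muNu / 2)
  filter_upwards [eventually_ge_atTop 1, hp.eventually_muNu_le hmu,
    h1.eventually_le_const (by positivity : 0 < p.muNu / 2),
    h2.eventually_le_const zero_lt_one] with t ht h3 h4 h5
  refine max_le ?_ (by linarith)
  have hpos := hp.rate_pos ht
  have hge := hp.rate_ge ht
  have h6 := mul_le_mul_of_nonneg_left h3 hpos.le
  have h7 := mul_le_mul_of_nonneg_left h4 hpos.le
  have h8 := mul_le_mul_of_nonneg_left hge (by positivity : 0 ≤ p.muNu / 2)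
  unfold contraction
  linarith

lemma natCast_rpow_neg_le_succ {m : ℝ} (hm : 0 ≤ m) {t : ℕ} (ht : 1 ≤ t) :
    (t : ℝ) ^ (-m) ≤ 2 ^ m * ((t + 1 : ℕ) : ℝ) ^ (-m) := by
  have ht0 : (0 : ℝ) < t := by exact_mod_cast ht
  have ht1 : (1 : ℝ) ≤ t := by exact_mod_cast ht
  have h : ((t + 1 : ℕ) : ℝ) ≤ 2 * t := by push_cast; linarith
  have h1 := Real.rpow_le_rpow_of_nonpos (by positivity) h (by linarith : -m ≤ 0)
  rw [Real.mul_rpow (by norm_num) ht0.le, Real.rpow_neg (by norm_num : (0 : ℝ) ≤ 2)] at h1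
  have h2 : (0 : ℝ) < 2 ^ m := by positivity
  calc (t : ℝ) ^ (-m) = 2 ^ m * ((2 ^ m)⁻¹ * (t : ℝ) ^ (-m)) := by field_simp
    _ ≤ _ := mul_le_mul_of_nonneg_left h1 h2.le

/-- Slow variation of the rate, in the form required by `exists_bound_of_recursion`: `(1 + 1/x)^m ≤
e^(m/x) ≤ 1 + (m/x) e^m` for `x ≥ 1`. -/
lemma succ_rpow_neg_le {m : ℝ} (hm : 0 ≤ m) (t : ℕ) :
    ((t + 1 : ℕ) : ℝ) ^ (-m) ≤ ((t + 1 + 1 : ℕ) : ℝ) ^ (-m) *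
      (1 + m * Real.exp m / ((t + 1 : ℕ) : ℝ)) := by
  set x : ℝ := ((t + 1 : ℕ) : ℝ) with hx
  have hx1 : 1 ≤ x := by rw [hx]; push_cast; linarith [(Nat.cast_nonneg t : (0 : ℝ) ≤ t)]
  have hx0 : 0 < x := by linarith
  have hy : ((t + 1 + 1 : ℕ) : ℝ) = x * (1 + 1 / x) := by
    rw [hx]; push_cast; field_simp
  rw [hy, Real.mul_rpow hx0.le (by positivity), mul_assoc]
  refine le_mul_of_one_le_right (by positivity) ?_
  rw [Real.rpow_neg (by positivity), inv_mul_eq_div, le_div_iff₀ (by positivity), one_mul]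
  have h1 : (1 + 1 / x) ^ m ≤ Real.exp (m / x) := by
    rw [Real.rpow_def_of_pos (by positivity)]
    refine Real.exp_le_exp.2 ?_
    have := Real.log_le_sub_one_of_pos (x := 1 + 1 / x) (by positivity)
    calc Real.log (1 + 1 / x) * m ≤ (1 / x) * m := by gcongr; linarith
      _ = m / x := by ring
  refine h1.trans ?_
  have h2 := Real.add_one_le_exp (-(m / x))
  have h3 : Real.exp (m / x) * Real.exp (-(m / x)) = 1 := by rw [← Real.exp_add]; simp
  have h4 : Real.exp (m / x) ≤ Real.exp m := Real.exp_le_exp.2 (div_le_self hm hx1)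
  have h5 := mul_le_mul_of_nonneg_left h2 (Real.exp_pos (m / x)).le
  have h6 := mul_le_mul_of_nonneg_left h4 (by positivity : 0 ≤ m / x)
  calc Real.exp (m / x) ≤ 1 + m / x * Real.exp (m / x) := by nlinarith
    _ ≤ 1 + m / x * Real.exp m := by linarith
    _ = _ := by ring

/-- Since `γ³σ⁴ = γ (γ^(1/2) σ)⁴`, the noise forces the recursion by `γ` times the fourth power of
the target rate; the bias does so by `γ ν⁴`. Rates are taken at `t + 1`, as in `errRate`, which is
thus positive at `t = 0`; the shift costs the factors `2 ^ m1` and `2 ^ m2`. -/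
lemma Valid.eventually_forcing_le (hp : p.Valid) (hmu : 0 < p.muNu) (ha : 0 < p.decay) :
    ∃ C : ℝ, 0 ≤ C ∧ ∀ t : ℕ, 1 ≤ t → p.forcing t ≤ C * (t : ℝ) ^ (-p.decay) *
      (((t + 1 : ℕ) : ℝ) ^ (-(4 * (p.rho * p.sigma + p.decay / 2))) +
        if p.Bnu ≠ 0 then ((t + 1 : ℕ) : ℝ) ^ (-(4 * (p.rho * p.nu))) else 0) := by
  have hr := hp.rho_nonneg
  have hs := hp.sigma_mem.1
  have hnu := hp.nu_pos
  have hg := hp.Cgamma_pos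
  have hCs := hp.Csigma_pos
  set ε : ℝ := p.muNu / 32 with hε
  have hε0 : 0 < ε := by positivity
  set g : ℝ := p.Cgamma * (2 * p.Crho) ^ p.beta with hgdef
  have hg0 : 0 ≤ g := by positivity
  set m1 : ℝ := 4 * (p.rho * p.sigma + p.decay / 2) with hm1
  set m2 : ℝ := 4 * (p.rho * p.nu) with hm2
  have hm10 : 0 ≤ m1 := by positivity
  have hm20 : 0 ≤ m2 := by positivity
  refine ⟨g * (ε⁻¹ ^ 3 * p.Bnu ^ 4) * 2 ^ m2 +
    (8 * g ^ 3 / ε + 24 * g ^ 4) * p.Csigma ^ 4 * 2 ^ m1, by positivity, fun t ht => ?_⟩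
  have ht0 : (0 : ℝ) < t := by exact_mod_cast ht
  have ht1 : (1 : ℝ) ≤ t := by exact_mod_cast ht
  have hrate := hp.rate_le ht
  rw [← hgdef] at hrate
  have hrpos := hp.rate_pos ht
  set y : ℝ := (t : ℝ) ^ (-p.decay) with hy
  have hy0 : 0 < y := by positivity
  have hy1 : y ≤ 1 := Real.rpow_le_one_of_one_le_of_nonpos ht1 (by linarith)
  have hnoise : p.noiseRate t ^ 4 ≤ p.Csigma ^ 4 * (t : ℝ) ^ (-(4 * (p.rho * p.sigma))) := by
    have := pow_le_pow_left₀ (hp.noiseRate_nonneg t) (hp.noiseRate_le ht) 4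
    rwa [mul_pow, ← Real.rpow_mul_natCast ht0.le,
      show -(p.rho * p.sigma) * (4 : ℕ) = -(4 * (p.rho * p.sigma)) by push_cast; ring] at this
  have hdep : p.depRate t ^ 4 ≤ (t : ℝ) ^ (-m2) := by
    have := pow_le_pow_left₀ (p.depRate_nonneg t) (hp.depRate_le ht) 4
    rwa [← Real.rpow_mul_natCast ht0.le,
      show -(p.rho * p.nu) * (4 : ℕ) = -m2 by rw [hm2]; push_cast; ring] at this
  have hy2 : y ^ 2 * (t : ℝ) ^ (-(4 * (p.rho * p.sigma))) = (t : ℝ) ^ (-m1) := by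
    rw [hy, ← Real.rpow_mul_natCast ht0.le, ← Real.rpow_add ht0]
    congr 1; rw [hm1]; push_cast; ring
  have e1 := natCast_rpow_neg_le_succ hm10 ht
  have e2 := natCast_rpow_neg_le_succ hm20 ht
  set A : ℝ := ((t + 1 : ℕ) : ℝ) ^ (-m1) with hA
  set B : ℝ := ((t + 1 : ℕ) : ℝ) ^ (-m2) with hB
  have hA0 : 0 ≤ A := by positivity
  have hB0 : 0 ≤ B := by positivity
  have T1 : p.rate t * (ε⁻¹ ^ 3 * p.depRate t ^ 4 * p.Bnu ^ 4) ≤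
      (g * (ε⁻¹ ^ 3 * p.Bnu ^ 4) * 2 ^ m2) * y * (if p.Bnu ≠ 0 then B else 0) := by
    by_cases hB' : p.Bnu = 0
    · simp [hB']
    · rw [if_pos hB']
      have := hp.Bnu_nonneg
      calc _ ≤ (g * y) * (ε⁻¹ ^ 3 * (2 ^ m2 * B) * p.Bnu ^ 4) := by
            gcongr
            exact hdep.trans e2
        _ = _ := by ring
  have hpow : ∀ k : ℕ, p.rate t ^ k ≤ g ^ k * y ^ k := fun k => by
    rw [← mul_pow]; exact pow_le_pow_left₀ hrpos.le hrate k
  have hyA : y ^ 2 * p.noiseRate t ^ 4 ≤ p.Csigma ^ 4 * (2 ^ m1 * A) := by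
    calc _ ≤ y ^ 2 * (p.Csigma ^ 4 * (t : ℝ) ^ (-(4 * (p.rho * p.sigma)))) := by gcongr
      _ = p.Csigma ^ 4 * (t : ℝ) ^ (-m1) := by rw [← hy2]; ring
      _ ≤ _ := by gcongr
  have hnz := hp.noiseRate_nonneg t
  have T2 : 8 * p.rate t ^ 3 * p.noiseRate t ^ 4 / ε ≤
      8 * g ^ 3 / ε * p.Csigma ^ 4 * 2 ^ m1 * y * A := by
    calc _ ≤ 8 * (g ^ 3 * y ^ 3) * p.noiseRate t ^ 4 / ε := by gcongr; exact hpow 3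
      _ = 8 * g ^ 3 / ε * y * (y ^ 2 * p.noiseRate t ^ 4) := by ring
      _ ≤ 8 * g ^ 3 / ε * y * (p.Csigma ^ 4 * (2 ^ m1 * A)) := by gcongr
      _ = _ := by ring
  have T3 : 24 * p.rate t ^ 4 * p.noiseRate t ^ 4 ≤
      24 * g ^ 4 * p.Csigma ^ 4 * 2 ^ m1 * y * A := by
    calc _ ≤ 24 * (g ^ 4 * y ^ 4) * p.noiseRate t ^ 4 := by gcongr; exact hpow 4
      _ = 24 * g ^ 4 * y * y * (y ^ 2 * p.noiseRate t ^ 4) := by ring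
      _ ≤ 24 * g ^ 4 * y * 1 * (p.Csigma ^ 4 * (2 ^ m1 * A)) := by gcongr
      _ = _ := by ring
  have hif : 0 ≤ (if p.Bnu ≠ 0 then B else 0) := by split_ifs <;> simp [hB0]
  set I : ℝ := if p.Bnu ≠ 0 then B else 0 with hI
  unfold forcing
  rw [← hε]
  have c1 : 0 ≤ (g * (ε⁻¹ ^ 3 * p.Bnu ^ 4) * 2 ^ m2) * y * A := by positivity
  have c2 : 0 ≤ (8 * g ^ 3 / ε + 24 * g ^ 4) * p.Csigma ^ 4 * 2 ^ m1 * y * I := by positivity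
  linarith

lemma Valid.exists_fourth_moment_bound (hp : p.Valid) (hmu : 0 < p.muNu) (ha : 0 < p.decay)
    (ha1 : p.decay < 1) :
    ∃ K : ℝ, 0 ≤ K ∧ ∀ u : ℕ → ℝ, (∀ t, 0 ≤ u t) → u 0 ≤ p.Delta0 →
      (∀ t, u (t + 1) ≤ p.contraction (t + 1) * u t + p.forcing (t + 1)) →
      ∀ t, u t ≤ (K * p.errRate t) ^ 4 := by
  have hr := hp.rho_nonneg
  have hs := hp.sigma_mem.1
  have hnu := hp.nu_pos
  have hg := hp.Cgamma_pos
  obtain ⟨C, hC0, hC⟩ := hp.eventually_forcing_le hmu ha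
  set m1 : ℝ := 4 * (p.rho * p.sigma + p.decay / 2) with hm1
  set m2 : ℝ := 4 * (p.rho * p.nu) with hm2
  have hm10 : 0 ≤ m1 := by positivity
  have hm20 : 0 ≤ m2 := by positivity
  let r : ℕ → ℝ := fun t => ((t + 1 : ℕ) : ℝ) ^ (-m1) +
        if p.Bnu ≠ 0 then ((t + 1 : ℕ) : ℝ) ^ (-m2) else 0
  have hr0 : ∀ t, 0 < r t := by
    intro t
    have : (0 : ℝ) < ((t + 1 : ℕ) : ℝ) ^ (-m1) := by positivity
    simp only [r]
    split_ifs <;> positivity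
  have hrm : ∀ t : ℕ, r t ≤ r (t + 1) *
      (1 + (m1 * Real.exp m1 + m2 * Real.exp m2) / ((t + 1 : ℕ) : ℝ)) := by
    intro t
    have h1 := succ_rpow_neg_le hm10 t
    have h2 := succ_rpow_neg_le hm20 t
    have q1 : 0 ≤ m1 * Real.exp m1 / ((t + 1 : ℕ) : ℝ) := by positivity
    have q2 : 0 ≤ m2 * Real.exp m2 / ((t + 1 : ℕ) : ℝ) := by positivity
    have p1 : 0 ≤ ((t + 1 + 1 : ℕ) : ℝ) ^ (-m1) := by positivity
    have p2 : 0 ≤ ((t + 1 + 1 : ℕ) : ℝ) ^ (-m2) := by positivity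
    simp only [r, add_div]
    split_ifs
    · have := mul_nonneg p1 q2
      have := mul_nonneg p2 q1
      linarith
    · have := mul_nonneg p1 q2
      linarith
  obtain ⟨K, hK0, hK⟩ := exists_bound_of_recursion (b := fun t => max (p.contraction t) 0)
    (f := p.forcing) (r := r) (a := p.decay) (c := p.Cgamma * p.muNu / 2) (C := C)
    (m := m1 * Real.exp m1 + m2 * Real.exp m2) ha1 (by positivity) hC0 hr0 hrm
    (fun t => le_max_right _ _) (hp.eventually_contraction_le hmu ha)
    (by filter_upwards [eventually_ge_atTop 1] with t ht using hC t ht) p.Delta0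
  -- `K + 1` and not `K`, because `K ≤ K^4` may fail below `1`.
  refine ⟨K + 1, by positivity, fun u hu hu0 hrec t => ?_⟩
  have h1 := hK u hu0 (fun t => (hrec t).trans (by
    have := mul_le_mul_of_nonneg_right (le_max_left (p.contraction (t + 1)) 0) (hu t)
    linarith)) t
  refine h1.trans ?_
  have hrz : r t ≤ p.errRate t ^ 4 := by
    have e : ∀ s : ℝ, ((t + 1 : ℕ) : ℝ) ^ (-(4 * s)) = (((t + 1 : ℕ) : ℝ) ^ (-s)) ^ 4 := by
      intro s
      rw [← Real.rpow_mul_natCast (by positivity)]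
      congr 1; push_cast; ring
    simp only [r, hm1, hm2, errRate, e]
    split_ifs
    · set x : ℝ := ((t + 1 : ℕ) : ℝ) ^ (-(p.rho * p.sigma + p.decay / 2))
      set y : ℝ := ((t + 1 : ℕ) : ℝ) ^ (-(p.rho * p.nu))
      have hx : 0 ≤ x := by positivity
      have hy : 0 ≤ y := by positivity
      have : 0 ≤ 4 * x ^ 3 * y + 6 * x ^ 2 * y ^ 2 + 4 * x * y ^ 3 := by positivity
      nlinarith
    · simp
  calc K * r t ≤ (K + 1) ^ 4 * p.errRate t ^ 4 := by
        have hK1 : K ≤ (K + 1) ^ 4 := by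
          have : (K + 1) ^ 1 ≤ (K + 1) ^ 4 := pow_le_pow_right₀ (by linarith) (by norm_num)
          linarith
        have := (hr0 t).le
        gcongr
    _ = _ := by rw [mul_pow]

end Params

/-! ### Orders of the weighted sums of error rates, in `t` and in `N_t` -/

lemma sum_range_succ_eq_sum_Icc (f : ℕ → ℝ) (t : ℕ) :
    ∑ i ∈ Finset.range t, f (i + 1) = ∑ i ∈ Finset.Icc 1 t, f i := by
  induction t with
  | zero => simp
  | succ t ih => rw [Finset.sum_range_succ, ih, Finset.sum_Icc_succ_top (by omega)]

lemma sqrt_add_le {x y : ℝ} (hx : 0 ≤ x) (hy : 0 ≤ y) : √(x + y) ≤ √x + √y := by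
  rw [Real.sqrt_le_left (by positivity), add_sq, Real.sq_sqrt hx, Real.sq_sqrt hy]
  have := mul_nonneg (Real.sqrt_nonneg x) (Real.sqrt_nonneg y)
  linarith

namespace Params

variable {p : Params}

/-- The order, in `t` and up to logarithms, of all the terms of lower order. -/
noncomputable def remainder (p : Params) (t : ℕ) : ℝ :=
  (t : ℝ) ^ (-(1 + p.rho * p.sigma - p.decay / 2)) +
    (t : ℝ) ^ (-(2 * (p.rho * p.sigma + p.decay / 2))) +
    (if p.Dnu ≠ 0 then (t : ℝ) ^ (-(p.rho * p.nu + (p.rho * p.sigma + p.decay / 2))) else 0) +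
    (if p.Bnu ≠ 0 then (t : ℝ) ^ (-(p.rho * p.nu)) else 0)

/-- The weight `n_t / γ_t`. -/
noncomputable def weight (p : Params) (t : ℕ) : ℝ := p.batch t / p.rate t

/-- Absorbs the `+ 1` of `sum_rpow_le`. It is dominated by `N_t t^(-e)`, up to a constant, for every
`e ≤ 1 + ρ`; the choice `e = 1 + ρσ - decay/2` is admissible and is an exponent of `remainder`
anyway, so nothing is lost. -/
lemma Valid.rpow_add_one_le (hp : p.Valid) (ha : 0 < p.decay) (s : ℝ) {t : ℕ} (ht : 1 ≤ t) :
    (t : ℝ) ^ (1 + p.rho - s) + 1 ≤ 2 * p.total t *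
      ((t : ℝ) ^ (-s) + (t : ℝ) ^ (-(1 + p.rho * p.sigma - p.decay / 2))) := by
  have ht0 : (0 : ℝ) < t := by exact_mod_cast ht
  have ht1 : (1 : ℝ) ≤ t := by exact_mod_cast ht
  have hN : (t : ℝ) ^ (1 + p.rho) ≤ 2 * p.total t := by
    have h1 := hp.total_ge t
    have h2 := hp.one_le_Crho
    have h3 : 0 ≤ (t : ℝ) ^ (1 + p.rho) := by positivity
    have h4 := hp.rho_mem.2
    have h5 := hp.total_pos ht
    nlinarith
  have h1 : (1 : ℝ) ≤ (t : ℝ) ^ (1 + p.rho) * (t : ℝ) ^ (-(1 + p.rho * p.sigma - p.decay / 2)) := by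
    rw [← Real.rpow_add ht0]
    refine Real.one_le_rpow ht1 ?_
    have := mul_le_mul_of_nonneg_left hp.sigma_mem.2 hp.rho_nonneg
    have := hp.rho_nonneg
    linarith
  have h2 : (t : ℝ) ^ (1 + p.rho - s) = (t : ℝ) ^ (1 + p.rho) * (t : ℝ) ^ (-s) := by
    rw [← Real.rpow_add ht0, sub_eq_add_neg]
  calc _ ≤ (t : ℝ) ^ (1 + p.rho) *
        ((t : ℝ) ^ (-s) + (t : ℝ) ^ (-(1 + p.rho * p.sigma - p.decay / 2))) := by
        rw [h2]; linarith
    _ ≤ _ := mul_le_mul_of_nonneg_right hN (by positivity)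

lemma Valid.sum_batch_mul_rpow_le (hp : p.Valid) (ha : 0 < p.decay) (s : ℝ) {t : ℕ}
    (ht : 1 ≤ t) :
    ∑ i ∈ Finset.range t, (p.batch (i + 1) : ℝ) * ((i + 1 : ℕ) : ℝ) ^ (-s) ≤
      4 * p.Crho * p.total t * (1 + Real.log t) *
        ((t : ℝ) ^ (-s) + (t : ℝ) ^ (-(1 + p.rho * p.sigma - p.decay / 2))) := by
  have hlog : 0 ≤ Real.log t := Real.log_nonneg (by exact_mod_cast ht)
  rw [sum_range_succ_eq_sum_Icc (fun i => (p.batch i : ℝ) * (i : ℝ) ^ (-s))]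
  calc ∑ i ∈ Finset.Icc 1 t, (p.batch i : ℝ) * (i : ℝ) ^ (-s)
      ≤ ∑ i ∈ Finset.Icc 1 t, 2 * p.Crho * (i : ℝ) ^ (p.rho - s) := by
        refine Finset.sum_le_sum fun i hi => ?_
        have hi := (Finset.mem_Icc.1 hi).1
        have hi0 : (0 : ℝ) < i := by exact_mod_cast hi
        rw [sub_eq_add_neg, Real.rpow_add hi0, ← mul_assoc]
        exact mul_le_mul_of_nonneg_right (hp.batch_le hi) (by positivity)
    _ = 2 * p.Crho * ∑ i ∈ Finset.Icc 1 t, (i : ℝ) ^ (p.rho - s) := by rw [Finset.mul_sum]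
    _ ≤ 2 * p.Crho * ((1 + Real.log t) * ((t : ℝ) ^ (1 + p.rho - s) + 1)) := by
        have := sum_rpow_le (p.rho - s) ht
        rw [show p.rho - s + 1 = 1 + p.rho - s by ring] at this
        gcongr
    _ ≤ 2 * p.Crho * ((1 + Real.log t) * (2 * p.total t *
        ((t : ℝ) ^ (-s) + (t : ℝ) ^ (-(1 + p.rho * p.sigma - p.decay / 2))))) := by
        have := hp.rpow_add_one_le ha s ht
        gcongr
    _ = _ := by ring

/-- The quadratic counterpart of `sum_batch_mul_rpow_le`, for orthogonal summands: orthogonality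
improves the exponent from `s` to `1/2 + s`. -/
lemma Valid.sqrt_sum_batch_sq_mul_rpow_le (hp : p.Valid) (ha : 0 < p.decay) (s : ℝ) {t : ℕ}
    (ht : 1 ≤ t) :
    √(∑ i ∈ Finset.range t, (p.batch (i + 1) : ℝ) ^ 2 * (((i + 1 : ℕ) : ℝ) ^ (-s)) ^ 2) ≤
      4 * p.Crho * p.total t * (1 + Real.log t) *
        ((t : ℝ) ^ (-(1 / 2 + s)) + (t : ℝ) ^ (-(1 + p.rho * p.sigma - p.decay / 2))) := by
  have ht0 : (0 : ℝ) < t := by exact_mod_cast ht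
  have hlog : 0 ≤ Real.log t := Real.log_nonneg (by exact_mod_cast ht)
  rw [sum_range_succ_eq_sum_Icc (fun i => (p.batch i : ℝ) ^ 2 * ((i : ℝ) ^ (-s)) ^ 2)]
  have h1 : ∑ i ∈ Finset.Icc 1 t, (p.batch i : ℝ) ^ 2 * ((i : ℝ) ^ (-s)) ^ 2 ≤
      (2 * p.Crho) ^ 2 * ((1 + Real.log t) * ((t : ℝ) ^ (2 * p.rho - 2 * s + 1) + 1)) := by
    calc ∑ i ∈ Finset.Icc 1 t, (p.batch i : ℝ) ^ 2 * ((i : ℝ) ^ (-s)) ^ 2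
        ≤ ∑ i ∈ Finset.Icc 1 t, (2 * p.Crho) ^ 2 * (i : ℝ) ^ (2 * p.rho - 2 * s) := by
          refine Finset.sum_le_sum fun i hi => ?_
          have hi := (Finset.mem_Icc.1 hi).1
          have hi0 : (0 : ℝ) < i := by exact_mod_cast hi
          have : (i : ℝ) ^ (2 * p.rho - 2 * s) = ((i : ℝ) ^ p.rho * (i : ℝ) ^ (-s)) ^ 2 := by
            rw [← Real.rpow_add hi0, ← Real.rpow_mul_natCast hi0.le]
            congr 1; push_cast; ring
          rw [this, ← mul_pow, ← mul_pow, ← mul_assoc]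
          have := hp.batch_le hi
          gcongr
      _ = (2 * p.Crho) ^ 2 * ∑ i ∈ Finset.Icc 1 t, (i : ℝ) ^ (2 * p.rho - 2 * s) := by
        rw [Finset.mul_sum]
      _ ≤ _ := by
        have := sum_rpow_le (2 * p.rho - 2 * s) ht
        gcongr
  have h2 : (2 * p.Crho : ℝ) ^ 2 * ((1 + Real.log t) * ((t : ℝ) ^ (2 * p.rho - 2 * s + 1) + 1)) ≤
      (2 * p.Crho * ((1 + Real.log t) * ((t : ℝ) ^ (1 + p.rho - (1 / 2 + s)) + 1))) ^ 2 := by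
    have e : (t : ℝ) ^ (2 * p.rho - 2 * s + 1) = ((t : ℝ) ^ (1 + p.rho - (1 / 2 + s))) ^ 2 := by
      rw [← Real.rpow_mul_natCast ht0.le]
      congr 1; push_cast; ring
    rw [e, mul_pow (2 * (p.Crho : ℝ)), mul_pow (1 + Real.log t)]
    set y := (t : ℝ) ^ (1 + p.rho - (1 / 2 + s))
    have hy : 0 ≤ y := by positivity
    have l1 : 1 + Real.log t ≤ (1 + Real.log t) ^ 2 := by nlinarith
    have l2 : y ^ 2 + 1 ≤ (y + 1) ^ 2 := by nlinarith
    gcongr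
  calc _ ≤ 2 * p.Crho * ((1 + Real.log t) * ((t : ℝ) ^ (1 + p.rho - (1 / 2 + s)) + 1)) :=
        (Real.sqrt_le_sqrt (h1.trans h2)).trans_eq (Real.sqrt_sq (by positivity))
    _ ≤ 2 * p.Crho * ((1 + Real.log t) * (2 * p.total t *
        ((t : ℝ) ^ (-(1 / 2 + s)) + (t : ℝ) ^ (-(1 + p.rho * p.sigma - p.decay / 2))))) := by
        have := hp.rpow_add_one_le ha (1 / 2 + s) ht
        gcongr
    _ = _ := by ring

/-- A consequence of the conventions `0 ^ (-α) = 0` and `x / 0 = 0`. It leaves summation by parts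
without an initial boundary term. -/
lemma weight_zero (h : 0 < p.alpha) : p.weight 0 = 0 := by
  have : ((0 : ℕ) : ℝ) ^ (-p.alpha) = 0 := by
    rw [Nat.cast_zero, Real.zero_rpow (by linarith)]
  simp only [weight, rate, this, mul_zero, div_zero]

lemma Valid.weight_eq (hp : p.Valid) {t : ℕ} (ht : 1 ≤ t) :
    p.weight t = p.Cgamma⁻¹ * ((p.batch t : ℝ) ^ (1 - p.beta) * (t : ℝ) ^ p.alpha) := by
  have ht0 : (0 : ℝ) < t := by exact_mod_cast ht
  have hb := hp.batch_pos ht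
  have hg := hp.Cgamma_pos
  rw [weight, rate, Real.rpow_neg ht0.le, Real.rpow_sub hb, Real.rpow_one]
  field_simp

lemma Valid.alpha_pos (hp : p.Valid) (ha : 0 < p.decay) : 0 < p.alpha := by
  have := mul_nonneg hp.rho_nonneg hp.beta_mem.1
  unfold decay at ha
  linarith

/-- Both `n_t^(1-β)` and `t^α` increase, so the coefficients produced by summation by parts are
nonnegative. -/
lemma Valid.weight_le_succ (hp : p.Valid) (ha : 0 < p.decay) (t : ℕ) :
    p.weight t ≤ p.weight (t + 1) := by
  have hal := hp.alpha_pos ha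
  have hg := hp.Cgamma_pos
  rcases Nat.eq_zero_or_pos t with rfl | ht
  · rw [weight_zero hal, hp.weight_eq (by omega)]
    positivity
  · rw [hp.weight_eq ht, hp.weight_eq (by omega)]
    have h1 : (p.batch t : ℝ) ≤ p.batch (t + 1) := by exact_mod_cast hp.batch_mono (by omega)
    have h2 : (t : ℝ) ≤ ((t + 1 : ℕ) : ℝ) := by push_cast; linarith
    have h3 : 0 ≤ 1 - p.beta := by linarith [hp.beta_mem.2]
    gcongr

lemma Valid.weight_le (hp : p.Valid) {t : ℕ} (ht : 1 ≤ t) :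
    p.weight t ≤ p.Cgamma⁻¹ * (2 * p.Crho) ^ (1 - p.beta) * (t : ℝ) ^ (p.decay + p.rho) := by
  have ht0 : (0 : ℝ) < t := by exact_mod_cast ht
  have hg := hp.Cgamma_pos
  have h3 : 0 ≤ 1 - p.beta := by linarith [hp.beta_mem.2]
  rw [hp.weight_eq ht]
  have h : (p.batch t : ℝ) ^ (1 - p.beta) ≤
      (2 * p.Crho) ^ (1 - p.beta) * (t : ℝ) ^ (p.rho * (1 - p.beta)) := by
    rw [Real.rpow_mul ht0.le, ← Real.mul_rpow (by positivity) (by positivity)]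
    exact Real.rpow_le_rpow (by positivity) (hp.batch_le ht) h3
  have e : (t : ℝ) ^ (p.decay + p.rho) = (t : ℝ) ^ (p.rho * (1 - p.beta)) * (t : ℝ) ^ p.alpha := by
    rw [← Real.rpow_add ht0]; congr 1; unfold decay; ring
  calc _ ≤ p.Cgamma⁻¹ * ((2 * p.Crho) ^ (1 - p.beta) * (t : ℝ) ^ (p.rho * (1 - p.beta)) *
        (t : ℝ) ^ p.alpha) := by gcongr
    _ = _ := by rw [e]; ring

/-- The weight grows at most like `N_t t^(-(1 - decay))`. Multiplied by the noise rate, of exponent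
`ρσ + decay/2`, it produces the exponent `1 + ρσ - decay/2`. For the bias rate the factor `t^(-(1 -
decay))` is simply dropped. -/
lemma Valid.exists_weight_sum_le (hp : p.Valid) (ha : 0 < p.decay) (ha1 : p.decay < 1) :
    ∃ K : ℝ, 0 ≤ K ∧ ∀ t : ℕ, 1 ≤ t →
      ∑ i ∈ Finset.range t, (p.weight (i + 1) - p.weight i) * p.errRate i +
        p.weight t * p.errRate t ≤ K * (p.total t * (1 + Real.log t) * p.remainder t) := by
  have hg := hp.Cgamma_pos
  have hnu := hp.nu_pos
  have hr := hp.rho_nonneg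
  have hs := hp.sigma_mem.1
  set W : ℝ := p.Cgamma⁻¹ * (2 * p.Crho) ^ (1 - p.beta)
  have hW : 0 ≤ W := by positivity
  set s1 : ℝ := p.rho * p.sigma + p.decay / 2 with hs1
  set s2 : ℝ := p.rho * p.nu with hs2
  have hs10 : 0 ≤ s1 := by positivity
  have hs20 : 0 ≤ s2 := by positivity
  have key : ∀ s : ℝ, 0 ≤ s → ∀ t : ℕ, 1 ≤ t →
      ∑ i ∈ Finset.range t, (p.weight (i + 1) - p.weight i) * ((i + 1 : ℕ) : ℝ) ^ (-s) +
        p.weight t * ((t + 1 : ℕ) : ℝ) ^ (-s) ≤ 2 * W * (s + 2) * (p.total t * (1 + Real.log t) *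
        ((t : ℝ) ^ (-(1 - p.decay + s)) +
          (t : ℝ) ^ (-(1 + p.rho * p.sigma - p.decay / 2)))) := by
    intro s hs t ht
    have hlog : 0 ≤ Real.log t := Real.log_nonneg (by exact_mod_cast ht)
    have h := sum_sub_mul_rpow_le (b := p.decay + p.rho) (weight_zero (hp.alpha_pos ha))
      (fun i hi => hp.weight_le hi) hW hs ht
    have h2 := hp.rpow_add_one_le ha (1 - p.decay + s) ht
    rw [show 1 + p.rho - (1 - p.decay + s) = p.decay + p.rho - s by ring] at h2
    calc _ ≤ _ := h
      _ ≤ W * (s + 2) * ((1 + Real.log t) * (2 * p.total t *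
          ((t : ℝ) ^ (-(1 - p.decay + s)) +
            (t : ℝ) ^ (-(1 + p.rho * p.sigma - p.decay / 2))))) := by gcongr
      _ = _ := by ring
  refine ⟨2 * W * (s1 + 2) * 2 + 2 * W * (s2 + 2), by positivity, fun t ht => ?_⟩
  have ht0 : (0 : ℝ) < t := by exact_mod_cast ht
  have ht1 : (1 : ℝ) ≤ t := by exact_mod_cast ht
  have hlog : 0 ≤ Real.log t := Real.log_nonneg ht1
  have hN := hp.total_pos ht
  have k1 := key s1 hs10 t ht
  have k2 := key s2 hs20 t ht
  set E1 : ℝ := (t : ℝ) ^ (-(1 + p.rho * p.sigma - p.decay / 2)) with hE1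
  have hE10 : 0 ≤ E1 := by positivity
  rw [show -(1 - p.decay + s1) = -(1 + p.rho * p.sigma - p.decay / 2) by rw [hs1]; ring,
    ← hE1] at k1
  have hle : (t : ℝ) ^ (-(1 - p.decay + s2)) ≤ (t : ℝ) ^ (-s2) :=
    Real.rpow_le_rpow_of_exponent_le ht1 (by linarith)
  have hrem0 : 0 ≤ p.remainder t - E1 := by
    unfold remainder
    have h1 : 0 ≤ (t : ℝ) ^ (-(2 * (p.rho * p.sigma + p.decay / 2))) := by positivity
    split_ifs
    all_goals
      rw [← hE1]
      ring_nf
      positivity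
  have hrem1 : p.Bnu ≠ 0 → E1 + (t : ℝ) ^ (-s2) ≤ p.remainder t := by
    intro hB
    unfold remainder
    rw [if_pos hB, ← hE1, ← hs2]
    have h1 : 0 ≤ (t : ℝ) ^ (-(2 * (p.rho * p.sigma + p.decay / 2))) := by positivity
    split_ifs
    · have : 0 ≤ (t : ℝ) ^ (-(s2 + (p.rho * p.sigma + p.decay / 2))) := by positivity
      linarith
    · linarith
  have k1' : ∑ i ∈ Finset.range t, (p.weight (i + 1) - p.weight i) * ((i + 1 : ℕ) : ℝ) ^ (-s1) +
        p.weight t * ((t + 1 : ℕ) : ℝ) ^ (-s1) ≤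
        2 * W * (s1 + 2) * 2 * (p.total t * (1 + Real.log t) * p.remainder t) := by
    calc _ ≤ _ := k1
      _ = 2 * W * (s1 + 2) * 2 * (p.total t * (1 + Real.log t) * E1) := by ring
      _ ≤ _ := by gcongr; linarith
  have hX : 0 ≤ p.total t * (1 + Real.log t) * p.remainder t := by
    have : 0 ≤ p.remainder t := by linarith
    positivity
  by_cases hB : p.Bnu = 0
  · simp only [errRate, hB, ne_eq, not_true, if_false, add_zero]
    have : 0 ≤ 2 * W * (s2 + 2) * (p.total t * (1 + Real.log t) * p.remainder t) := by positivity
    linarith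
  · simp only [errRate, ne_eq, hB, not_false_eq_true, if_true, mul_add, Finset.sum_add_distrib]
    have k2' : ∑ i ∈ Finset.range t, (p.weight (i + 1) - p.weight i) * ((i + 1 : ℕ) : ℝ) ^ (-s2) +
        p.weight t * ((t + 1 : ℕ) : ℝ) ^ (-s2) ≤
        2 * W * (s2 + 2) * (p.total t * (1 + Real.log t) * p.remainder t) := by
      refine k2.trans ?_
      have := hrem1 hB
      gcongr
      linarith
    linarith

lemma remainder_bounds (p : Params) (t : ℕ) :
    0 ≤ p.remainder t ∧
    (t : ℝ) ^ (-(1 + p.rho * p.sigma - p.decay / 2)) +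
      (t : ℝ) ^ (-(2 * (p.rho * p.sigma + p.decay / 2))) ≤ p.remainder t ∧
    (p.Dnu ≠ 0 → (t : ℝ) ^ (-(1 + p.rho * p.sigma - p.decay / 2)) +
      (t : ℝ) ^ (-(p.rho * p.nu + (p.rho * p.sigma + p.decay / 2))) ≤ p.remainder t) ∧
    (p.Bnu ≠ 0 → (t : ℝ) ^ (-(1 + p.rho * p.sigma - p.decay / 2)) +
      (t : ℝ) ^ (-(p.rho * p.nu)) ≤ p.remainder t) := by
  have h1 : 0 ≤ (t : ℝ) ^ (-(1 + p.rho * p.sigma - p.decay / 2)) := by positivity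
  have h2 : 0 ≤ (t : ℝ) ^ (-(2 * (p.rho * p.sigma + p.decay / 2))) := by positivity
  have h3 : 0 ≤ (t : ℝ) ^ (-(p.rho * p.nu + (p.rho * p.sigma + p.decay / 2))) := by positivity
  have h4 : 0 ≤ (t : ℝ) ^ (-(p.rho * p.nu)) := by positivity
  unfold remainder
  refine ⟨?_, ?_, fun hD => ?_, fun hB => ?_⟩
  · split_ifs <;> linarith
  · split_ifs <;> linarith
  · rw [if_pos hD]; split_ifs <;> linarith
  · rw [if_pos hB]; split_ifs <;> linarith

lemma errRate_sq_le (p : Params) (i : ℕ) : p.errRate i ^ 2 ≤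
    2 * (((i + 1 : ℕ) : ℝ) ^ (-(p.rho * p.sigma + p.decay / 2))) ^ 2 +
      if p.Bnu ≠ 0 then 2 * (((i + 1 : ℕ) : ℝ) ^ (-(p.rho * p.nu))) ^ 2 else 0 := by
  unfold errRate
  split_ifs
  · nlinarith [sq_nonneg (((i + 1 : ℕ) : ℝ) ^ (-(p.rho * p.sigma + p.decay / 2)) -
      ((i + 1 : ℕ) : ℝ) ^ (-(p.rho * p.nu)))]
  · nlinarith [sq_nonneg (((i + 1 : ℕ) : ℝ) ^ (-(p.rho * p.sigma + p.decay / 2)))]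

lemma Valid.sum_batch_errRate_sq_le (hp : p.Valid) (ha : 0 < p.decay) {t : ℕ} (ht : 1 ≤ t) :
    ∑ i ∈ Finset.range t, (p.batch (i + 1) : ℝ) * p.errRate i ^ 2 ≤
      16 * p.Crho * (p.total t * (1 + Real.log t) * p.remainder t) := by
  have ht0 : (0 : ℝ) < t := by exact_mod_cast ht
  have ht1 : (1 : ℝ) ≤ t := by exact_mod_cast ht
  have hlog : 0 ≤ Real.log t := Real.log_nonneg ht1
  have hN := hp.total_pos ht
  have hC := hp.one_le_Crho
  have hnu := hp.nu_pos
  have hr := hp.rho_nonneg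
  obtain ⟨r0, r1, -, r3⟩ := p.remainder_bounds t
  have e : ∀ (s : ℝ) (i : ℕ), (((i + 1 : ℕ) : ℝ) ^ (-s)) ^ 2 = ((i + 1 : ℕ) : ℝ) ^ (-(2 * s)) := by
    intro s i
    rw [← Real.rpow_mul_natCast (by positivity)]
    congr 1; push_cast; ring
  have k1 := hp.sum_batch_mul_rpow_le ha (2 * (p.rho * p.sigma + p.decay / 2)) ht
  have k2 := hp.sum_batch_mul_rpow_le ha (2 * (p.rho * p.nu)) ht
  have hsum : ∑ i ∈ Finset.range t, (p.batch (i + 1) : ℝ) * p.errRate i ^ 2 ≤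
      2 * (∑ i ∈ Finset.range t, (p.batch (i + 1) : ℝ) *
        ((i + 1 : ℕ) : ℝ) ^ (-(2 * (p.rho * p.sigma + p.decay / 2)))) +
      if p.Bnu ≠ 0 then 2 * ∑ i ∈ Finset.range t, (p.batch (i + 1) : ℝ) *
        ((i + 1 : ℕ) : ℝ) ^ (-(2 * (p.rho * p.nu))) else 0 := by
    have h1 : ∀ i ∈ Finset.range t, (p.batch (i + 1) : ℝ) * p.errRate i ^ 2 ≤ _ :=
      fun i _ => mul_le_mul_of_nonneg_left (p.errRate_sq_le i) (by positivity)
    refine (Finset.sum_le_sum h1).trans_eq ?_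
    simp only [e]
    split_ifs
    · rw [Finset.mul_sum, Finset.mul_sum, ← Finset.sum_add_distrib]
      exact Finset.sum_congr rfl fun i _ => by ring
    · rw [Finset.mul_sum, add_zero]
      exact Finset.sum_congr rfl fun i _ => by ring
  refine hsum.trans ?_
  have hX : 0 ≤ 4 * p.Crho * p.total t * (1 + Real.log t) := by positivity
  have k1' := k1.trans (mul_le_mul_of_nonneg_left (by linarith : _ ≤ p.remainder t) hX)
  split_ifs with hB
  · have hle : (t : ℝ) ^ (-(2 * (p.rho * p.nu))) ≤ (t : ℝ) ^ (-(p.rho * p.nu)) := by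
      refine Real.rpow_le_rpow_of_exponent_le ht1 ?_
      have : 0 ≤ p.rho * p.nu := by positivity
      linarith
    have k2' := k2.trans (mul_le_mul_of_nonneg_left (by linarith [r3 hB] : _ ≤ p.remainder t) hX)
    linarith
  · have := mul_nonneg hX r0
    linarith

/-- The place where `decay > 1/2` matters: it gives `1/2 + ρσ + decay/2 ≥ 1 + ρσ - decay/2`, so the
fluctuations are of no larger order than the terms from summation by parts. -/
lemma Valid.sqrt_sum_batch_sq_errRate_sq_le (hp : p.Valid) (ha : 1 / 2 < p.decay) {t : ℕ}
    (ht : 1 ≤ t) :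
    √(∑ i ∈ Finset.range t, (p.batch (i + 1) : ℝ) ^ 2 * p.errRate i ^ 2) ≤
      24 * p.Crho * (p.total t * (1 + Real.log t) * p.remainder t) := by
  have ha0 : 0 < p.decay := by linarith
  have ht0 : (0 : ℝ) < t := by exact_mod_cast ht
  have ht1 : (1 : ℝ) ≤ t := by exact_mod_cast ht
  have hlog : 0 ≤ Real.log t := Real.log_nonneg ht1
  have hN := hp.total_pos ht
  have hC := hp.one_le_Crho
  have hnu := hp.nu_pos
  have hr := hp.rho_nonneg
  obtain ⟨r0, r1, -, r3⟩ := p.remainder_bounds t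
  have k1 := hp.sqrt_sum_batch_sq_mul_rpow_le ha0 (p.rho * p.sigma + p.decay / 2) ht
  have k2 := hp.sqrt_sum_batch_sq_mul_rpow_le ha0 (p.rho * p.nu) ht
  set A := ∑ i ∈ Finset.range t, (p.batch (i + 1) : ℝ) ^ 2 *
    (((i + 1 : ℕ) : ℝ) ^ (-(p.rho * p.sigma + p.decay / 2))) ^ 2 with hA
  set B := ∑ i ∈ Finset.range t, (p.batch (i + 1) : ℝ) ^ 2 *
    (((i + 1 : ℕ) : ℝ) ^ (-(p.rho * p.nu))) ^ 2 with hB'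
  have hA0 : 0 ≤ A := Finset.sum_nonneg fun i _ => by positivity
  have hB0 : 0 ≤ B := Finset.sum_nonneg fun i _ => by positivity
  have hsum : ∑ i ∈ Finset.range t, (p.batch (i + 1) : ℝ) ^ 2 * p.errRate i ^ 2 ≤
      2 * A + if p.Bnu ≠ 0 then 2 * B else 0 := by
    have h1 : ∀ i ∈ Finset.range t, (p.batch (i + 1) : ℝ) ^ 2 * p.errRate i ^ 2 ≤ _ :=
      fun i _ => mul_le_mul_of_nonneg_left (p.errRate_sq_le i) (by positivity)
    refine (Finset.sum_le_sum h1).trans_eq ?_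
    rw [hA, hB']
    split_ifs
    · rw [Finset.mul_sum, Finset.mul_sum, ← Finset.sum_add_distrib]
      exact Finset.sum_congr rfl fun i _ => by ring
    · rw [Finset.mul_sum, add_zero]
      exact Finset.sum_congr rfl fun i _ => by ring
  have hX : 0 ≤ 4 * p.Crho * p.total t * (1 + Real.log t) := by positivity
  have hs2 : Real.sqrt 2 ≤ 3 / 2 := by
    rw [Real.sqrt_le_left (by norm_num)]; norm_num
  have hle1 : (t : ℝ) ^ (-(1 / 2 + (p.rho * p.sigma + p.decay / 2))) ≤
      (t : ℝ) ^ (-(1 + p.rho * p.sigma - p.decay / 2)) :=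
    Real.rpow_le_rpow_of_exponent_le ht1 (by linarith)
  have hE : 0 ≤ (t : ℝ) ^ (-(2 * (p.rho * p.sigma + p.decay / 2))) := by positivity
  have k1' : √A ≤ 4 * p.Crho * p.total t * (1 + Real.log t) * (2 * p.remainder t) :=
    k1.trans (mul_le_mul_of_nonneg_left (by linarith) hX)
  have d1 : √(2 * A) ≤ 3 / 2 * √A := by
    rw [Real.sqrt_mul (by norm_num)]; gcongr
  have hXr := mul_nonneg hX r0
  refine (Real.sqrt_le_sqrt hsum).trans ?_
  split_ifs with hB
  · have hle : (t : ℝ) ^ (-(1 / 2 + p.rho * p.nu)) ≤ (t : ℝ) ^ (-(p.rho * p.nu)) :=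
      Real.rpow_le_rpow_of_exponent_le ht1 (by linarith)
    have k2' : √B ≤ _ := k2.trans (mul_le_mul_of_nonneg_left
      (by linarith [r3 hB] : _ ≤ p.remainder t) hX)
    have d2 : √(2 * B) ≤ 3 / 2 * √B := by
      rw [Real.sqrt_mul (by norm_num)]; gcongr
    have := sqrt_add_le (x := 2 * A) (y := 2 * B) (by positivity) (by positivity)
    linarith
  · rw [add_zero]
    linarith

lemma Valid.sum_batch_bias_le (hp : p.Valid) (ha : 0 < p.decay) {K : ℝ} (hK : 0 ≤ K) {t : ℕ}
    (ht : 1 ≤ t) :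
    ∑ i ∈ Finset.range t, (p.batch (i + 1) : ℝ) *
        (p.depRate (i + 1) * (p.Dnu * (K * p.errRate i) + p.Bnu)) ≤
      4 * p.Crho * (2 * p.Dnu * K + p.Bnu) *
        (p.total t * (1 + Real.log t) * p.remainder t) := by
  have ht0 : (0 : ℝ) < t := by exact_mod_cast ht
  have ht1 : (1 : ℝ) ≤ t := by exact_mod_cast ht
  have hlog : 0 ≤ Real.log t := Real.log_nonneg ht1
  have hN := hp.total_pos ht
  have hC := hp.one_le_Crho
  have hnu := hp.nu_pos
  have hr := hp.rho_nonneg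
  have hD0 := hp.Dnu_nonneg
  have hB0 := hp.Bnu_nonneg
  obtain ⟨r0, r1, r2, r3⟩ := p.remainder_bounds t
  have k1 := hp.sum_batch_mul_rpow_le ha (p.rho * p.nu + (p.rho * p.sigma + p.decay / 2)) ht
  have k2 := hp.sum_batch_mul_rpow_le ha (p.rho * p.nu) ht
  have hX : 0 ≤ 4 * p.Crho * p.total t * (1 + Real.log t) := by positivity
  set A := ∑ i ∈ Finset.range t, (p.batch (i + 1) : ℝ) *
    ((i + 1 : ℕ) : ℝ) ^ (-(p.rho * p.nu + (p.rho * p.sigma + p.decay / 2))) with hA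
  set B := ∑ i ∈ Finset.range t, (p.batch (i + 1) : ℝ) *
    ((i + 1 : ℕ) : ℝ) ^ (-(p.rho * p.nu)) with hB'
  have hsum : ∑ i ∈ Finset.range t, (p.batch (i + 1) : ℝ) *
        (p.depRate (i + 1) * (p.Dnu * (K * p.errRate i) + p.Bnu)) ≤
      p.Dnu * K * A + if p.Bnu ≠ 0 then (p.Dnu * K + p.Bnu) * B else 0 := by
    have h1 : ∀ i ∈ Finset.range t, (p.batch (i + 1) : ℝ) *
        (p.depRate (i + 1) * (p.Dnu * (K * p.errRate i) + p.Bnu)) ≤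
        p.Dnu * K * ((p.batch (i + 1) : ℝ) *
          ((i + 1 : ℕ) : ℝ) ^ (-(p.rho * p.nu + (p.rho * p.sigma + p.decay / 2)))) +
        if p.Bnu ≠ 0 then (p.Dnu * K + p.Bnu) * ((p.batch (i + 1) : ℝ) *
          ((i + 1 : ℕ) : ℝ) ^ (-(p.rho * p.nu))) else 0 := by
      intro i _
      have hi0 : (0 : ℝ) < ((i + 1 : ℕ) : ℝ) := by positivity
      have hi1 : (1 : ℝ) ≤ ((i + 1 : ℕ) : ℝ) := by exact_mod_cast Nat.le_add_left 1 i
      have hd := hp.depRate_le (t := i + 1) (by omega)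
      have hz := p.errRate_nonneg i
      have h2 : (p.batch (i + 1) : ℝ) *
          (p.depRate (i + 1) * (p.Dnu * (K * p.errRate i) + p.Bnu)) ≤
          (p.batch (i + 1) : ℝ) *
          (((i + 1 : ℕ) : ℝ) ^ (-(p.rho * p.nu)) * (p.Dnu * (K * p.errRate i) + p.Bnu)) := by
        gcongr
      refine h2.trans ?_
      rw [neg_add, Real.rpow_add hi0]
      unfold errRate
      set x := ((i + 1 : ℕ) : ℝ) ^ (-(p.rho * p.sigma + p.decay / 2))
      have hy1 : ((i + 1 : ℕ) : ℝ) ^ (-(p.rho * p.nu)) ≤ 1 :=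
        Real.rpow_le_one_of_one_le_of_nonpos hi1 (by have := mul_nonneg hr hnu.le; linarith)
      have hy0 : 0 ≤ ((i + 1 : ℕ) : ℝ) ^ (-(p.rho * p.nu)) := by positivity
      set y := ((i + 1 : ℕ) : ℝ) ^ (-(p.rho * p.nu))
      split_ifs with hB
      -- The dependence acting on the bias part of `errRate` is of order `y²`; it is absorbed in the
      -- pure bias, of order `y ≤ 1`.
      · have : (p.batch (i + 1) : ℝ) * (p.Dnu * K) * y * y ≤
          (p.batch (i + 1) : ℝ) * (p.Dnu * K) * y * 1 := by gcongr
        linarith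
      · simp only [ne_eq, not_not] at hB
        rw [hB]
        apply le_of_eq
        ring
    refine (Finset.sum_le_sum h1).trans_eq ?_
    rw [hA, hB', Finset.sum_add_distrib, Finset.mul_sum]
    split_ifs
    · rw [Finset.mul_sum]
    · simp
  refine hsum.trans ?_
  have hXr := mul_nonneg hX r0
  have t1 : p.Dnu * K * A ≤
      p.Dnu * K * (4 * p.Crho * p.total t * (1 + Real.log t) * p.remainder t) := by
    by_cases hD : p.Dnu = 0
    · simp [hD]
    · refine mul_le_mul_of_nonneg_left ?_ (by positivity)
      exact k1.trans (mul_le_mul_of_nonneg_left (by linarith [r2 hD]) hX)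
  split_ifs with hB
  · have t2 : (p.Dnu * K + p.Bnu) * B ≤ (p.Dnu * K + p.Bnu) *
        (4 * p.Crho * p.total t * (1 + Real.log t) * p.remainder t) := by
      refine mul_le_mul_of_nonneg_left ?_ (by positivity)
      exact k2.trans (mul_le_mul_of_nonneg_left (by linarith [r3 hB]) hX)
    linarith
  · have : 0 ≤ (p.Dnu * K + p.Bnu) *
        (4 * p.Crho * p.total t * (1 + Real.log t) * p.remainder t) := by positivity
    linarith

/-- The order, in `N_t`, of the main remainder. -/
noncomputable def orderMain (p : Params) (t : ℕ) : ℝ := max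
  ((p.total t : ℝ) ^
    (-((2 + p.rho * (2 * p.sigma + p.beta) - p.alpha) / (2 * (1 + p.rho)))))
  ((p.total t : ℝ) ^
    (-((p.rho * (2 * p.sigma - p.beta) + p.alpha) / (1 + p.rho))))

/-- The order, in `N_t`, of the remainder due to the dependence. -/
noncomputable def orderDep (p : Params) (t : ℕ) : ℝ :=
  (p.total t : ℝ) ^ (-((p.delta + p.rho * p.nu) / (2 * (1 + p.rho))))

/-- The order, in `N_t`, of the remainder due to the bias. -/
noncomputable def orderBias (p : Params) (t : ℕ) : ℝ :=
  max ((p.total t : ℝ) ^ (-(p.rho * (p.sigma + p.nu) / (2 * (1 + p.rho)))))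
  (max ((p.total t : ℝ) ^
    (-((1 + p.rho * (p.beta + p.nu) - p.alpha) / (1 + p.rho))))
  (max ((p.total t : ℝ) ^ (-((1 + 2 * p.rho * p.nu) / (2 * (1 + p.rho)))))
  (max ((p.total t : ℝ) ^ (-((p.delta / 2 + p.rho * p.nu) / (2 * (1 + p.rho)))))
    ((p.total t : ℝ) ^ (-(2 * p.rho * p.nu / (1 + p.rho)))))))

lemma Valid.rpow_neg_le_total_rpow (hp : p.Valid) {s s' : ℝ} (hs : 0 ≤ s) (hs' : s' ≤ s) {t : ℕ}
    (ht : 1 ≤ t) :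
    (t : ℝ) ^ (-s) ≤ (2 * p.Crho) ^ (s / (1 + p.rho)) *
      (p.total t : ℝ) ^ (-(s' / (1 + p.rho))) := by
  have ht0 : (0 : ℝ) < t := by exact_mod_cast ht
  have ht1 : (1 : ℝ) ≤ t := by exact_mod_cast ht
  have hN := hp.total_pos ht
  have hN1 : (1 : ℝ) ≤ p.total t := ht1.trans (hp.natCast_le_total t)
  have hC : (0 : ℝ) < 2 * p.Crho := by linarith [hp.one_le_Crho]
  have h1r : 0 < 1 + p.rho := by linarith [hp.rho_nonneg]
  have h1 : (t : ℝ) ^ (-s) ≤ (2 * p.Crho) ^ (s / (1 + p.rho)) *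
      (p.total t : ℝ) ^ (-(s / (1 + p.rho))) := by
    have h := Real.rpow_le_rpow hN.le (hp.total_le ht) (by positivity : 0 ≤ s / (1 + p.rho))
    rw [Real.mul_rpow hC.le (by positivity), ← Real.rpow_mul ht0.le,
      mul_div_cancel₀ _ h1r.ne'] at h
    rw [Real.rpow_neg ht0.le, Real.rpow_neg hN.le, inv_le_iff_one_le_mul₀ (by positivity),
      mul_assoc, mul_comm (_⁻¹), ← mul_assoc, ← div_eq_mul_inv, le_div_iff₀ (by positivity),
      one_mul]
    exact h
  refine h1.trans (mul_le_mul_of_nonneg_left ?_ (by positivity))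
  refine Real.rpow_le_rpow_of_exponent_le hN1 ?_
  rw [neg_le_neg_iff]
  gcongr

/-- The first two powers match `orderMain` exactly. For the dependence, `δ ≤ 2 (ρσ + decay/2)` gives
`(δ + ρν)/2 ≤ ρν + ρσ + decay/2`. With bias, also `δ ≤ 2ρν`, so the power with exponent `ρν` is
already dominated by the fourth entry of the maximum in `orderBias`. -/
lemma Valid.exists_remainder_le (hp : p.Valid) (ha : 0 < p.decay) (ha1 : p.decay < 1) :
    ∃ K : ℝ, 0 ≤ K ∧ ∀ t : ℕ, 1 ≤ t → p.remainder t ≤ K * p.orderMain t +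
      (if p.Dnu ≠ 0 then K * p.orderDep t else 0) +
      (if p.Bnu ≠ 0 then K * p.orderBias t else 0) := by
  have h1r : 0 < 1 + p.rho := by linarith [hp.rho_nonneg]
  have hr := hp.rho_nonneg
  have hs := hp.sigma_mem.1
  have hnu := hp.nu_pos
  have hrs : 0 ≤ p.rho * p.sigma := by positivity
  have hrn : 0 ≤ p.rho * p.nu := by positivity
  have hdec : p.decay = p.alpha - p.rho * p.beta := rfl
  set c : ℝ → ℝ := fun s => (2 * (p.Crho : ℝ)) ^ (s / (1 + p.rho)) with hc
  have hc0 : ∀ s, 0 ≤ c s := fun s => by simp only [hc]; positivity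
  set e1 : ℝ := 1 + p.rho * p.sigma - p.decay / 2 with he1
  set e2 : ℝ := 2 * (p.rho * p.sigma + p.decay / 2) with he2
  set e3 : ℝ := p.rho * p.nu + (p.rho * p.sigma + p.decay / 2) with he3
  have he10 : 0 ≤ e1 := by linarith
  have he20 : 0 ≤ e2 := by linarith
  have he30 : 0 ≤ e3 := by linarith
  have hdelta : p.delta ≤ e2 := by
    have : p.rho * (2 * p.sigma - p.beta) + p.alpha = e2 := by rw [he2, hdec]; ring
    unfold delta
    split_ifs
    · exact this.le
    · exact (min_le_left _ _).trans this.le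
  have hdelta2 : p.Bnu ≠ 0 → p.delta ≤ 2 * (p.rho * p.nu) := by
    intro hB
    unfold delta
    rw [if_neg hB]
    exact (min_le_right _ _).trans (by linarith)
  refine ⟨c e1 + c e2 + c e3 + c (p.rho * p.nu), by
    have := hc0 e1; have := hc0 e2; have := hc0 e3; have := hc0 (p.rho * p.nu); positivity,
    fun t ht => ?_⟩
  have m1 : (t : ℝ) ^ (-e1) ≤ c e1 * p.orderMain t := by
    refine (hp.rpow_neg_le_total_rpow he10 le_rfl ht).trans
      (mul_le_mul_of_nonneg_left ?_ (hc0 _))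
    refine le_trans (le_of_eq ?_) (le_max_left _ _)
    congr 2
    rw [he1, hdec]; field_simp; ring
  have m2 : (t : ℝ) ^ (-e2) ≤ c e2 * p.orderMain t := by
    refine (hp.rpow_neg_le_total_rpow he20 le_rfl ht).trans
      (mul_le_mul_of_nonneg_left ?_ (hc0 _))
    refine le_trans (le_of_eq ?_) (le_max_right _ _)
    congr 2
    rw [he2, hdec]; congr 1; ring
  have m3 : (t : ℝ) ^ (-e3) ≤ c e3 * p.orderDep t := by
    refine (hp.rpow_neg_le_total_rpow (s' := (p.delta + p.rho * p.nu) / 2) he30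
      (by rw [he3]; linarith) ht).trans (mul_le_mul_of_nonneg_left (le_of_eq ?_) (hc0 _))
    unfold orderDep
    congr 2
    rw [div_div]
  have m4 : p.Bnu ≠ 0 → (t : ℝ) ^ (-(p.rho * p.nu)) ≤ c (p.rho * p.nu) * p.orderBias t := by
    intro hB
    refine (hp.rpow_neg_le_total_rpow (s' := (p.delta / 2 + p.rho * p.nu) / 2) hrn
      (by linarith [hdelta2 hB]) ht).trans (mul_le_mul_of_nonneg_left ?_ (hc0 _))
    unfold orderBias
    refine le_trans (le_of_eq ?_) ((le_max_left _ _).trans ((le_max_right _ _).trans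
      ((le_max_right _ _).trans (le_max_right _ _))))
    congr 2
    rw [div_div]
  have o1 : 0 ≤ p.orderMain t := le_max_of_le_left (by positivity)
  have o2 : 0 ≤ p.orderDep t := by unfold orderDep; positivity
  have o3 : 0 ≤ p.orderBias t := le_max_of_le_left (by positivity)
  have q := fun s => mul_nonneg (hc0 s) o1
  have q2 := fun s => mul_nonneg (hc0 s) o2
  have q3 := fun s => mul_nonneg (hc0 s) o3
  unfold remainder
  rw [← he1, ← he2, ← he3]
  have a1 : (t : ℝ) ^ (-e1) + (t : ℝ) ^ (-e2) ≤
      (c e1 + c e2 + c e3 + c (p.rho * p.nu)) * p.orderMain t := by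
    linarith [q e3, q (p.rho * p.nu)]
  have a2 : (if p.Dnu ≠ 0 then (t : ℝ) ^ (-e3) else 0) ≤ if p.Dnu ≠ 0 then
      (c e1 + c e2 + c e3 + c (p.rho * p.nu)) * p.orderDep t else 0 := by
    split_ifs
    · linarith [q2 e1, q2 e2, q2 (p.rho * p.nu)]
    · exact le_rfl
  have a3 : (if p.Bnu ≠ 0 then (t : ℝ) ^ (-(p.rho * p.nu)) else 0) ≤ if p.Bnu ≠ 0 then
      (c e1 + c e2 + c e3 + c (p.rho * p.nu)) * p.orderBias t else 0 := by
    split_ifs with hB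
    · linarith [q3 e1, q3 e2, q3 e3, m4 hB]
    · exact le_rfl
  linarith

end Params

/-! ### Linearization of the gradient and the Hessian at the minimizer -/

section Calculus

variable {d : ℕ} {p : Params} {Θ : Set (EuclideanSpace ℝ (Fin d))}
  {F : EuclideanSpace ℝ (Fin d) → ℝ} {θs : EuclideanSpace ℝ (Fin d)}

/-- Dropping `F θ - F θ* ≥ 0` leaves the constant `μ / 2`. In the fourth moment recursion, where the
drift has coefficient `4γ`, this becomes `2γμ`. -/
lemma QuasiStronglyConvex.le_inner (hF : QuasiStronglyConvex p Θ F θs)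
    (hmin : ∀ η, F θs ≤ F η) {θ : EuclideanSpace ℝ (Fin d)} (hθ : θ ∈ Θ) :
    p.mu / 2 * ‖θ - θs‖ ^ 2 ≤ inner ℝ (θ - θs) (gradient F θ) := by
  have h := hF.le θ hθ
  have h1 := hmin θ
  rw [← neg_sub θ θs, inner_neg_right, norm_neg, real_inner_comm] at h
  linarith

/-- Mean value inequality on the convex set of points of `Θ` no farther from `θ*` than `θ`, where
the Hessian differs from its value at `θ*` by at most `Chess * ‖θ - θs‖`. -/
lemma Smooth.norm_gradient_sub_le (hS : Smooth p Θ F θs) (hconv : Convex ℝ Θ) (hs : θs ∈ Θ)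
    (h0 : gradient F θs = 0) {θ : EuclideanSpace ℝ (Fin d)} (hθ : θ ∈ Θ) (hC : 0 ≤ p.Chess) :
    ‖gradient F θ - fderiv ℝ (gradient F) θs (θ - θs)‖ ≤ p.Chess * ‖θ - θs‖ ^ 2 := by
  have h := Convex.norm_image_sub_le_of_norm_fderiv_le' (𝕜 := ℝ) (f := gradient F)
    (s := Θ ∩ Metric.closedBall θs ‖θ - θs‖) (C := p.Chess * ‖θ - θs‖)
    (φ := fderiv ℝ (gradient F) θs) (x := θs) (y := θ)
    (fun x hx => hS.twice_differentiable x hx.1)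
    (fun x hx => (hS.hessian_lipschitz x hx.1).trans
      (mul_le_mul_of_nonneg_left (by simpa [dist_eq_norm] using hx.2) hC))
    (hconv.inter (convex_closedBall _ _)) ⟨hs, by simp⟩ ⟨hθ, by simp [dist_eq_norm]⟩
  rw [h0, sub_zero] at h
  rwa [sq, ← mul_assoc]

/-- The Hessian is symmetric. -/
lemma inner_fderiv_gradient_comm (hd : Differentiable ℝ F)
    (h2 : DifferentiableAt ℝ (gradient F) θs) (v w : EuclideanSpace ℝ (Fin d)) :
    inner ℝ (fderiv ℝ (gradient F) θs v) w = inner ℝ (fderiv ℝ (gradient F) θs w) v := by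
  let L : EuclideanSpace ℝ (Fin d) →L[ℝ] (EuclideanSpace ℝ (Fin d) →L[ℝ] ℝ) := innerSL ℝ
  have h := second_derivative_symmetric (𝕜 := ℝ) (f := F) (f' := fun x => L (gradient F x))
    (f'' := L.comp (fderiv ℝ (gradient F) θs)) (x := θs)
    (fun y => (hd y).hasGradientAt.hasFDerivAt) (L.hasFDerivAt.comp θs h2.hasFDerivAt) v w
  exact h

/-- Quasi-strong convexity bounds the Hessian at an interior minimizer from below. -/
lemma QuasiStronglyConvex.mu_le_hessian (hF : QuasiStronglyConvex p Θ F θs)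
    (hint : θs ∈ interior Θ) (h2 : DifferentiableAt ℝ (gradient F) θs)
    (v : EuclideanSpace ℝ (Fin d)) :
    p.mu * ‖v‖ ^ 2 ≤ inner ℝ (fderiv ℝ (gradient F) θs v) v := by
  set h : ℝ := inner ℝ (fderiv ℝ (gradient F) θs v) v with hh
  set φ : ℝ → ℝ := fun s => inner ℝ (gradient F (θs + s • v)) v with hφ
  have hline : HasDerivAt (fun s : ℝ => θs + s • v) v 0 := by
    simpa using ((hasDerivAt_id (0 : ℝ)).smul_const v).const_add θs
  have hφ' : HasDerivAt φ h 0 := by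
    have h2' : HasFDerivAt (gradient F) (fderiv ℝ (gradient F) θs) (θs + (0 : ℝ) • v) := by
      simpa using h2.hasFDerivAt
    have h3 := h2'.comp_hasDerivAt (0 : ℝ) hline
    have h4 := h3.inner ℝ (hasDerivAt_const (0 : ℝ) v)
    rw [inner_zero_right, zero_add] at h4
    exact h4
  have hφ0 : φ 0 = 0 := by
    simp only [hφ, zero_smul, add_zero, hF.gradient_eq_zero, inner_zero_left]
  have hG : ∀ s : ℝ, HasDerivAt (fun s : ℝ => F (θs + s • v)) (φ s) s := by
    intro s
    have h3 : HasDerivAt (fun s : ℝ => θs + s • v) v s := by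
      simpa using ((hasDerivAt_id s).smul_const v).const_add θs
    have h4 := (hF.differentiable (θs + s • v)).hasGradientAt.hasFDerivAt.comp_hasDerivAt s h3
    exact h4
  -- For small `s`, `F` exceeds its minimum by about `h s²/2` while `s φ(s)` is about `h s²`, so
  -- quasi-strong convexity reads `h/2 ≥ μ ‖v‖²/2`. Discarding the growth of `F` would lose a factor
  -- `2`. A tolerance `ε/3` on `φ` costs `ε/3` in `s φ(s)` and `ε/6` after integration, in total
  -- `ε/2`.
  refine le_of_forall_pos_le_add fun ε hε => ?_
  have hsmall : ∀ᶠ s in 𝓝 (0 : ℝ), |φ s - h * s| ≤ ε / 3 * |s| := by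
    have h5 := (hasDerivAt_iff_isLittleO_nhds_zero.1 hφ').def (by positivity : 0 < ε / 3)
    filter_upwards [h5] with s hs
    simpa [hφ0, mul_comm h] using hs
  have hmem : ∀ᶠ s in 𝓝 (0 : ℝ), θs + s • v ∈ Θ := by
    have : Tendsto (fun s : ℝ => θs + s • v) (𝓝 0) (𝓝 θs) := by
      simpa using hline.continuousAt.tendsto
    exact this.eventually (mem_interior_iff_mem_nhds.1 hint)
  obtain ⟨r, hr, hball⟩ := Metric.eventually_nhds_iff.1 (hsmall.and hmem)
  set s : ℝ := r / 2 with hs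
  have hs0 : 0 < s := by positivity
  have hin : ∀ x ∈ Set.Icc (0 : ℝ) s, |φ x - h * x| ≤ ε / 3 * x ∧ θs + x • v ∈ Θ := by
    intro x hx
    have := hball (y := x) (by
      rw [Real.dist_eq, sub_zero, abs_of_nonneg hx.1]; linarith [hx.2])
    rwa [abs_of_nonneg hx.1] at this
  have hmono : F θs ≤ F (θs + s • v) - (h - ε / 3) / 2 * s ^ 2 := by
    have hder : ∀ x : ℝ, HasDerivAt (fun x : ℝ => F (θs + x • v) - (h - ε / 3) / 2 * x ^ 2)
        (φ x - (h - ε / 3) * x) x := by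
      intro x
      have h6 : HasDerivAt (fun x : ℝ => (h - ε / 3) / 2 * x ^ 2) ((h - ε / 3) * x) x :=
        ((hasDerivAt_pow 2 x).const_mul ((h - ε / 3) / 2)).congr_deriv (by push_cast; ring)
      exact (hG x).sub h6
    have hm : MonotoneOn (fun x : ℝ => F (θs + x • v) - (h - ε / 3) / 2 * x ^ 2)
        (Set.Icc 0 s) := by
      refine monotoneOn_of_deriv_nonneg (convex_Icc _ _)
        (fun x _ => (hder x).continuousAt.continuousWithinAt)
        (fun x _ => (hder x).differentiableAt.differentiableWithinAt) fun x hx => ?_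
      rw [interior_Icc] at hx
      rw [(hder x).deriv]
      have := (abs_le.1 (hin x ⟨hx.1.le, hx.2.le⟩).1).1
      linarith
    have := hm (Set.left_mem_Icc.2 hs0.le) (Set.right_mem_Icc.2 hs0.le) hs0.le
    simpa using this
  obtain ⟨hb, hΘ⟩ := hin s ⟨hs0.le, le_rfl⟩
  have hle := hF.le _ hΘ
  have e1 : θs - (θs + s • v) = -(s • v) := by abel
  rw [e1, inner_neg_right, inner_smul_right, norm_neg, norm_smul, Real.norm_of_nonneg hs0.le]
    at hle
  change F (θs + s • v) + -(s * φ s) + p.mu / 2 * (s * ‖v‖) ^ 2 ≤ F θs at hle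
  have hb' := (abs_le.1 hb).2
  have hb2 := mul_le_mul_of_nonneg_left hb' hs0.le
  have hfin : s ^ 2 * (p.mu * ‖v‖ ^ 2) ≤ s ^ 2 * (h + ε) := by nlinarith
  exact le_of_mul_le_mul_left hfin (by positivity)

end Calculus

/-! ### Traces of semidefinite matrices and the inverse Hessian -/

section Matrices

variable {d : ℕ}

open Matrix

lemma trace_mul_vecMulVec_mul {K : Matrix (Fin d) (Fin d) ℝ} (hK : Kᵀ = K) (v : Fin d → ℝ) :
    (K * vecMulVec v v * K).trace = ‖toEuclideanCLM (𝕜 := ℝ) K (WithLp.toLp 2 v)‖ ^ 2 := by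
  rw [mul_vecMulVec, vecMulVec_mul, trace_vecMulVec, ← mulVec_transpose, hK,
    EuclideanSpace.norm_sq_eq]
  simp [dotProduct, sq, toEuclideanCLM_toLp]

/-- A positive semidefinite matrix is a sum of matrices `v vᵀ`, and `Tr (K v vᵀ K) = ‖K v‖²`, so the
bound holds term by term. -/
lemma trace_mul_posSemidef_mul_le {K S : Matrix (Fin d) (Fin d) ℝ} (hK : Kᵀ = K)
    (hS : S.PosSemidef) {c : ℝ}
    (hc : ∀ v, ‖toEuclideanCLM (𝕜 := ℝ) K v‖ ≤ c * ‖v‖) :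
    (K * S * K).trace ≤ c ^ 2 * S.trace := by
  obtain ⟨m, v, rfl⟩ := posSemidef_iff_eq_sum_vecMulVec.1 hS
  simp only [star_trivial, Finset.mul_sum, Finset.sum_mul, trace_sum]
  refine Finset.sum_le_sum fun i _ => ?_
  rw [trace_mul_vecMulVec_mul hK, trace_vecMulVec]
  have h := pow_le_pow_left₀ (norm_nonneg _) (hc (WithLp.toLp 2 (v i))) 2
  rw [mul_pow, EuclideanSpace.norm_sq_eq (WithLp.toLp 2 (v i))] at h
  simpa [dotProduct, sq] using h

lemma trace_mul_mul_nonneg {K S : Matrix (Fin d) (Fin d) ℝ} (hK : Kᵀ = K)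
    (hS : S.PosSemidef) : 0 ≤ (K * S * K).trace := by
  obtain ⟨m, v, rfl⟩ := posSemidef_iff_eq_sum_vecMulVec.1 hS
  simp only [star_trivial, Finset.mul_sum, Finset.sum_mul, trace_sum]
  refine Finset.sum_nonneg fun i _ => ?_
  rw [trace_mul_vecMulVec_mul hK]
  positivity

/-- A symmetric coercive operator: its matrix has a symmetric inverse, bounded by `1 / c`. -/
lemma inverse_of_coercive {A : EuclideanSpace ℝ (Fin d) →L[ℝ] EuclideanSpace ℝ (Fin d)}
    {M : Matrix (Fin d) (Fin d) ℝ} (hM : ∀ v, toEuclideanCLM (𝕜 := ℝ) M v = A v)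
    (hsymm : ∀ v w, inner ℝ (A v) w = inner ℝ (A w) v) {c : ℝ} (hc : 0 < c)
    (hA : ∀ v, c * ‖v‖ ^ 2 ≤ inner ℝ (A v) v) :
    (M⁻¹)ᵀ = M⁻¹ ∧ (∀ v, toEuclideanCLM (𝕜 := ℝ) M⁻¹ (A v) = v) ∧
      ∀ v, ‖toEuclideanCLM (𝕜 := ℝ) M⁻¹ v‖ ≤ c⁻¹ * ‖v‖ := by
  have hMt : Mᵀ = M := by
    ext i j
    have h := hsymm (EuclideanSpace.single i 1) (EuclideanSpace.single j 1)
    rw [← hM, ← hM] at h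
    simpa [EuclideanSpace.inner_single_right, ofLp_toEuclideanCLM, mulVec_single] using h
  have hinj : ∀ v : Fin d → ℝ, M *ᵥ v = 0 → v = 0 := by
    intro v hv
    have h := hA (WithLp.toLp 2 v)
    have h0 : A (WithLp.toLp 2 v) = 0 := by
      rw [← hM, toEuclideanCLM_toLp, hv]; rfl
    rw [h0, inner_zero_left] at h
    have h1 : ‖WithLp.toLp 2 v‖ ^ 2 ≤ 0 := by
      by_contra hcon
      push Not at hcon
      have := mul_pos hc hcon
      linarith
    have h2 : ‖WithLp.toLp 2 v‖ = 0 := by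
      have := sq_nonneg ‖WithLp.toLp 2 v‖
      exact pow_eq_zero_iff (two_ne_zero) |>.1 (le_antisymm h1 this)
    simpa using norm_eq_zero.1 h2
  have hdet : IsUnit M.det := by
    rw [isUnit_iff_ne_zero]
    intro h0
    obtain ⟨v, hv0, hv⟩ := exists_mulVec_eq_zero_iff.2 h0
    exact hv0 (hinj v hv)
  have hleft : ∀ v, toEuclideanCLM (𝕜 := ℝ) M⁻¹ (A v) = v := by
    intro v
    rw [← hM]
    apply (WithLp.ofLp_injective 2)
    rw [ofLp_toEuclideanCLM, ofLp_toEuclideanCLM, mulVec_mulVec, nonsing_inv_mul _ hdet,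
      one_mulVec]
  have hright : ∀ v, A (toEuclideanCLM (𝕜 := ℝ) M⁻¹ v) = v := by
    intro v
    rw [← hM]
    apply (WithLp.ofLp_injective 2)
    rw [ofLp_toEuclideanCLM, ofLp_toEuclideanCLM, mulVec_mulVec, mul_nonsing_inv _ hdet,
      one_mulVec]
  refine ⟨by rw [transpose_nonsing_inv, hMt], hleft, fun v => ?_⟩
  have h := hA (toEuclideanCLM (𝕜 := ℝ) M⁻¹ v)
  rw [hright] at h
  have h1 := h.trans (real_inner_le_norm _ _)
  set x := ‖toEuclideanCLM (𝕜 := ℝ) M⁻¹ v‖ with hx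
  have hx0 : 0 ≤ x := norm_nonneg _
  rw [inv_mul_eq_div, le_div_iff₀ hc]
  rcases hx0.eq_or_lt with h0 | h0
  · rw [← h0, zero_mul]; positivity
  · have : x * (x * c) ≤ x * ‖v‖ := by linarith
    exact le_of_mul_le_mul_left this h0

lemma toEuclideanCLM_hessianMatrix (F : EuclideanSpace ℝ (Fin d) → ℝ)
    (θ v : EuclideanSpace ℝ (Fin d)) :
    toEuclideanCLM (𝕜 := ℝ) (hessianMatrix F θ) v = fderiv ℝ (gradient F) θ v := by
  have hv : v = ∑ j, v j • EuclideanSpace.single j (1 : ℝ) := by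
    ext i
    simp [Finset.sum_apply, Pi.single_apply]
  ext i
  rw [ofLp_toEuclideanCLM]
  conv_rhs => rw [hv, map_sum]
  simp [mulVec, dotProduct, hessianMatrix, mul_comm]

end Matrices

/-! ### `L²` and `L⁴` norms of random vectors -/

section Moments

variable {Ω E : Type*} {mΩ : MeasurableSpace Ω} {P : Measure Ω} [NormedAddCommGroup E]

lemma lpNorm_two_eq_sqrt {X : Ω → E} (hX : AEStronglyMeasurable X P) :
    lpNorm X 2 P = √(∫ ω, ‖X ω‖ ^ 2 ∂P) := by
  have h := lpNorm_eq_integral_norm_rpow_toReal (p := 2) (by norm_num) (by norm_num) hX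
  rw [h, Real.sqrt_eq_rpow]
  norm_num

lemma lpNorm_four_pow {X : Ω → E} (hX : AEStronglyMeasurable X P) :
    lpNorm X 4 P ^ 4 = ∫ ω, ‖X ω‖ ^ 4 ∂P := by
  have h := lpNorm_eq_integral_norm_rpow_toReal (p := 4) (by norm_num) (by norm_num) hX
  have h4 : (4 : ENNReal).toReal = 4 := by norm_num
  rw [h, h4, ← Real.rpow_natCast, ← Real.rpow_mul
    (integral_nonneg fun ω => by positivity)]
  norm_num

lemma memLp_four_of_integrable {X : Ω → E} (hX : AEStronglyMeasurable X P)
    (h : Integrable (fun ω => ‖X ω‖ ^ 4) P) : MemLp X 4 P := by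
  rw [← integrable_norm_rpow_iff hX (by norm_num) (by norm_num)]
  have h4 : (4 : ENNReal).toReal = (4 : ℕ) := by norm_num
  simpa [h4] using h

lemma integrable_norm_four {X : Ω → E} (h : MemLp X 4 P) :
    Integrable (fun ω => ‖X ω‖ ^ 4) P :=
  MemLp.integrable_norm_pow (p := 4) (by exact_mod_cast h) (by norm_num)

lemma integrable_norm_two {X : Ω → E} (h : MemLp X 2 P) :
    Integrable (fun ω => ‖X ω‖ ^ 2) P :=
  MemLp.integrable_norm_pow (p := 2) (by exact_mod_cast h) (by norm_num)

lemma memLp_two_of_four [IsFiniteMeasure P] {X : Ω → E} (h : MemLp X 4 P) : MemLp X 2 P :=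
  h.mono_exponent (by norm_num)

lemma lpNorm_two_le_four [IsProbabilityMeasure P] {X : Ω → E} (h : MemLp X 4 P) :
    lpNorm X 2 P ≤ lpNorm X 4 P := by
  rw [← toReal_eLpNorm h.aestronglyMeasurable, ← toReal_eLpNorm h.aestronglyMeasurable]
  exact ENNReal.toReal_mono h.eLpNorm_ne_top
    (eLpNorm_le_eLpNorm_of_exponent_le (by norm_num) h.aestronglyMeasurable)

/-- A function that is quadratically bounded by an `L⁴` function is in `L²`. -/
lemma lpNorm_two_le_of_norm_le_sq {E' : Type*} [NormedAddCommGroup E'] {X : Ω → E} {Y : Ω → E'}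
    {c : ℝ} (hc : 0 ≤ c) (hX : MemLp X 4 P) (hY : AEStronglyMeasurable Y P)
    (h : ∀ᵐ ω ∂P, ‖Y ω‖ ≤ c * ‖X ω‖ ^ 2) :
    MemLp Y 2 P ∧ lpNorm Y 2 P ≤ c * lpNorm X 4 P ^ 2 := by
  have hi := (integrable_norm_four hX).const_mul (c ^ 2)
  have hle : ∀ᵐ ω ∂P, ‖Y ω‖ ^ 2 ≤ c ^ 2 * ‖X ω‖ ^ 4 := by
    filter_upwards [h] with ω hω
    calc ‖Y ω‖ ^ 2 ≤ (c * ‖X ω‖ ^ 2) ^ 2 := pow_le_pow_left₀ (norm_nonneg _) hω 2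
      _ = _ := by ring
  have hY2 : Integrable (fun ω => ‖Y ω‖ ^ 2) P := by
    refine hi.mono (hY.norm.pow 2) ?_
    filter_upwards [hle] with ω hω
    rw [Real.norm_of_nonneg (by positivity), Real.norm_of_nonneg (by positivity)]
    exact hω
  refine ⟨(memLp_two_iff_integrable_sq_norm hY).2 hY2, ?_⟩
  rw [lpNorm_two_eq_sqrt hY, Real.sqrt_le_left (by positivity)]
  calc ∫ ω, ‖Y ω‖ ^ 2 ∂P ≤ ∫ ω, c ^ 2 * ‖X ω‖ ^ 4 ∂P := integral_mono_ae hY2 hi hle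
    _ = c ^ 2 * lpNorm X 4 P ^ 4 := by
      rw [integral_const_mul, lpNorm_four_pow hX.aestronglyMeasurable]
    _ = _ := by ring

lemma lpNorm_clm_le {E' : Type*} [NormedAddCommGroup E'] {X : Ω → E} {Y : Ω → E'} {c : ℝ}
    (hc : 0 ≤ c) (hX : MemLp X 2 P) (h : ∀ ω, ‖Y ω‖ ≤ c * ‖X ω‖) :
    lpNorm Y 2 P ≤ c * lpNorm X 2 P := by
  have h1 : lpNorm Y 2 P ≤ lpNorm (c • fun ω => ‖X ω‖) 2 P :=
    lpNorm_mono_real (hX.norm.const_smul c) h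
  rw [lpNorm_const_smul, coe_nnnorm, Real.norm_of_nonneg hc, lpNorm_norm hX.aestronglyMeasurable] at h1
  exact h1

end Moments

lemma integrable_inner_of_memLp {Ω E : Type*} {mΩ : MeasurableSpace Ω} {P : Measure Ω}
    [NormedAddCommGroup E] [InnerProductSpace ℝ E] {X Y : Ω → E} (hX : MemLp X 2 P)
    (hY : MemLp Y 2 P) : Integrable (fun ω => inner ℝ (X ω) (Y ω)) P := by
  refine ((integrable_norm_two hX).add (integrable_norm_two hY)).mono'
    (hX.aestronglyMeasurable.inner hY.aestronglyMeasurable) (Eventually.of_forall fun ω => ?_)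
  have h := norm_inner_le_norm (𝕜 := ℝ) (X ω) (Y ω)
  simp only [Pi.add_apply]
  nlinarith [sq_nonneg (‖X ω‖ - ‖Y ω‖), sq_nonneg ‖X ω‖, sq_nonneg ‖Y ω‖]

/-! ### Conditional expectations and sums of martingale differences -/

section CondExp

variable {Ω E : Type*} {m mΩ : MeasurableSpace Ω} {P : Measure Ω} [IsProbabilityMeasure P]
  [NormedAddCommGroup E] [InnerProductSpace ℝ E] [CompleteSpace E]

lemma integral_inner_condExp (hm : m ≤ mΩ) {X Y : Ω → E} (hY : StronglyMeasurable[m] Y)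
    (hX : Integrable X P) (hXY : Integrable (fun ω => inner ℝ (Y ω) (X ω)) P) :
    Integrable (fun ω => inner ℝ (Y ω) ((P[X | m]) ω)) P ∧
      ∫ ω, inner ℝ (Y ω) (X ω) ∂P = ∫ ω, inner ℝ (Y ω) ((P[X | m]) ω) ∂P := by
  let B : E →L[ℝ] E →L[ℝ] ℝ := innerSL ℝ
  have h : P[fun ω => inner ℝ (Y ω) (X ω) | m] =ᵐ[P] fun ω => inner ℝ (Y ω) ((P[X | m]) ω) :=
    condExp_bilin_of_stronglyMeasurable_left B hY hXY hX
  refine ⟨integrable_condExp.congr h, ?_⟩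
  rw [← integral_condExp hm, integral_congr_ae h]

/-- Pythagoras: conditional expectation is an orthogonal projection of `L²`. This is why uncentred
second moments of the scores suffice in the covariance assumption. -/
lemma integral_norm_sub_condExp_sq_le (hm : m ≤ mΩ) {X : Ω → E} (hX : MemLp X 2 P) :
    ∫ ω, ‖X ω - (P[X | m]) ω‖ ^ 2 ∂P ≤ ∫ ω, ‖X ω‖ ^ 2 ∂P := by
  have hC : MemLp (P[X | m]) 2 P := hX.condExp (by norm_num)
  have hXi : Integrable X P := hX.integrable (by norm_num)
  have hin : Integrable (fun ω => inner ℝ ((P[X | m]) ω) (X ω)) P := integrable_inner_of_memLp hC hX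
  have h := (integral_inner_condExp hm stronglyMeasurable_condExp hXi hin).2
  have hX2 := integrable_norm_two hX
  have hC2 := integrable_norm_two hC
  have e : ∀ ω, ‖X ω - (P[X | m]) ω‖ ^ 2 =
      ‖X ω‖ ^ 2 - 2 * inner ℝ ((P[X | m]) ω) (X ω) + ‖(P[X | m]) ω‖ ^ 2 := fun ω => by
    rw [norm_sub_sq_real, real_inner_comm]
  simp only [e]
  have hsub : Integrable (fun ω => ‖X ω‖ ^ 2 - 2 * inner ℝ ((P[X | m]) ω) (X ω)) P :=
    hX2.sub (hin.const_mul 2)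
  rw [integral_add hsub hC2, integral_sub hX2 (hin.const_mul 2),
    integral_const_mul, h]
  simp only [real_inner_self_eq_norm_sq]
  have : 0 ≤ ∫ ω, ‖(P[X | m]) ω‖ ^ 2 ∂P := integral_nonneg fun ω => by positivity
  linarith

/-- Orthogonality of martingale differences. -/
lemma integral_norm_sum_sq_eq (𝓕 : Filtration ℕ mΩ) {D : ℕ → Ω → E}
    (hD : ∀ i, StronglyMeasurable[𝓕 (i + 1)] (D i)) (hD2 : ∀ i, MemLp (D i) 2 P)
    (hD0 : ∀ i, P[D i | 𝓕 i] =ᵐ[P] 0) (t : ℕ) :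
    ∫ ω, ‖∑ i ∈ Finset.range t, D i ω‖ ^ 2 ∂P =
      ∑ i ∈ Finset.range t, ∫ ω, ‖D i ω‖ ^ 2 ∂P := by
  induction t with
  | zero => simp
  | succ t ih =>
    have hS : StronglyMeasurable[𝓕 t] fun ω => ∑ i ∈ Finset.range t, D i ω :=
      Finset.stronglyMeasurable_fun_sum _ fun i hi =>
        (hD i).mono (𝓕.mono (Finset.mem_range.1 hi))
    have hS2 : MemLp (fun ω => ∑ i ∈ Finset.range t, D i ω) 2 P :=
      memLp_finsetSum _ fun i _ => hD2 i
    have hin : Integrable (fun ω => inner ℝ (∑ i ∈ Finset.range t, D i ω) (D t ω)) P :=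
      integrable_inner_of_memLp hS2 (hD2 t)
    have h := (integral_inner_condExp (𝓕.le t) hS ((hD2 t).integrable (by norm_num)) hin).2
    have h0 : ∫ ω, inner ℝ (∑ i ∈ Finset.range t, D i ω) ((P[D t | 𝓕 t]) ω) ∂P = 0 := by
      rw [integral_congr_ae (g := fun _ => (0 : ℝ)), integral_zero]
      filter_upwards [hD0 t] with ω hω
      rw [hω, Pi.zero_apply, inner_zero_right]
    simp only [Finset.sum_range_succ, norm_add_sq_real]
    have hadd : Integrable (fun ω => ‖∑ i ∈ Finset.range t, D i ω‖ ^ 2 +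
        2 * inner ℝ (∑ i ∈ Finset.range t, D i ω) (D t ω)) P :=
      (integrable_norm_two hS2).add (hin.const_mul 2)
    rw [integral_add hadd (integrable_norm_two (hD2 t)),
      integral_add (integrable_norm_two hS2) (hin.const_mul 2), integral_const_mul, h, h0, ih]
    ring

/-- The `L²` norm of a weighted sum of centred terms. -/
lemma lpNorm_sum_sub_condExp_le (𝓕 : Filtration ℕ mΩ) {X : ℕ → Ω → E} (c : ℕ → ℝ)
    (hX : ∀ i, StronglyMeasurable[𝓕 (i + 1)] (X i)) (hX2 : ∀ i, MemLp (X i) 2 P) (t : ℕ) :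
    MemLp (fun ω => ∑ i ∈ Finset.range t, c i • (X i ω - (P[X i | 𝓕 i]) ω)) 2 P ∧
    lpNorm (fun ω => ∑ i ∈ Finset.range t, c i • (X i ω - (P[X i | 𝓕 i]) ω)) 2 P ≤
      √(∑ i ∈ Finset.range t, c i ^ 2 * ∫ ω, ‖X i ω‖ ^ 2 ∂P) := by
  let D : ℕ → Ω → E := fun i ω => c i • (X i ω - (P[X i | 𝓕 i]) ω)
  have hXi : ∀ i, Integrable (X i) P := fun i => (hX2 i).integrable (by norm_num)
  have hD : ∀ i, StronglyMeasurable[𝓕 (i + 1)] (D i) := fun i =>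
    ((hX i).sub (stronglyMeasurable_condExp.mono (𝓕.mono (Nat.le_succ i)))).const_smul (c i)
  have hD2 : ∀ i, MemLp (D i) 2 P := fun i =>
    ((hX2 i).sub ((hX2 i).condExp (by norm_num))).const_smul (c i)
  have hD0 : ∀ i, P[D i | 𝓕 i] =ᵐ[P] 0 := by
    intro i
    have h1 : P[D i | 𝓕 i] =ᵐ[P] c i • P[X i - P[X i | 𝓕 i] | 𝓕 i] :=
      condExp_smul (c i) (X i - P[X i | 𝓕 i]) (𝓕 i)
    have h2 := condExp_sub (hXi i) (integrable_condExp (μ := P) (f := X i) (m := 𝓕 i)) (𝓕 i)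
    have h3 : P[P[X i | 𝓕 i] | 𝓕 i] = P[X i | 𝓕 i] :=
      condExp_of_stronglyMeasurable (𝓕.le i) stronglyMeasurable_condExp integrable_condExp
    filter_upwards [h1, h2] with ω e1 e2
    rw [e1, Pi.smul_apply, e2, Pi.sub_apply, h3, sub_self, smul_zero, Pi.zero_apply]
  have hS2 : MemLp (fun ω => ∑ i ∈ Finset.range t, D i ω) 2 P :=
    memLp_finsetSum _ fun i _ => hD2 i
  refine ⟨hS2, ?_⟩
  rw [lpNorm_two_eq_sqrt hS2.aestronglyMeasurable]
  refine Real.sqrt_le_sqrt ?_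
  refine (integral_norm_sum_sq_eq 𝓕 hD hD2 hD0 t).trans_le (Finset.sum_le_sum fun i _ => ?_)
  simp only [D, norm_smul, mul_pow, Real.norm_eq_abs, sq_abs]
  rw [integral_const_mul]
  exact mul_le_mul_of_nonneg_left (integral_norm_sub_condExp_sq_le (𝓕.le i) (hX2 i))
    (sq_nonneg _)

end CondExp

/-! ### Euclidean projection onto a closed convex set -/

section Projection

variable {d : ℕ} {Θ : Set (EuclideanSpace ℝ (Fin d))}

lemma IsProjection.inner_le (hΘ : Convex ℝ Θ) {x y z : EuclideanSpace ℝ (Fin d)}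
    (h : IsProjection Θ x y) (hz : z ∈ Θ) : inner ℝ (x - y) (z - y) ≤ 0 := by
  refine (norm_eq_iInf_iff_real_inner_le_zero hΘ h.1).1 ?_ z hz
  have : Nonempty Θ := ⟨⟨y, h.1⟩⟩
  refine le_antisymm (le_ciInf fun w => h.2 w w.2) ?_
  exact ciInf_le ⟨0, Set.forall_mem_range.2 fun _ => norm_nonneg _⟩ (⟨y, h.1⟩ : Θ)

/-- The two variational inequalities add up to `‖y - y'‖² ≤ ⟨x - x', y - y'⟩`; conclude by
Cauchy–Schwarz. -/
lemma IsProjection.norm_sub_le (hΘ : Convex ℝ Θ) {x y x' y' : EuclideanSpace ℝ (Fin d)}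
    (h : IsProjection Θ x y) (h' : IsProjection Θ x' y') : ‖y - y'‖ ≤ ‖x - x'‖ := by
  have h1 := h.inner_le hΘ h'.1
  have h2 := h'.inner_le hΘ h.1
  have e : inner ℝ (x - x') (y - y') =
      ‖y - y'‖ ^ 2 - inner ℝ (x - y) (y' - y) - inner ℝ (x' - y') (y - y') := by
    have e1 : x - x' = (x - y) + (y - y') - (x' - y') := by abel
    have e2 : inner ℝ (x - y) (y' - y) = -inner ℝ (x - y) (y - y') := by
      rw [← inner_neg_right, neg_sub]
    rw [e2, e1, inner_sub_left, inner_add_left, real_inner_self_eq_norm_sq]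
    ring
  have h3 := real_inner_le_norm (x - x') (y - y')
  have h4 : ‖y - y'‖ * ‖y - y'‖ ≤ ‖x - x'‖ * ‖y - y'‖ := by nlinarith
  rcases (norm_nonneg (y - y')).eq_or_lt with h0 | h0
  · rw [← h0]; positivity
  · exact le_of_mul_le_mul_right h4 h0

lemma isProjection_self {x : EuclideanSpace ℝ (Fin d)} (hx : x ∈ Θ) : IsProjection Θ x x :=
  ⟨hx, fun z _ => by simp⟩

/-- The projection of an outer point lies on the boundary. -/
lemma IsProjection.mem_frontier (hΘ : Convex ℝ Θ) {x y : EuclideanSpace ℝ (Fin d)}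
    (h : IsProjection Θ x y) (hne : y ≠ x) : y ∈ frontier Θ := by
  refine ⟨subset_closure h.1, fun hint => ?_⟩
  -- If `y` were interior, a small move from `y` towards `x` would stay in `Θ`, against the
  -- variational inequality.
  have ht : Tendsto (fun s : ℝ => y + s • (x - y)) (𝓝[>] 0) (𝓝 y) := by
    have : Continuous fun s : ℝ => y + s • (x - y) := by fun_prop
    have h0 := this.tendsto 0
    simp only [zero_smul, add_zero] at h0
    exact h0.mono_left nhdsWithin_le_nhds
  obtain ⟨s, hs, hs0⟩ := ((ht.eventually (mem_interior_iff_mem_nhds.1 hint)).and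
    self_mem_nhdsWithin).exists
  have h1 := h.inner_le hΘ hs
  rw [add_sub_cancel_left, inner_smul_right, real_inner_self_eq_norm_sq] at h1
  have h2 : 0 < ‖x - y‖ := norm_pos_iff.2 (sub_ne_zero.2 hne.symm)
  have h3 : 0 < s := hs0
  have : 0 < s * ‖x - y‖ ^ 2 := by positivity
  linarith

/-- A function whose values are projections of a measurable function is measurable. -/
lemma measurable_of_isProjection (hΘ : Convex ℝ Θ) (hcl : IsClosed Θ) {Ω : Type*}
    {m : MeasurableSpace Ω} {X Y : Ω → EuclideanSpace ℝ (Fin d)} (hX : Measurable X)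
    (h : ∀ ω, IsProjection Θ (X ω) (Y ω)) : Measurable Y := by
  rcases isEmpty_or_nonempty Ω with hΩ | ⟨⟨ω₀⟩⟩
  · exact measurable_of_empty Y
  have hne : Θ.Nonempty := ⟨Y ω₀, (h ω₀).1⟩
  have hex : ∀ u : EuclideanSpace ℝ (Fin d), ∃ v, IsProjection Θ u v := by
    intro u
    obtain ⟨v, hv, he⟩ := exists_norm_eq_iInf_of_complete_convex hne hcl.isComplete hΘ u
    refine ⟨v, hv, fun z hz => he.trans_le ?_⟩
    exact ciInf_le ⟨0, Set.forall_mem_range.2 fun _ => norm_nonneg _⟩ (⟨z, hz⟩ : Θ)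
  -- `Y` is only known pointwise to be some projection of `X`. Nonexpansiveness makes `π` continuous
  -- and also forces `Y = π ∘ X`.
  choose π hπ using hex
  have hlip : LipschitzWith 1 π := LipschitzWith.of_dist_le_mul fun u v => by
    simpa [dist_eq_norm] using (hπ u).norm_sub_le hΘ (hπ v)
  have hY : Y = π ∘ X := by
    funext ω
    have := (h ω).norm_sub_le hΘ (hπ (X ω))
    rw [sub_self, norm_zero] at this
    exact sub_eq_zero.1 (norm_le_zero_iff.1 this)
  rw [hY]
  exact hlip.continuous.measurable.comp hX

end Projection

/-! ### Measurability of random gradients -/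

section Measurability

variable {d : ℕ} {Ω : Type*} {m : MeasurableSpace Ω}

/-- The gradient of a random differentiable function, at a random point, is measurable. -/
lemma measurable_gradient_comp {u : Ω → EuclideanSpace ℝ (Fin d) → ℝ}
    (hd : ∀ ω, Differentiable ℝ (u ω)) (hu : ∀ η, Measurable fun ω => u ω η)
    {ϑ : Ω → EuclideanSpace ℝ (Fin d)} (hϑ : Measurable ϑ) :
    Measurable fun ω => gradient (u ω) (ϑ ω) := by
  -- A function continuous in the parameter and measurable in `ω` is jointly measurable. Partial
  -- derivatives at a random point are then limits of measurable difference quotients with step `1 /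
  -- (n + 1)`.
  have hcomp : ∀ {κ : Ω → EuclideanSpace ℝ (Fin d)}, Measurable κ →
      Measurable fun ω => u ω (κ ω) := by
    intro κ hκ
    have h := measurable_uncurry_of_continuous_of_measurable (u := fun η ω => u ω η)
      (fun ω => (hd ω).continuous) hu
    exact h.comp (hκ.prodMk measurable_id)
  have hcoord : ∀ j, Measurable fun ω => gradient (u ω) (ϑ ω) j := by
    intro j
    let e : EuclideanSpace ℝ (Fin d) := EuclideanSpace.single j (1 : ℝ)
    have hlim : ∀ ω, Tendsto (fun n : ℕ => ((n : ℝ) + 1) *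
        (u ω (ϑ ω + ((n : ℝ) + 1)⁻¹ • e) - u ω (ϑ ω))) atTop
        (𝓝 (gradient (u ω) (ϑ ω) j)) := by
      intro ω
      have h1 := (hd ω (ϑ ω)).hasGradientAt.hasFDerivAt.hasLineDerivAt e
      have h2 := h1.tendsto_slope_zero
      have h3 : Tendsto (fun n : ℕ => ((n : ℝ) + 1)⁻¹) atTop (𝓝[≠] 0) := by
        refine tendsto_nhdsWithin_iff.2 ⟨?_, Eventually.of_forall fun n => ?_⟩
        · exact tendsto_inv_atTop_zero.comp
            (tendsto_atTop_add_const_right _ _ tendsto_natCast_atTop_atTop)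
        · have : (0 : ℝ) < (n : ℝ) + 1 := by positivity
          exact (inv_pos.2 this).ne'
      have h4 := h2.comp h3
      have e5 : (InnerProductSpace.toDual ℝ (EuclideanSpace ℝ (Fin d)))
          (gradient (u ω) (ϑ ω)) e = gradient (u ω) (ϑ ω) j := by
        rw [InnerProductSpace.toDual_apply_apply, EuclideanSpace.inner_single_right]
        simp
      rw [e5] at h4
      refine h4.congr fun n => ?_
      simp
    refine measurable_of_tendsto_metrizable (f := fun (n : ℕ) ω => ((n : ℝ) + 1) *
        (u ω (ϑ ω + ((n : ℝ) + 1)⁻¹ • e) - u ω (ϑ ω))) (fun n => ?_) (tendsto_pi_nhds.2 hlim)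
    exact ((hcomp (hϑ.add_const _)).sub (hcomp hϑ)).const_mul _
  have hpi : Measurable fun ω => (gradient (u ω) (ϑ ω)).ofLp := measurable_pi_iff.2 hcoord
  exact (MeasurableEquiv.toLp 2 (Fin d → ℝ)).measurable.comp hpi

end Measurability

/-! ### The fourth moment recursion -/

lemma pow_three_mul_le {x b l : ℝ} (hl : 0 < l) :
    x ^ 3 * b ≤ 3 / 4 * l * x ^ 4 + l⁻¹ ^ 3 / 4 * b ^ 4 := by
  have key : ∀ c : ℝ, 4 * x ^ 3 * c ≤ 3 * x ^ 4 + c ^ 4 := fun c => by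
    -- This product equals `3x⁴ - 4x³c + c⁴`, so no sign of `x` or `b` is needed.
    have h1 : 0 ≤ (x - c) ^ 2 * ((x + c) ^ 2 + 2 * x ^ 2) := by positivity
    nlinarith
  have h := mul_le_mul_of_nonneg_left (key (b * l⁻¹)) hl.le
  have e1 : l * (4 * x ^ 3 * (b * l⁻¹)) = 4 * (x ^ 3 * b) := by field_simp
  have e2 : l * (3 * x ^ 4 + (b * l⁻¹) ^ 4) = 3 * l * x ^ 4 + l⁻¹ ^ 3 * b ^ 4 := by
    field_simp
  rw [e1, e2] at h
  linarith

section Step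

variable {E : Type*} [NormedAddCommGroup E] [InnerProductSpace ℝ E]

/-- Square the expansion of `‖x - γ G‖²` and split `G` into `G - H` and `H`, the latter to be the
score at the minimizer. Balancing `γ² ‖x‖² ‖H‖²` with the weight `ε` takes a small share `γ ε` of
the contraction and leaves `γ³ ‖H‖⁴ / ε`; leaving `γ² ‖H‖⁴` would spoil the rate. -/
lemma norm_sub_smul_pow_four_le (x G H : E) {γ ε : ℝ} (hγ : 0 ≤ γ) (hε : 0 < ε) :
    ‖x - γ • G‖ ^ 4 ≤ ‖x‖ ^ 4 - 4 * γ * inner ℝ (‖x‖ ^ 2 • x) G +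
      8 * γ ^ 2 * (‖x‖ ^ 4 + ‖G - H‖ ^ 4) + 8 * γ * ε * ‖x‖ ^ 4 +
      8 * γ ^ 3 / ε * ‖H‖ ^ 4 + 24 * γ ^ 4 * (‖G - H‖ ^ 4 + ‖H‖ ^ 4) := by
  have hsq : ‖x - γ • G‖ ^ 2 = ‖x‖ ^ 2 - 2 * γ * inner ℝ x G + γ ^ 2 * ‖G‖ ^ 2 := by
    rw [norm_sub_sq_real, inner_smul_right, norm_smul, Real.norm_of_nonneg hγ]; ring
  have hin : inner ℝ (‖x‖ ^ 2 • x) G = ‖x‖ ^ 2 * inner ℝ x G := by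
    rw [inner_smul_left]; simp
  have habs := abs_real_inner_le_norm x G
  have htri : ‖G‖ ≤ ‖G - H‖ + ‖H‖ := by
    calc ‖G‖ = ‖G - H + H‖ := by rw [sub_add_cancel]
      _ ≤ _ := norm_add_le _ _
  rw [show ‖x - γ • G‖ ^ 4 = (‖x - γ • G‖ ^ 2) ^ 2 by ring, hsq, hin]
  set i := inner ℝ x G
  set X := ‖x‖
  set Y := ‖G‖
  set Z := ‖G - H‖
  set W := ‖H‖
  have hX : 0 ≤ X := norm_nonneg _
  have hY : 0 ≤ Y := norm_nonneg _
  have hZ : 0 ≤ Z := norm_nonneg _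
  have hW : 0 ≤ W := norm_nonneg _
  have hi2 : i ^ 2 ≤ X ^ 2 * Y ^ 2 := by
    rw [← mul_pow, ← sq_abs]
    exact pow_le_pow_left₀ (abs_nonneg _) habs 2
  have hi1 : -(X * Y) ≤ i := (abs_le.1 habs).1
  have s1 : (X ^ 2 - 2 * γ * i + γ ^ 2 * Y ^ 2) ^ 2 ≤
      X ^ 4 - 4 * γ * (X ^ 2 * i) + 8 * γ ^ 2 * (X ^ 2 * Y ^ 2) + 3 * γ ^ 4 * Y ^ 4 := by
    have a1 : 4 * γ ^ 2 * i ^ 2 ≤ 4 * γ ^ 2 * (X ^ 2 * Y ^ 2) := by gcongr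
    have a2 : 4 * γ ^ 3 * Y ^ 2 * (-i) ≤ 4 * γ ^ 3 * Y ^ 2 * (X * Y) := by
      gcongr; linarith
    -- Splits the cross term `4γ³XY³` into `2γ²X²Y² + 2γ⁴Y⁴`.
    have a3 : 0 ≤ 2 * γ ^ 2 * Y ^ 2 * (X - γ * Y) ^ 2 := by positivity
    nlinarith
  have s2 : Y ^ 2 ≤ 2 * Z ^ 2 + 2 * W ^ 2 := by
    have := pow_le_pow_left₀ hY htri 2
    nlinarith [sq_nonneg (Z - W)]
  have s3 : Y ^ 4 ≤ 8 * (Z ^ 4 + W ^ 4) := by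
    have := pow_le_pow_left₀ (sq_nonneg Y) s2 2
    nlinarith [sq_nonneg (Z ^ 2 - W ^ 2)]
  have s4 : 8 * γ ^ 2 * (X ^ 2 * Y ^ 2) ≤ 8 * γ ^ 2 * (X ^ 4 + Z ^ 4) + 8 * γ * ε * X ^ 4 +
      8 * γ ^ 3 / ε * W ^ 4 := by
    have b1 : 8 * γ ^ 2 * (X ^ 2 * Y ^ 2) ≤ 8 * γ ^ 2 * (X ^ 2 * (2 * Z ^ 2 + 2 * W ^ 2)) := by
      gcongr
    have b2 : 8 * γ ^ 2 * (2 * (X ^ 2 * Z ^ 2)) ≤ 8 * γ ^ 2 * (X ^ 4 + Z ^ 4) := by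
      gcongr
      nlinarith [sq_nonneg (X ^ 2 - Z ^ 2)]
    have b3 : 2 * (X ^ 2 * (γ * W ^ 2)) ≤ ε * X ^ 4 + γ ^ 2 / ε * W ^ 4 := by
      have h0 : 0 ≤ (ε * X ^ 2 - γ * W ^ 2) ^ 2 / ε := by positivity
      have e : (ε * X ^ 2 - γ * W ^ 2) ^ 2 / ε =
          ε * X ^ 4 + γ ^ 2 / ε * W ^ 4 - 2 * (X ^ 2 * (γ * W ^ 2)) := by
        field_simp
        ring
      linarith
    have b4 := mul_le_mul_of_nonneg_left b3 (by positivity : 0 ≤ 8 * γ)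
    have e4 : 8 * γ * (ε * X ^ 4 + γ ^ 2 / ε * W ^ 4) =
        8 * γ * ε * X ^ 4 + 8 * γ ^ 3 / ε * W ^ 4 := by ring
    rw [e4] at b4
    linarith
  have s5 : 3 * γ ^ 4 * Y ^ 4 ≤ 24 * γ ^ 4 * (Z ^ 4 + W ^ 4) := by
    have := mul_le_mul_of_nonneg_left s3 (by positivity : 0 ≤ 3 * γ ^ 4)
    linarith
  linarith

variable {Ω : Type*} {m mΩ : MeasurableSpace Ω} {P : Measure Ω} [IsProbabilityMeasure P]
  [CompleteSpace E]

/-- One step of the fourth moment recursion. -/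
lemma fourth_moment_step (hm : m ≤ mΩ) {x y G H N : Ω → E} {γ ε μ ν D B κ s : ℝ}
    (hγ : 0 ≤ γ) (hε : 0 < ε) (hν : 0 ≤ ν) (hD : 0 ≤ D)
    (hxm : StronglyMeasurable[m] x) (hx : MemLp x 4 P) (hG : MemLp G 4 P) (hH : MemLp H 4 P)
    (hN : ∀ ω, μ / 2 * ‖x ω‖ ^ 2 ≤ inner ℝ (x ω) (N ω))
    (hb : Integrable (fun ω => ‖(P[G | m]) ω - N ω‖ ^ 4) P)
    (hb' : ∫ ω, ‖(P[G | m]) ω - N ω‖ ^ 4 ∂P ≤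
      ν ^ 4 * (D ^ 4 * ∫ ω, ‖x ω‖ ^ 4 ∂P + B ^ 4))
    (hκ : ∫ ω, ‖G ω - H ω‖ ^ 4 ∂P ≤ κ ^ 4 * ∫ ω, ‖x ω‖ ^ 4 ∂P)
    (hs : ∫ ω, ‖H ω‖ ^ 4 ∂P ≤ s ^ 4)
    (hy : MemLp y 4 P) (hyx : ∀ ω, ‖y ω‖ ≤ ‖x ω - γ • G ω‖) :
    ∫ ω, ‖y ω‖ ^ 4 ∂P ≤
      (1 - γ * (2 * μ - 4 * ν * D - 12 * ε) + 8 * γ ^ 2 * (1 + κ ^ 4) + 24 * γ ^ 4 * κ ^ 4) *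
        ∫ ω, ‖x ω‖ ^ 4 ∂P +
      (γ * (ε⁻¹ ^ 3 * ν ^ 4 * B ^ 4) + 8 * γ ^ 3 * s ^ 4 / ε + 24 * γ ^ 4 * s ^ 4) := by
  set Δ := ∫ ω, ‖x ω‖ ^ 4 ∂P with hΔ
  have hΔ0 : 0 ≤ Δ := integral_nonneg fun ω => by positivity
  have ix := integrable_norm_four hx
  have iH := integrable_norm_four hH
  have iGH : Integrable (fun ω => ‖G ω - H ω‖ ^ 4) P := integrable_norm_four (hG.sub hH)
  have hGi : Integrable G P := hG.integrable (by norm_num)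
  have hYm : StronglyMeasurable[m] fun ω => ‖x ω‖ ^ 2 • x ω := (hxm.norm.pow 2).smul hxm
  have hin : Integrable (fun ω => inner ℝ (‖x ω‖ ^ 2 • x ω) (G ω)) P := by
    refine (ix.add (integrable_norm_four hG)).mono'
      ((hYm.mono hm).aestronglyMeasurable.inner hG.aestronglyMeasurable)
      (Eventually.of_forall fun ω => ?_)
    have h1 := norm_inner_le_norm (𝕜 := ℝ) (‖x ω‖ ^ 2 • x ω) (G ω)
    rw [norm_smul, Real.norm_of_nonneg (by positivity : 0 ≤ ‖x ω‖ ^ 2)] at h1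
    have h2 := pow_three_mul_le (x := ‖x ω‖) (b := ‖G ω‖) zero_lt_one
    have h3 : 0 ≤ ‖x ω‖ ^ 4 := by positivity
    have h4 : 0 ≤ ‖G ω‖ ^ 4 := by positivity
    simp only [Pi.add_apply]
    refine h1.trans ?_
    calc ‖x ω‖ ^ 2 * ‖x ω‖ * ‖G ω‖ = ‖x ω‖ ^ 3 * ‖G ω‖ := by ring
      _ ≤ _ := h2
      _ ≤ _ := by norm_num; linarith
  obtain ⟨hci, hce⟩ := integral_inner_condExp hm hYm hGi hin
  -- The weight in Young's inequality. Since `l⁻³ (νD)⁴ ≤ l`, the dependence costs `3l/4 + l/4 = l`,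
  -- and `l ≥ ε > 0` controls the factor `l⁻³` in front of `B⁴`. After multiplication by `4γ` the
  -- cost is `4γνD + 4γε`; with the `8γε` of `norm_sub_smul_pow_four_le` this makes `4γνD + 12γε`.
  set l : ℝ := ν * D + ε with hl
  have hl0 : 0 < l := by positivity
  have hlow : (μ / 2 - l) * Δ - ε⁻¹ ^ 3 / 4 * (ν ^ 4 * B ^ 4) ≤
      ∫ ω, inner ℝ (‖x ω‖ ^ 2 • x ω) (G ω) ∂P := by
    rw [hce]
    have hpt : ∀ ω, (μ / 2 - 3 / 4 * l) * ‖x ω‖ ^ 4 -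
        l⁻¹ ^ 3 / 4 * ‖(P[G | m]) ω - N ω‖ ^ 4 ≤
        inner ℝ (‖x ω‖ ^ 2 • x ω) ((P[G | m]) ω) := by
      intro ω
      have e : inner ℝ (‖x ω‖ ^ 2 • x ω) ((P[G | m]) ω) =
          ‖x ω‖ ^ 2 * inner ℝ (x ω) (N ω) +
            ‖x ω‖ ^ 2 * inner ℝ (x ω) ((P[G | m]) ω - N ω) := by
        rw [inner_smul_left, inner_sub_right]; simp; ring
      have h1 := mul_le_mul_of_nonneg_left (hN ω) (sq_nonneg ‖x ω‖)
      have h2 := mul_le_mul_of_nonneg_left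
        (abs_le.1 (abs_real_inner_le_norm (x ω) ((P[G | m]) ω - N ω))).1 (sq_nonneg ‖x ω‖)
      have h3 := pow_three_mul_le (x := ‖x ω‖) (b := ‖(P[G | m]) ω - N ω‖) hl0
      rw [e]
      have e1 : ‖x ω‖ ^ 2 * -(‖x ω‖ * ‖(P[G | m]) ω - N ω‖) =
          -(‖x ω‖ ^ 3 * ‖(P[G | m]) ω - N ω‖) := by ring
      have e2 : ‖x ω‖ ^ 2 * (μ / 2 * ‖x ω‖ ^ 2) = μ / 2 * ‖x ω‖ ^ 4 := by ring
      rw [e1] at h2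
      rw [e2] at h1
      linarith
    have hint := integral_mono ((ix.const_mul (μ / 2 - 3 / 4 * l)).sub
      (hb.const_mul (l⁻¹ ^ 3 / 4))) hci hpt
    rw [integral_sub' (ix.const_mul _) (hb.const_mul _), integral_const_mul,
      integral_const_mul, ← hΔ] at hint
    refine le_trans ?_ hint
    have hb2 := mul_le_mul_of_nonneg_left hb' (by positivity : 0 ≤ l⁻¹ ^ 3 / 4)
    have c1 : l⁻¹ ^ 3 * (ν ^ 4 * D ^ 4) ≤ l := by
      have : ν ^ 4 * D ^ 4 ≤ l ^ 4 := by
        rw [← mul_pow]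
        exact pow_le_pow_left₀ (by positivity) (by rw [hl]; linarith) 4
      calc l⁻¹ ^ 3 * (ν ^ 4 * D ^ 4) ≤ l⁻¹ ^ 3 * l ^ 4 := by gcongr
        _ = l := by field_simp
    have c2 : l⁻¹ ^ 3 ≤ ε⁻¹ ^ 3 := by
      have : ε ≤ l := by rw [hl]; have := mul_nonneg hν hD; linarith
      gcongr
    have c1' := mul_le_mul_of_nonneg_right c1 hΔ0
    have c2' := mul_le_mul_of_nonneg_right c2 (by positivity : 0 ≤ ν ^ 4 * B ^ 4)
    have e : l⁻¹ ^ 3 / 4 * (ν ^ 4 * (D ^ 4 * Δ + B ^ 4)) =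
        (l⁻¹ ^ 3 * (ν ^ 4 * D ^ 4) * Δ) / 4 + l⁻¹ ^ 3 * (ν ^ 4 * B ^ 4) / 4 := by ring
    rw [e] at hb2
    linarith
  have hstep : ∀ ω, ‖y ω‖ ^ 4 ≤ (1 + 8 * γ ^ 2 + 8 * γ * ε) * ‖x ω‖ ^ 4 -
      4 * γ * inner ℝ (‖x ω‖ ^ 2 • x ω) (G ω) +
      (8 * γ ^ 2 + 24 * γ ^ 4) * ‖G ω - H ω‖ ^ 4 +
      (8 * γ ^ 3 / ε + 24 * γ ^ 4) * ‖H ω‖ ^ 4 := fun ω => by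
    have h1 := norm_sub_smul_pow_four_le (x ω) (G ω) (H ω) hγ hε
    have h2 := pow_le_pow_left₀ (norm_nonneg _) (hyx ω) 4
    linarith
  have i1 := ix.const_mul (1 + 8 * γ ^ 2 + 8 * γ * ε)
  have i2 := hin.const_mul (4 * γ)
  have i3 := iGH.const_mul (8 * γ ^ 2 + 24 * γ ^ 4)
  have i4 := iH.const_mul (8 * γ ^ 3 / ε + 24 * γ ^ 4)
  have hfin := integral_mono (integrable_norm_four hy) (((i1.sub i2).add i3).add i4) hstep
  rw [integral_add' ((i1.sub i2).add i3) i4, integral_add' (i1.sub i2) i3, integral_sub' i1 i2,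
    integral_const_mul, integral_const_mul, integral_const_mul, integral_const_mul, ← hΔ] at hfin
  have j2 := mul_le_mul_of_nonneg_left hlow (by positivity : 0 ≤ 4 * γ)
  have j3 := mul_le_mul_of_nonneg_left hκ (by positivity : 0 ≤ 8 * γ ^ 2 + 24 * γ ^ 4)
  have j4 := mul_le_mul_of_nonneg_left hs (by positivity : 0 ≤ 8 * γ ^ 3 / ε + 24 * γ ^ 4)
  have e : 8 * γ ^ 3 * s ^ 4 / ε = 8 * γ ^ 3 / ε * s ^ 4 := by ring
  rw [e]
  simp only [hl] at j2
  nlinarith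

end Step

/-! ### Common setting of the projected and unprojected recursions -/

section Model

variable {d : ℕ} {Ω : Type*} [mΩ : MeasurableSpace Ω]

/-- The assumptions shared by the projected and the unprojected recursions. -/
structure Model (p : Params) (P : Measure Ω) (𝓕 : Filtration ℕ mΩ)
    (Θ : Set (EuclideanSpace ℝ (Fin d)))
    (g : ℕ → Ω → EuclideanSpace ℝ (Fin d) → EuclideanSpace ℝ (Fin d))
    (F : EuclideanSpace ℝ (Fin d) → ℝ) (θs : EuclideanSpace ℝ (Fin d))
    (θ : ℕ → Ω → EuclideanSpace ℝ (Fin d)) : Prop where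
  valid : p.Valid
  muNu_pos : 0 < p.muNu
  closed : IsClosed Θ
  convex : Convex ℝ Θ
  mem_interior : θs ∈ interior Θ
  isMin : ∀ η, F θs ≤ F η
  quasiConvex : QuasiStronglyConvex p Θ F θs
  smooth : Smooth p Θ F θs
  depBias : DependenceBias p 4 P 𝓕 Θ g F θs
  expSmooth : ExpectedSmooth p 4 P 𝓕 Θ g θs
  noise : GradientNoise p 4 P g θs
  measurable_grad : ∀ t : ℕ, 1 ≤ t → ∀ ϑ : Ω → EuclideanSpace ℝ (Fin d),
    Measurable[𝓕 t] ϑ → Measurable[𝓕 t] fun ω => g t ω (ϑ ω)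
  init_measurable : Measurable[𝓕 0] (θ 0)
  init_memLp : MemLp (θ 0) 4 P
  init_le : ∫ ω, ‖θ 0 ω - θs‖ ^ 4 ∂P ≤ p.Delta0
  recursion : IsPSSG p Θ g θ
  -- The displacement by the projection is of second order in the error; without projection it is
  -- zero. The absolute value keeps the bound nonnegative when nothing is known about `G`.
  overshoot : ∀ t : ℕ, ∀ᵐ ω ∂P,
    ‖θ (t + 1) ω - (θ t ω - p.rate (t + 1) • g (t + 1) ω (θ t ω))‖ ≤
      p.rate (t + 1) * (|p.G| / p.DTheta ^ 2 * ‖θ (t + 1) ω - θs‖ ^ 2)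

namespace Model

variable {p : Params} {P : Measure Ω} {𝓕 : Filtration ℕ mΩ}
  {Θ : Set (EuclideanSpace ℝ (Fin d))}
  {g : ℕ → Ω → EuclideanSpace ℝ (Fin d) → EuclideanSpace ℝ (Fin d)}
  {F : EuclideanSpace ℝ (Fin d) → ℝ} {θs : EuclideanSpace ℝ (Fin d)}
  {θ : ℕ → Ω → EuclideanSpace ℝ (Fin d)}

lemma minimizer_mem (h : Model p P 𝓕 Θ g F θs θ) : θs ∈ Θ := interior_subset h.mem_interior

lemma iterate_mem (h : Model p P 𝓕 Θ g F θs θ) (t : ℕ) (ω : Ω) : θ t ω ∈ Θ := by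
  cases t with
  | zero => exact h.recursion.1 ω
  | succ t => exact (h.recursion.2 t ω).1

lemma iterate_measurable (h : Model p P 𝓕 Θ g F θs θ) (t : ℕ) : Measurable[𝓕 t] (θ t) := by
  induction t with
  | zero => exact h.init_measurable
  | succ t ih =>
    have h1 : Measurable[𝓕 (t + 1)] (θ t) := ih.mono (𝓕.mono (Nat.le_succ t)) le_rfl
    have h2 := h.measurable_grad (t + 1) (by omega) (θ t) h1
    refine measurable_of_isProjection (m := 𝓕 (t + 1)) h.convex h.closed
      (X := fun ω => θ t ω - p.rate (t + 1) • g (t + 1) ω (θ t ω)) ?_ (h.recursion.2 t)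
    exact Measurable.sub (m := 𝓕 (t + 1)) h1 (Measurable.const_smul (m := 𝓕 (t + 1)) h2 (p.rate (t + 1)))

lemma grad_stronglyMeasurable (h : Model p P 𝓕 Θ g F θs θ) (t : ℕ) :
    StronglyMeasurable[𝓕 (t + 1)] fun ω => g (t + 1) ω (θ t ω) :=
  (h.measurable_grad (t + 1) (by omega) (θ t) ((h.iterate_measurable t).mono
    (𝓕.mono (Nat.le_succ t)) le_rfl)).stronglyMeasurable

lemma score_stronglyMeasurable (h : Model p P 𝓕 Θ g F θs θ) (t : ℕ) :
    StronglyMeasurable[𝓕 (t + 1)] fun ω => g (t + 1) ω θs :=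
  (h.measurable_grad (t + 1) (by omega) (fun _ => θs)
    (measurable_const)).stronglyMeasurable

lemma score_memLp (h : Model p P 𝓕 Θ g F θs θ) (t : ℕ) :
    MemLp (fun ω => g (t + 1) ω θs) 4 P :=
  memLp_four_of_integrable ((h.score_stronglyMeasurable t).mono (𝓕.le _)).aestronglyMeasurable
    (h.noise (t + 1) (by omega)).1

/-- The minimizer is its own projection, and projections are nonexpansive. -/
lemma norm_error_le (h : Model p P 𝓕 Θ g F θs θ) (t : ℕ) (ω : Ω) :
    ‖θ (t + 1) ω - θs‖ ≤ ‖(θ t ω - θs) - p.rate (t + 1) • g (t + 1) ω (θ t ω)‖ := by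
  have h1 := (h.recursion.2 t ω).norm_sub_le h.convex (isProjection_self h.minimizer_mem)
  rwa [sub_right_comm] at h1

lemma grad_memLp_of_iterate (h : Model p P 𝓕 Θ g F θs θ) {t : ℕ} (ht : MemLp (θ t) 4 P) :
    MemLp (fun ω => g (t + 1) ω (θ t ω)) 4 P := by
  have h1 := (h.expSmooth (t + 1) (by omega) (θ t) (h.iterate_measurable t) (h.iterate_mem t)
    (by exact_mod_cast ht)).1
  have h2 : MemLp (fun ω => g (t + 1) ω (θ t ω) - g (t + 1) ω θs) 4 P :=
    memLp_four_of_integrable (((h.grad_stronglyMeasurable t).sub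
      (h.score_stronglyMeasurable t)).mono (𝓕.le _)).aestronglyMeasurable h1
  have h3 := h2.add (h.score_memLp t)
  refine h3.congr_norm ((h.grad_stronglyMeasurable t).mono (𝓕.le _)).aestronglyMeasurable
    (Eventually.of_forall fun ω => ?_)
  simp

variable [IsProbabilityMeasure P]

lemma iterate_memLp (h : Model p P 𝓕 Θ g F θs θ) (t : ℕ) : MemLp (θ t) 4 P := by
  induction t with
  | zero => exact h.init_memLp
  | succ t ih =>
    have hc : MemLp (fun _ : Ω => θs) 4 P := memLp_const θs
    have h1 := (ih.sub hc).sub ((h.grad_memLp_of_iterate ih).const_smul (p.rate (t + 1)))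
    have hm : AEStronglyMeasurable (θ (t + 1)) P :=
      ((h.iterate_measurable (t + 1)).stronglyMeasurable.mono (𝓕.le _)).aestronglyMeasurable
    have h2 : MemLp (fun ω => θ (t + 1) ω - θs) 4 P :=
      h1.of_le (hm.sub aestronglyMeasurable_const)
        (Eventually.of_forall fun ω => h.norm_error_le t ω)
    refine (h2.add hc).congr_norm hm (Eventually.of_forall fun ω => ?_)
    simp

lemma error_memLp (h : Model p P 𝓕 Θ g F θs θ) (t : ℕ) : MemLp (fun ω => θ t ω - θs) 4 P :=
  (h.iterate_memLp t).sub (memLp_const θs)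

lemma grad_memLp (h : Model p P 𝓕 Θ g F θs θ) (t : ℕ) :
    MemLp (fun ω => g (t + 1) ω (θ t ω)) 4 P :=
  h.grad_memLp_of_iterate (h.iterate_memLp t)

lemma fourth_moment_recursion (h : Model p P 𝓕 Θ g F θs θ) (t : ℕ) :
    ∫ ω, ‖θ (t + 1) ω - θs‖ ^ 4 ∂P ≤
      p.contraction (t + 1) * ∫ ω, ‖θ t ω - θs‖ ^ 4 ∂P + p.forcing (t + 1) := by
  have hmu := h.muNu_pos
  have hdep := h.depBias (t + 1) (by omega) (θ t) (h.iterate_measurable t) (h.iterate_mem t)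
    (by exact_mod_cast h.iterate_memLp t)
  have hexp := h.expSmooth (t + 1) (by omega) (θ t) (h.iterate_measurable t) (h.iterate_mem t)
    (by exact_mod_cast h.iterate_memLp t)
  exact fourth_moment_step (𝓕.le t) (x := fun ω => θ t ω - θs) (y := fun ω => θ (t + 1) ω - θs)
    (G := fun ω => g (t + 1) ω (θ t ω)) (H := fun ω => g (t + 1) ω θs)
    (N := fun ω => gradient F (θ t ω)) (h.valid.rate_pos (by omega)).le
    (by positivity : 0 < p.muNu / 32) (p.depRate_nonneg (t + 1)) h.valid.Dnu_nonneg
    ((h.iterate_measurable t).stronglyMeasurable.sub stronglyMeasurable_const)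
    (h.error_memLp t) (h.grad_memLp t) (h.score_memLp t)
    (fun ω => h.quasiConvex.le_inner h.isMin (h.iterate_mem t ω)) hdep.2.1 hdep.2.2 hexp.2
    (h.noise (t + 1) (by omega)).2 (h.error_memLp (t + 1)) (h.norm_error_le t)

end Model

end Model

/-! ### Quadratic forms of the scores and the size of the leading sums -/

section Leading

variable {p : Params}

/-- To be used with `Λ` at `s = σ` and with `C_σ'` in place of `Λ` at `s = σ + σ'`. -/
lemma Params.Valid.sqrt_sum_div_total_le (hp : p.Valid) {s Λ : ℝ} (hs0 : 0 ≤ s) (hs1 : s ≤ 1)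
    (hΛ : 0 ≤ Λ) {t : ℕ} (ht : 1 ≤ t) :
    √(Λ * ∑ i ∈ Finset.Icc 1 t, (p.batch i : ℝ) ^ (2 - 2 * s)) / p.total t ≤
      √2 * √Λ * (p.Crho : ℝ) ^ ((1 - 2 * s) / (2 * (1 + p.rho))) /
        (p.total t : ℝ) ^ ((1 + 2 * p.rho * s) / (2 * (1 + p.rho))) := by
  have hN := hp.total_pos ht
  have hC : (0 : ℝ) < p.Crho := by linarith [hp.one_le_Crho]
  have h1r : 0 < 1 + p.rho := by linarith [hp.rho_nonneg]
  have h := mul_le_mul_of_nonneg_left (hp.sum_batch_rpow_le hs0 hs1 ht) hΛ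
  refine (div_le_div_of_nonneg_right (Real.sqrt_le_sqrt h) hN.le).trans_eq ?_
  have e1 : (p.Crho : ℝ) ^ ((1 - 2 * s) / (1 + p.rho)) =
      ((p.Crho : ℝ) ^ ((1 - 2 * s) / (2 * (1 + p.rho)))) ^ 2 := by
    rw [← Real.rpow_mul_natCast hC.le]; congr 1; push_cast; field_simp
  have e2 : (p.total t : ℝ) ^ (2 - (1 + 2 * p.rho * s) / (1 + p.rho)) =
      ((p.total t : ℝ) / (p.total t : ℝ) ^ ((1 + 2 * p.rho * s) / (2 * (1 + p.rho)))) ^ 2 := by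
    rw [div_pow, ← Real.rpow_mul_natCast hN.le, Real.rpow_sub hN]
    congr 1
    · norm_num
    · congr 1; push_cast; field_simp
  rw [e1, e2, ← mul_assoc, ← mul_assoc, Real.sqrt_mul (by positivity), Real.sqrt_mul (by positivity),
    Real.sqrt_mul hΛ, Real.sqrt_sq (by positivity), Real.sqrt_sq (by positivity)]
  field_simp

variable {d : ℕ} {Ω : Type*} [mΩ : MeasurableSpace Ω] {P : Measure Ω}

open Matrix in
lemma integral_norm_toEuclideanCLM_sq {K : Matrix (Fin d) (Fin d) ℝ} (hK : Kᵀ = K)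
    {X : Ω → EuclideanSpace ℝ (Fin d)} (hX : MemLp X 2 P) :
    ∫ ω, ‖toEuclideanCLM (𝕜 := ℝ) K (X ω)‖ ^ 2 ∂P =
      (K * Matrix.of (fun i j => ∫ ω, X ω i * X ω j ∂P) * K).trace := by
  have hexp : ∀ S : Matrix (Fin d) (Fin d) ℝ,
      (K * S * K).trace = ∑ i, ∑ j, S i j * (K * K) j i := by
    intro S
    rw [Matrix.mul_assoc, trace_mul_comm, Matrix.mul_assoc]
    rfl
  have hpt : ∀ ω, ‖toEuclideanCLM (𝕜 := ℝ) K (X ω)‖ ^ 2 =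
      ∑ i, ∑ j, X ω i * X ω j * (K * K) j i := fun ω => by
    have := trace_mul_vecMulVec_mul hK (X ω).ofLp
    rw [hexp] at this
    exact this.symm
  have hc : ∀ i, MemLp (fun ω => X ω i) 2 P := fun i => by
    refine hX.of_le ?_ (Eventually.of_forall fun ω => PiLp.norm_apply_le (X ω) i)
    exact (EuclideanSpace.proj (𝕜 := ℝ) i).continuous.comp_aestronglyMeasurable
      hX.aestronglyMeasurable
  have hi : ∀ i j, Integrable (fun ω => X ω i * X ω j) P := fun i j => (hc i).integrable_mul (hc j)
  simp only [hpt]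
  rw [hexp, integral_finsetSum _ fun i _ => integrable_finsetSum _ fun j _ =>
    (hi i j).mul_const _]
  refine Finset.sum_congr rfl fun i _ => ?_
  rw [integral_finsetSum _ fun j _ => (hi i j).mul_const _]
  refine Finset.sum_congr rfl fun j _ => ?_
  rw [integral_mul_const]
  rfl

end Leading

/-! ### Weighted sums in `L²` and summation by parts for vectors -/

section Lp

variable {Ω E : Type*} {mΩ : MeasurableSpace Ω} {P : Measure Ω} [NormedAddCommGroup E]

lemma lpNorm_two_congr_ae {X Y : Ω → E} (hX : AEStronglyMeasurable X P) (h : X =ᵐ[P] Y) :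
    lpNorm X 2 P = lpNorm Y 2 P := by
  rw [← toReal_eLpNorm hX, ← toReal_eLpNorm (hX.congr h), eLpNorm_congr_ae h]

variable [NormedSpace ℝ E]

lemma lpNorm_sum_smul_le {c b : ℕ → ℝ} (hc : ∀ i, 0 ≤ c i) {X : ℕ → Ω → E}
    (hX : ∀ i, MemLp (X i) 2 P) (hb : ∀ i, lpNorm (X i) 2 P ≤ b i) (t : ℕ) :
    MemLp (fun ω => ∑ i ∈ Finset.range t, c i • X i ω) 2 P ∧
      lpNorm (fun ω => ∑ i ∈ Finset.range t, c i • X i ω) 2 P ≤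
        ∑ i ∈ Finset.range t, c i * b i := by
  refine ⟨memLp_finsetSum _ fun i _ => (hX i).const_smul (c i), ?_⟩
  have e : (fun ω => ∑ i ∈ Finset.range t, c i • X i ω) = ∑ i ∈ Finset.range t, c i • X i := by
    funext ω; simp
  rw [e]
  refine (lpNorm_sum_le (fun i _ => (hX i).const_smul (c i)) (by norm_num)).trans
    (Finset.sum_le_sum fun i _ => ?_)
  rw [lpNorm_const_smul, coe_nnnorm, Real.norm_of_nonneg (hc i)]
  exact mul_le_mul_of_nonneg_left (hb i) (hc i)

end Lp

lemma sum_smul_sub_succ {E : Type*} [AddCommGroup E] [Module ℝ E] (w : ℕ → ℝ) (x : ℕ → E)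
    (hw : w 0 = 0) (t : ℕ) :
    ∑ i ∈ Finset.range t, w (i + 1) • (x i - x (i + 1)) =
      ∑ i ∈ Finset.range t, (w (i + 1) - w i) • x i - w t • x t := by
  induction t with
  | zero => simp [hw]
  | succ t ih =>
    rw [Finset.sum_range_succ, Finset.sum_range_succ, ih]
    module

lemma Params.errRate_succ_le {p : Params} (hp : p.Valid) (ha : 0 < p.decay) (i : ℕ) :
    p.errRate (i + 1) ≤ p.errRate i := by
  have h : ((i + 1 : ℕ) : ℝ) ≤ ((i + 1 + 1 : ℕ) : ℝ) := by push_cast; linarith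
  have h0 : (0 : ℝ) < ((i + 1 : ℕ) : ℝ) := by positivity
  have h1 := mul_nonneg hp.rho_nonneg hp.sigma_mem.1
  have h2 := mul_nonneg hp.rho_nonneg hp.nu_pos.le
  have e1 := Real.rpow_le_rpow_of_nonpos h0 h
    (by linarith : -(p.rho * p.sigma + p.decay / 2) ≤ 0)
  have e2 := Real.rpow_le_rpow_of_nonpos h0 h (by linarith : -(p.rho * p.nu) ≤ 0)
  unfold errRate
  split_ifs <;> linarith

/-! ### The leading term of the averaged iterates -/

namespace Model

variable {d : ℕ} {Ω : Type*} [mΩ : MeasurableSpace Ω]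
  {p : Params} {P : Measure Ω} {𝓕 : Filtration ℕ mΩ}
  {Θ : Set (EuclideanSpace ℝ (Fin d))}
  {g : ℕ → Ω → EuclideanSpace ℝ (Fin d) → EuclideanSpace ℝ (Fin d)}
  {F : EuclideanSpace ℝ (Fin d) → ℝ} {θs : EuclideanSpace ℝ (Fin d)}
  {θ : ℕ → Ω → EuclideanSpace ℝ (Fin d)}

open Matrix in
lemma hessian_inverse (h : Model p P 𝓕 Θ g F θs θ) :
    ((hessianMatrix F θs)⁻¹)ᵀ = (hessianMatrix F θs)⁻¹ ∧
      (∀ v, toEuclideanCLM (𝕜 := ℝ) (hessianMatrix F θs)⁻¹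
        (fderiv ℝ (gradient F) θs v) = v) ∧
      ∀ v, ‖toEuclideanCLM (𝕜 := ℝ) (hessianMatrix F θs)⁻¹ v‖ ≤ p.mu⁻¹ * ‖v‖ :=
  inverse_of_coercive (toEuclideanCLM_hessianMatrix F θs)
    (inner_fderiv_gradient_comm h.quasiConvex.differentiable
      (h.smooth.twice_differentiable θs h.minimizer_mem)) h.valid.mu_pos
    (h.quasiConvex.mu_le_hessian h.mem_interior
      (h.smooth.twice_differentiable θs h.minimizer_mem))

lemma Lam_nonneg (h : Model p P 𝓕 Θ g F θs θ) {S : Matrix (Fin d) (Fin d) ℝ}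
    {St : ℕ → Matrix (Fin d) (Fin d) ℝ} (hS : ScoreCovariance p P g θs S St) :
    0 ≤ Lam F θs S :=
  trace_mul_mul_nonneg h.hessian_inverse.1 hS.posSemidef

variable [IsProbabilityMeasure P]

-- Conjugation by the symmetric matrix `H⁻¹` followed by the trace preserves the semidefinite
-- inequality. The part `Σ` gives `Λ`; the part `Σ_t` is bounded by `μ⁻² Tr Σ_t`, as `‖H⁻¹‖ ≤ 1 /
-- μ`.
open Matrix in
lemma score_second_moment_le (h : Model p P 𝓕 Θ g F θs θ) {S : Matrix (Fin d) (Fin d) ℝ}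
    {St : ℕ → Matrix (Fin d) (Fin d) ℝ} (hS : ScoreCovariance p P g θs S St) (i : ℕ) :
    ∫ ω, ‖toEuclideanCLM (𝕜 := ℝ) (hessianMatrix F θs)⁻¹ (g (i + 1) ω θs)‖ ^ 2 ∂P ≤
      (p.batch (i + 1) : ℝ) ^ (-(2 * p.sigma)) * (Lam F θs S +
        p.mu⁻¹ ^ 2 * (p.Csigma' * (p.batch (i + 1) : ℝ) ^ (-(2 * p.sigma')))) := by
  obtain ⟨hsym, -, hbd⟩ := h.hessian_inverse
  have hn := h.valid.batch_pos (t := i + 1) (by omega)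
  rw [integral_norm_toEuclideanCLM_sq hsym (memLp_two_of_four (h.score_memLp i))]
  change ((hessianMatrix F θs)⁻¹ * scoreMatrix P g θs (i + 1) * (hessianMatrix F θs)⁻¹).trace ≤ _
  have h1 := trace_mul_mul_nonneg hsym (hS.le (i + 1) (by omega))
  have h2 := trace_mul_posSemidef_mul_le hsym (hS.posSemidef_t (i + 1) (by omega)) hbd
  rw [hS.trace_t (i + 1) (by omega)] at h2
  rw [Matrix.mul_sub, Matrix.sub_mul, Matrix.mul_add, Matrix.add_mul, trace_sub, trace_add,
    Matrix.mul_smul, Matrix.smul_mul, trace_smul, smul_eq_mul] at h1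
  rw [Real.rpow_neg hn.le, inv_mul_eq_div, le_div_iff₀ (by positivity), mul_comm]
  unfold Lam
  linarith

lemma leading_le (h : Model p P 𝓕 Θ g F θs θ) {S : Matrix (Fin d) (Fin d) ℝ}
    {St : ℕ → Matrix (Fin d) (Fin d) ℝ} (hS : ScoreCovariance p P g θs S St) {t : ℕ}
    (ht : 1 ≤ t) :
    √(∑ i ∈ Finset.range t, (p.batch (i + 1) : ℝ) ^ 2 *
      ∫ ω, ‖Matrix.toEuclideanCLM (𝕜 := ℝ) (hessianMatrix F θs)⁻¹ (g (i + 1) ω θs)‖ ^ 2 ∂P) /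
        p.total t ≤
      (if p.sigma = 1 / 2 then √(Lam F θs S) / √(p.total t : ℝ) else 0)
      + (if p.sigma < 1 / 2 then
        √2 * √(Lam F θs S) * (p.Crho : ℝ) ^ ((1 - 2 * p.sigma) / (2 * (1 + p.rho)))
          / (p.total t : ℝ) ^ ((1 + 2 * p.rho * p.sigma) / (2 * (1 + p.rho))) else 0)
      + √2 * √p.Csigma'
          * (p.Crho : ℝ) ^ ((1 - 2 * (p.sigma + p.sigma')) / (2 * (1 + p.rho)))
          / (p.mu * (p.total t : ℝ) ^
            ((1 + 2 * p.rho * (p.sigma + p.sigma')) / (2 * (1 + p.rho)))) := by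
  have hp := h.valid
  have hN := hp.total_pos ht
  have hΛ := h.Lam_nonneg hS
  have hmu := hp.mu_pos
  have hC' := hp.Csigma'_nonneg
  have hs := hp.sigma_mem
  have hs' := hp.sigma'_mem
  set Λ := Lam F θs S with hΛdef
  set A := ∑ i ∈ Finset.Icc 1 t, (p.batch i : ℝ) ^ (2 - 2 * p.sigma) with hA
  set B := ∑ i ∈ Finset.Icc 1 t, (p.batch i : ℝ) ^ (2 - 2 * (p.sigma + p.sigma')) with hB
  have hA0 : 0 ≤ A := Finset.sum_nonneg fun i _ => by positivity
  have hB0 : 0 ≤ B := Finset.sum_nonneg fun i _ => by positivity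
  have hsum : ∑ i ∈ Finset.range t, (p.batch (i + 1) : ℝ) ^ 2 *
      ∫ ω, ‖Matrix.toEuclideanCLM (𝕜 := ℝ) (hessianMatrix F θs)⁻¹ (g (i + 1) ω θs)‖ ^ 2 ∂P ≤
      Λ * A + p.mu⁻¹ ^ 2 * (p.Csigma' * B) := by
    calc _ ≤ ∑ i ∈ Finset.range t, (Λ * (p.batch (i + 1) : ℝ) ^ (2 - 2 * p.sigma) +
          p.mu⁻¹ ^ 2 * (p.Csigma' * (p.batch (i + 1) : ℝ) ^ (2 - 2 * (p.sigma + p.sigma')))) := by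
          refine Finset.sum_le_sum fun i _ => ?_
          have hn := hp.batch_pos (t := i + 1) (by omega)
          refine (mul_le_mul_of_nonneg_left (h.score_second_moment_le hS i)
            (by positivity)).trans_eq ?_
          have e1 : (p.batch (i + 1) : ℝ) ^ (2 - 2 * p.sigma) =
              (p.batch (i + 1) : ℝ) ^ 2 * (p.batch (i + 1) : ℝ) ^ (-(2 * p.sigma)) := by
            rw [sub_eq_add_neg, Real.rpow_add hn]; norm_num
          have e2 : (p.batch (i + 1) : ℝ) ^ (2 - 2 * (p.sigma + p.sigma')) =
              (p.batch (i + 1) : ℝ) ^ 2 * ((p.batch (i + 1) : ℝ) ^ (-(2 * p.sigma)) *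
                (p.batch (i + 1) : ℝ) ^ (-(2 * p.sigma'))) := by
            rw [← Real.rpow_add hn, ← Real.rpow_natCast, ← Real.rpow_add hn]
            congr 1; push_cast; ring
          rw [e1, e2]
          ring
      _ = _ := by
          rw [Finset.sum_add_distrib, ← Finset.mul_sum, ← Finset.mul_sum, ← Finset.mul_sum,
            sum_range_succ_eq_sum_Icc (fun i => (p.batch i : ℝ) ^ (2 - 2 * p.sigma)),
            sum_range_succ_eq_sum_Icc
              (fun i => (p.batch i : ℝ) ^ (2 - 2 * (p.sigma + p.sigma')))]
  have hsq := (Real.sqrt_le_sqrt hsum).trans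
    (sqrt_add_le (mul_nonneg hΛ hA0) (by positivity : 0 ≤ p.mu⁻¹ ^ 2 * (p.Csigma' * B)))
  rw [Real.sqrt_mul (by positivity : 0 ≤ p.mu⁻¹ ^ 2), Real.sqrt_sq (by positivity)] at hsq
  have hdiv := div_le_div_of_nonneg_right hsq hN.le
  rw [add_div] at hdiv
  refine hdiv.trans (add_le_add ?_ ?_)
  · rcases hs.2.lt_or_eq with hlt | heq
    · rw [if_neg hlt.ne, if_pos hlt, zero_add]
      exact hp.sqrt_sum_div_total_le hs.1 (by linarith) hΛ ht
    · rw [if_pos heq, if_neg (by rw [heq]; exact lt_irrefl _), add_zero]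
      -- At `σ = 1/2` the summands are the `n_i` themselves, so this case has no factor `√2`.
      have eA : A = p.total t := by
        rw [hA, Params.cast_total]
        refine Finset.sum_congr rfl fun i _ => ?_
        rw [heq]; norm_num
      rw [eA, Real.sqrt_mul hΛ, mul_div_assoc, Real.sqrt_div_self, ← div_eq_mul_inv]
  · have h1 := hp.sqrt_sum_div_total_le (s := p.sigma + p.sigma') (by linarith [hs.1, hs'.1])
      (by linarith [hs.2, hs'.2]) hC' ht
    rw [mul_div_assoc, mul_comm p.mu, ← div_div, div_eq_inv_mul _ p.mu]
    exact mul_le_mul_of_nonneg_left h1 (by positivity)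

end Model

/-! ### The remainder of the linearized recursion -/

namespace Model

variable {d : ℕ} {Ω : Type*} [mΩ : MeasurableSpace Ω]
  {p : Params} {P : Measure Ω} {𝓕 : Filtration ℕ mΩ}
  {Θ : Set (EuclideanSpace ℝ (Fin d))}
  {g : ℕ → Ω → EuclideanSpace ℝ (Fin d) → EuclideanSpace ℝ (Fin d)}
  {F : EuclideanSpace ℝ (Fin d) → ℝ} {θs : EuclideanSpace ℝ (Fin d)}
  {θ : ℕ → Ω → EuclideanSpace ℝ (Fin d)}

lemma gradient_measurable (h : Model p P 𝓕 Θ g F θs θ) (t : ℕ) :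
    AEStronglyMeasurable (fun ω => gradient F (θ t ω)) P := by
  have h1 : Measurable (gradient F) := by
    have : Measurable (fderiv ℝ F) := measurable_fderiv ℝ F
    exact (InnerProductSpace.toDual ℝ
      (EuclideanSpace ℝ (Fin d))).symm.continuous.measurable.comp this
  exact (h1.comp ((h.iterate_measurable t).mono (𝓕.le t) le_rfl)).aestronglyMeasurable

variable [IsProbabilityMeasure P]

/-- `K` is chosen before the dimension, the probability space and the loss: the uniformity of the
remainders in the theorem comes from here. -/
lemma exists_error_bound (p : Params) (hp : p.Valid) (hmu : 0 < p.muNu) (ha : 0 < p.decay)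
    (ha1 : p.decay < 1) :
    ∃ K : ℝ, 0 ≤ K ∧ ∀ {d : ℕ} {Ω : Type*} [mΩ : MeasurableSpace Ω] {P : Measure Ω}
      {𝓕 : Filtration ℕ mΩ} {Θ : Set (EuclideanSpace ℝ (Fin d))}
      {g : ℕ → Ω → EuclideanSpace ℝ (Fin d) → EuclideanSpace ℝ (Fin d)}
      {F : EuclideanSpace ℝ (Fin d) → ℝ} {θs : EuclideanSpace ℝ (Fin d)}
      {θ : ℕ → Ω → EuclideanSpace ℝ (Fin d)} [IsProbabilityMeasure P],
      Model p P 𝓕 Θ g F θs θ → ∀ t, lpNorm (fun ω => θ t ω - θs) 4 P ≤ K * p.errRate t := by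
  obtain ⟨K, hK0, hK⟩ := hp.exists_fourth_moment_bound hmu ha ha1
  refine ⟨K, hK0, fun {d Ω mΩ P 𝓕 Θ g F θs θ} _ h t => ?_⟩
  have h1 := hK (fun t => ∫ ω, ‖θ t ω - θs‖ ^ 4 ∂P)
    (fun t => integral_nonneg fun ω => by positivity) h.init_le h.fourth_moment_recursion t
  rw [← lpNorm_four_pow (h.error_memLp t).aestronglyMeasurable] at h1
  exact le_of_pow_le_pow_left₀ (by norm_num) (mul_nonneg hK0 (p.errRate_nonneg t)) h1

/-- The `L²` norm of the linearization error of the gradient. -/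
lemma linearization_le (h : Model p P 𝓕 Θ g F θs θ) (t : ℕ) :
    MemLp (fun ω => gradient F (θ t ω) - fderiv ℝ (gradient F) θs (θ t ω - θs)) 2 P ∧
    lpNorm (fun ω => gradient F (θ t ω) - fderiv ℝ (gradient F) θs (θ t ω - θs)) 2 P ≤
      p.Chess * lpNorm (fun ω => θ t ω - θs) 4 P ^ 2 := by
  refine lpNorm_two_le_of_norm_le_sq h.valid.Chess_nonneg (h.error_memLp t) ?_
    (Eventually.of_forall fun ω => h.smooth.norm_gradient_sub_le h.convex h.minimizer_mem
      h.quasiConvex.gradient_eq_zero (h.iterate_mem t ω) h.valid.Chess_nonneg)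
  exact (h.gradient_measurable t).sub ((fderiv ℝ (gradient F) θs).continuous.comp_aestronglyMeasurable
    (h.error_memLp t).aestronglyMeasurable)

/-- The `L²` norm of the conditional bias of the gradient estimates. -/
lemma bias_le (h : Model p P 𝓕 Θ g F θs θ) (t : ℕ) :
    MemLp (fun ω => (P[fun ω => g (t + 1) ω (θ t ω) | 𝓕 t]) ω - gradient F (θ t ω)) 2 P ∧
    lpNorm (fun ω => (P[fun ω => g (t + 1) ω (θ t ω) | 𝓕 t]) ω - gradient F (θ t ω)) 2 P ≤
      p.depRate (t + 1) * (p.Dnu * lpNorm (fun ω => θ t ω - θs) 4 P + p.Bnu) := by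
  have hdep := h.depBias (t + 1) (by omega) (θ t) (h.iterate_measurable t) (h.iterate_mem t)
    (by exact_mod_cast h.iterate_memLp t)
  have hm : AEStronglyMeasurable
      (fun ω => (P[fun ω => g (t + 1) ω (θ t ω) | 𝓕 t]) ω - gradient F (θ t ω)) P :=
    integrable_condExp.aestronglyMeasurable.sub (h.gradient_measurable t)
  have h4 := memLp_four_of_integrable hm hdep.2.1
  refine ⟨memLp_two_of_four h4, (lpNorm_two_le_four h4).trans ?_⟩
  have hl : 0 ≤ lpNorm (fun ω => θ t ω - θs) 4 P := lpNorm_nonneg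
  have hν := p.depRate_nonneg (t + 1)
  have hD := h.valid.Dnu_nonneg
  have hB := h.valid.Bnu_nonneg
  refine le_of_pow_le_pow_left₀ (n := 4) (by norm_num) (by positivity) ?_
  rw [lpNorm_four_pow hm]
  refine hdep.2.2.trans ?_
  rw [← lpNorm_four_pow (h.error_memLp t).aestronglyMeasurable, mul_pow, ← mul_pow p.Dnu]
  refine mul_le_mul_of_nonneg_left ?_ (by positivity)
  set y := p.Dnu * lpNorm (fun ω => θ t ω - θs) 4 P
  have hy : 0 ≤ y := by positivity
  have : 0 ≤ 4 * y ^ 3 * p.Bnu + 6 * y ^ 2 * p.Bnu ^ 2 + 4 * y * p.Bnu ^ 3 := by positivity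
  nlinarith

/-- The second moment of the fluctuation of the gradient estimates around the scores. -/
lemma fluctuation_le (h : Model p P 𝓕 Θ g F θs θ) (t : ℕ) :
    MemLp (fun ω => g (t + 1) ω (θ t ω) - g (t + 1) ω θs) 2 P ∧
    ∫ ω, ‖g (t + 1) ω (θ t ω) - g (t + 1) ω θs‖ ^ 2 ∂P ≤
      (p.Ckappa * lpNorm (fun ω => θ t ω - θs) 4 P) ^ 2 := by
  have hexp := h.expSmooth (t + 1) (by omega) (θ t) (h.iterate_measurable t) (h.iterate_mem t)
    (by exact_mod_cast h.iterate_memLp t)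
  have h4 : MemLp (fun ω => g (t + 1) ω (θ t ω) - g (t + 1) ω θs) 4 P :=
    (h.grad_memLp t).sub (h.score_memLp t)
  have h2 := memLp_two_of_four h4
  refine ⟨h2, ?_⟩
  have hκ := h.valid.Ckappa_pos
  have hl : 0 ≤ lpNorm (fun ω => θ t ω - θs) 4 P := lpNorm_nonneg
  have hle : lpNorm (fun ω => g (t + 1) ω (θ t ω) - g (t + 1) ω θs) 2 P ≤
      p.Ckappa * lpNorm (fun ω => θ t ω - θs) 4 P := by
    refine (lpNorm_two_le_four h4).trans ?_
    refine le_of_pow_le_pow_left₀ (n := 4) (by norm_num) (by positivity) ?_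
    rw [lpNorm_four_pow h4.aestronglyMeasurable, mul_pow,
      lpNorm_four_pow (h.error_memLp t).aestronglyMeasurable]
    exact hexp.2
  rw [lpNorm_two_eq_sqrt h2.aestronglyMeasurable] at hle
  exact (Real.sqrt_le_left (by positivity)).1 hle

/-- The `L²` norm of the displacement caused by the projection. -/
lemma overshoot_le (h : Model p P 𝓕 Θ g F θs θ) (t : ℕ) :
    MemLp (fun ω => θ (t + 1) ω - (θ t ω - p.rate (t + 1) • g (t + 1) ω (θ t ω))) 2 P ∧
    lpNorm (fun ω => θ (t + 1) ω - (θ t ω - p.rate (t + 1) • g (t + 1) ω (θ t ω))) 2 P ≤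
      p.rate (t + 1) * (|p.G| / p.DTheta ^ 2) *
        lpNorm (fun ω => θ (t + 1) ω - θs) 4 P ^ 2 := by
  have hr := h.valid.rate_pos (t := t + 1) (by omega)
  refine lpNorm_two_le_of_norm_le_sq (by positivity) (h.error_memLp (t + 1)) ?_ ?_
  · exact ((h.iterate_memLp (t + 1)).sub ((h.iterate_memLp t).sub
      ((h.grad_memLp t).const_smul (p.rate (t + 1))))).aestronglyMeasurable
  · filter_upwards [h.overshoot t] with ω hω
    rw [mul_assoc]
    exact hω

/-- The remainder in the linearized recursion: everything but the weighted sum of the centred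
scores. -/
noncomputable def rest (p : Params) (P : Measure Ω) (𝓕 : Filtration ℕ mΩ)
    (g : ℕ → Ω → EuclideanSpace ℝ (Fin d) → EuclideanSpace ℝ (Fin d))
    (F : EuclideanSpace ℝ (Fin d) → ℝ) (θs : EuclideanSpace ℝ (Fin d))
    (θ : ℕ → Ω → EuclideanSpace ℝ (Fin d)) (t : ℕ) : Ω → EuclideanSpace ℝ (Fin d) :=
  (fun ω => ∑ i ∈ Finset.range t, (p.weight (i + 1) - p.weight i) • (θ i ω - θs))
  - (fun ω => p.weight t • (θ t ω - θs))
  + (fun ω => ∑ i ∈ Finset.range t, p.weight (i + 1) •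
      (θ (i + 1) ω - (θ i ω - p.rate (i + 1) • g (i + 1) ω (θ i ω))))
  - (fun ω => ∑ i ∈ Finset.range t, (p.batch (i + 1) : ℝ) •
      (gradient F (θ i ω) - fderiv ℝ (gradient F) θs (θ i ω - θs)))
  - (fun ω => ∑ i ∈ Finset.range t, (p.batch (i + 1) : ℝ) •
      ((P[fun ω => g (i + 1) ω (θ i ω) | 𝓕 i]) ω - gradient F (θ i ω)))
  - (fun ω => ∑ i ∈ Finset.range t, (p.batch (i + 1) : ℝ) •
      ((g (i + 1) ω (θ i ω) - g (i + 1) ω θs) -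
        (P[fun ω => g (i + 1) ω (θ i ω) - g (i + 1) ω θs | 𝓕 i]) ω))

/-- Minkowski's inequality over the six pieces of `rest`. Displacement and linearization use the
square of the `L⁴` rate, which is why fourth moments are needed for an `L²` conclusion; only the
fluctuation uses orthogonality. -/
lemma rest_le (h : Model p P 𝓕 Θ g F θs θ) (ha : 1 / 2 < p.decay) {K W : ℝ} (hK0 : 0 ≤ K)
    (hK : ∀ t, lpNorm (fun ω => θ t ω - θs) 4 P ≤ K * p.errRate t)
    (hW : ∀ t : ℕ, 1 ≤ t →
      ∑ i ∈ Finset.range t, (p.weight (i + 1) - p.weight i) * p.errRate i +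
        p.weight t * p.errRate t ≤ W * (p.total t * (1 + Real.log t) * p.remainder t))
    {t : ℕ} (ht : 1 ≤ t) :
    MemLp (rest p P 𝓕 g F θs θ t) 2 P ∧ lpNorm (rest p P 𝓕 g F θs θ t) 2 P ≤
      (K * W + (|p.G| / p.DTheta ^ 2) * K ^ 2 * (16 * p.Crho) + p.Chess * K ^ 2 * (16 * p.Crho) +
        4 * p.Crho * (2 * p.Dnu * K + p.Bnu) + p.Ckappa * K * (24 * p.Crho)) *
        (p.total t * (1 + Real.log t) * p.remainder t) := by
  have hp := h.valid
  have ha0 : 0 < p.decay := by linarith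
  have hz := p.errRate_nonneg
  have hwm : ∀ i, 0 ≤ p.weight (i + 1) - p.weight i := fun i =>
    sub_nonneg.2 (hp.weight_le_succ ha0 i)
  have hw : ∀ i, 0 ≤ p.weight (i + 1) := fun i => by
    have := hp.rate_pos (t := i + 1) (by omega)
    unfold Params.weight
    positivity
  have hwt : 0 ≤ p.weight t := by
    obtain ⟨s, rfl⟩ : ∃ s, t = s + 1 := ⟨t - 1, by omega⟩
    exact hw s
  have hx2 : ∀ i, MemLp (fun ω => θ i ω - θs) 2 P := fun i => memLp_two_of_four (h.error_memLp i)
  have hxle : ∀ i, lpNorm (fun ω => θ i ω - θs) 2 P ≤ K * p.errRate i := fun i =>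
    (lpNorm_two_le_four (h.error_memLp i)).trans (hK i)
  have hl0 : ∀ i, 0 ≤ lpNorm (fun ω => θ i ω - θs) 4 P := fun i => lpNorm_nonneg
  have hsq : ∀ i, lpNorm (fun ω => θ i ω - θs) 4 P ^ 2 ≤ K ^ 2 * p.errRate i ^ 2 := fun i => by
    rw [← mul_pow]; exact pow_le_pow_left₀ (hl0 i) (hK i) 2
  set X := (p.total t : ℝ) * (1 + Real.log t) * p.remainder t with hX
  have sqsum := hp.sum_batch_errRate_sq_le ha0 ht
  -- the two parts of the summation by parts
  have T1 := lpNorm_sum_smul_le hwm hx2 hxle t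
  have T2m : MemLp (fun ω => p.weight t • (θ t ω - θs)) 2 P := (hx2 t).const_smul (p.weight t)
  have T2 : lpNorm (fun ω => p.weight t • (θ t ω - θs)) 2 P ≤
      p.weight t * (K * p.errRate t) := by
    have e : lpNorm (fun ω => p.weight t • (θ t ω - θs)) 2 P =
        lpNorm (p.weight t • fun ω => θ t ω - θs) 2 P := rfl
    rw [e, lpNorm_const_smul, coe_nnnorm, Real.norm_of_nonneg hwt]
    exact mul_le_mul_of_nonneg_left (hxle t) hwt
  have T12 : ∑ i ∈ Finset.range t, (p.weight (i + 1) - p.weight i) * (K * p.errRate i) +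
      p.weight t * (K * p.errRate t) ≤ K * W * X := by
    have := mul_le_mul_of_nonneg_left (hW t ht) hK0
    rw [mul_add, Finset.mul_sum, ← mul_assoc K W] at this
    refine le_trans (le_of_eq ?_) this
    congr 1
    · exact Finset.sum_congr rfl fun i _ => by ring
    · ring
  have T3 := lpNorm_sum_smul_le hw (fun i => (h.overshoot_le i).1) (fun i => (h.overshoot_le i).2) t
  have T3' : ∑ i ∈ Finset.range t, p.weight (i + 1) * (p.rate (i + 1) * (|p.G| / p.DTheta ^ 2) *
      lpNorm (fun ω => θ (i + 1) ω - θs) 4 P ^ 2) ≤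
      (|p.G| / p.DTheta ^ 2) * K ^ 2 * (16 * p.Crho) * X := by
    calc _ ≤ ∑ i ∈ Finset.range t, (|p.G| / p.DTheta ^ 2) * K ^ 2 *
          ((p.batch (i + 1) : ℝ) * p.errRate i ^ 2) := by
          refine Finset.sum_le_sum fun i _ => ?_
          have hr := hp.rate_pos (t := i + 1) (by omega)
          -- The weight cancels the learning rate in the displacement, leaving `n_{i+1}` times the
          -- squared error at time `i + 1`; monotonicity of `errRate` brings the index back to `i`.
          have e : p.weight (i + 1) * p.rate (i + 1) = p.batch (i + 1) := by
            unfold Params.weight; field_simp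
          have h1 : lpNorm (fun ω => θ (i + 1) ω - θs) 4 P ^ 2 ≤ K ^ 2 * p.errRate i ^ 2 :=
            (hsq (i + 1)).trans (by
              have := Params.errRate_succ_le hp ha0 i
              have := hz (i + 1)
              gcongr)
          calc _ = (p.weight (i + 1) * p.rate (i + 1)) * (|p.G| / p.DTheta ^ 2) *
                lpNorm (fun ω => θ (i + 1) ω - θs) 4 P ^ 2 := by ring
            _ ≤ (p.batch (i + 1) : ℝ) * (|p.G| / p.DTheta ^ 2) * (K ^ 2 * p.errRate i ^ 2) := by
                rw [e]; gcongr
            _ = _ := by ring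
      _ = (|p.G| / p.DTheta ^ 2) * K ^ 2 *
          ∑ i ∈ Finset.range t, (p.batch (i + 1) : ℝ) * p.errRate i ^ 2 := by rw [Finset.mul_sum]
      _ ≤ (|p.G| / p.DTheta ^ 2) * K ^ 2 * (16 * p.Crho * X) := by gcongr
      _ = _ := by ring
  have hn : ∀ i, (0 : ℝ) ≤ p.batch (i + 1) := fun i => by positivity
  have T4 := lpNorm_sum_smul_le hn (fun i => (h.linearization_le i).1)
    (fun i => (h.linearization_le i).2) t
  have hCh := hp.Chess_nonneg
  have T4' : ∑ i ∈ Finset.range t, (p.batch (i + 1) : ℝ) *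
      (p.Chess * lpNorm (fun ω => θ i ω - θs) 4 P ^ 2) ≤ p.Chess * K ^ 2 * (16 * p.Crho) * X := by
    calc _ ≤ ∑ i ∈ Finset.range t, p.Chess * K ^ 2 *
          ((p.batch (i + 1) : ℝ) * p.errRate i ^ 2) := by
          refine Finset.sum_le_sum fun i _ => ?_
          calc _ ≤ (p.batch (i + 1) : ℝ) * (p.Chess * (K ^ 2 * p.errRate i ^ 2)) := by
                have := hsq i
                gcongr
            _ = _ := by ring
      _ = p.Chess * K ^ 2 *
          ∑ i ∈ Finset.range t, (p.batch (i + 1) : ℝ) * p.errRate i ^ 2 := by rw [Finset.mul_sum]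
      _ ≤ p.Chess * K ^ 2 * (16 * p.Crho * X) := by gcongr
      _ = _ := by ring
  have T5 := lpNorm_sum_smul_le hn (fun i => (h.bias_le i).1)
    (b := fun i => p.depRate (i + 1) * (p.Dnu * (K * p.errRate i) + p.Bnu))
    (fun i => (h.bias_le i).2.trans (by
      have := p.depRate_nonneg (i + 1)
      have := hp.Dnu_nonneg
      have := hK i
      gcongr)) t
  have T5' := hp.sum_batch_bias_le ha0 hK0 ht
  have T6 := lpNorm_sum_sub_condExp_le 𝓕 (fun i => (p.batch (i + 1) : ℝ))
    (fun i => (h.grad_stronglyMeasurable i).sub (h.score_stronglyMeasurable i))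
    (fun i => (h.fluctuation_le i).1) t
  have hκ := hp.Ckappa_pos
  have T6' : √(∑ i ∈ Finset.range t, (p.batch (i + 1) : ℝ) ^ 2 *
      ∫ ω, ‖g (i + 1) ω (θ i ω) - g (i + 1) ω θs‖ ^ 2 ∂P) ≤
      p.Ckappa * K * (24 * p.Crho) * X := by
    calc _ ≤ √((p.Ckappa * K) ^ 2 *
          ∑ i ∈ Finset.range t, (p.batch (i + 1) : ℝ) ^ 2 * p.errRate i ^ 2) := by
          refine Real.sqrt_le_sqrt ?_
          rw [Finset.mul_sum]
          refine Finset.sum_le_sum fun i _ => ?_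
          have h1 : (p.Ckappa * lpNorm (fun ω => θ i ω - θs) 4 P) ^ 2 ≤
              (p.Ckappa * (K * p.errRate i)) ^ 2 := by
            have := hK i
            have := hl0 i
            gcongr
          calc _ ≤ (p.batch (i + 1) : ℝ) ^ 2 * (p.Ckappa * (K * p.errRate i)) ^ 2 :=
                mul_le_mul_of_nonneg_left ((h.fluctuation_le i).2.trans h1) (by positivity)
            _ = _ := by ring
      _ = p.Ckappa * K *
          √(∑ i ∈ Finset.range t, (p.batch (i + 1) : ℝ) ^ 2 * p.errRate i ^ 2) := by
          rw [Real.sqrt_mul (by positivity), Real.sqrt_sq (by positivity)]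
      _ ≤ p.Ckappa * K * (24 * p.Crho * X) := by
          have := hp.sqrt_sum_batch_sq_errRate_sq_le ha ht
          gcongr
      _ = _ := by ring
  have m12 := T1.1.sub T2m
  have m3 := m12.add T3.1
  have m4 := m3.sub T4.1
  have m5 := m4.sub T5.1
  refine ⟨m5.sub T6.1, ?_⟩
  have l12 := lpNorm_sub_le (g := fun ω => p.weight t • (θ t ω - θs)) T1.1 (by norm_num : (1 : ENNReal) ≤ 2)
  have l3 := lpNorm_add_le (g := fun ω => ∑ i ∈ Finset.range t, p.weight (i + 1) •
      (θ (i + 1) ω - (θ i ω - p.rate (i + 1) • g (i + 1) ω (θ i ω)))) m12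
      (by norm_num : (1 : ENNReal) ≤ 2)
  have l4 := lpNorm_sub_le (g := fun ω => ∑ i ∈ Finset.range t, (p.batch (i + 1) : ℝ) •
      (gradient F (θ i ω) - fderiv ℝ (gradient F) θs (θ i ω - θs))) m3
      (by norm_num : (1 : ENNReal) ≤ 2)
  have l5 := lpNorm_sub_le (g := fun ω => ∑ i ∈ Finset.range t, (p.batch (i + 1) : ℝ) •
      ((P[fun ω => g (i + 1) ω (θ i ω) | 𝓕 i]) ω - gradient F (θ i ω))) m4
      (by norm_num : (1 : ENNReal) ≤ 2)
  have l6 := lpNorm_sub_le (g := fun ω => ∑ i ∈ Finset.range t, (p.batch (i + 1) : ℝ) •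
      ((g (i + 1) ω (θ i ω) - g (i + 1) ω θs) -
        (P[fun ω => g (i + 1) ω (θ i ω) - g (i + 1) ω θs | 𝓕 i]) ω)) m5
      (by norm_num : (1 : ENNReal) ≤ 2)
  have f3 := T3.2.trans T3'
  have f4 := T4.2.trans T4'
  have f5 := T5.2.trans T5'
  have f6 : lpNorm (fun ω => ∑ i ∈ Finset.range t, (p.batch (i + 1) : ℝ) •
      ((g (i + 1) ω (θ i ω) - g (i + 1) ω θs) -
        (P[fun ω => g (i + 1) ω (θ i ω) - g (i + 1) ω θs | 𝓕 i]) ω)) 2 P ≤ _ := T6.2.trans T6'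
  have f12 := T1.2
  refine l6.trans ?_
  linarith

/-- Linearization of the averaged recursion around the minimizer. -/
lemma average_sub_eq (h : Model p P 𝓕 Θ g F θs θ) (ha : 0 < p.decay) {t : ℕ} (ht : 1 ≤ t) :
    (fun ω => average p θ t ω - θs) =ᵐ[P] fun ω => (p.total t : ℝ)⁻¹ •
      (Matrix.toEuclideanCLM (𝕜 := ℝ) (hessianMatrix F θs)⁻¹ (rest p P 𝓕 g F θs θ t ω) -
        ∑ i ∈ Finset.range t, (p.batch (i + 1) : ℝ) •
          (Matrix.toEuclideanCLM (𝕜 := ℝ) (hessianMatrix F θs)⁻¹ (g (i + 1) ω θs) -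
            (P[fun ω => Matrix.toEuclideanCLM (𝕜 := ℝ) (hessianMatrix F θs)⁻¹
              (g (i + 1) ω θs) | 𝓕 i]) ω)) := by
  have hp := h.valid
  set T := Matrix.toEuclideanCLM (𝕜 := ℝ) (hessianMatrix F θs)⁻¹ with hT
  obtain ⟨-, hleft, -⟩ := h.hessian_inverse
  rw [← hT] at hleft
  have hN := hp.total_pos ht
  have hGi : ∀ i, Integrable (fun ω => g (i + 1) ω (θ i ω)) P := fun i =>
    (h.grad_memLp i).integrable (by norm_num)
  have hSi : ∀ i, Integrable (fun ω => g (i + 1) ω θs) P := fun i =>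
    (h.score_memLp i).integrable (by norm_num)
  have hsub : ∀ i, P[fun ω => g (i + 1) ω (θ i ω) - g (i + 1) ω θs | 𝓕 i] =ᵐ[P]
      P[fun ω => g (i + 1) ω (θ i ω) | 𝓕 i] - P[fun ω => g (i + 1) ω θs | 𝓕 i] := fun i =>
    condExp_sub (hGi i) (hSi i) (𝓕 i)
  have hcomm : ∀ i, (fun ω => T ((P[fun ω => g (i + 1) ω θs | 𝓕 i]) ω)) =ᵐ[P]
      P[fun ω => T (g (i + 1) ω θs) | 𝓕 i] := fun i => T.comp_condExp_comm (hSi i)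
  filter_upwards [ae_all_iff.2 hsub, ae_all_iff.2 hcomm] with ω e1 e2
  -- An exact identity: the first two terms add up to `n_{i+1} g`, the other four to `n_{i+1} H (θ_i
  -- - θ*) - n_{i+1} g`. In particular, both conditional expectations and `∇F` cancel.
  have hstep : ∀ i, (p.batch (i + 1) : ℝ) • fderiv ℝ (gradient F) θs (θ i ω - θs) =
      p.weight (i + 1) • ((θ i ω - θs) - (θ (i + 1) ω - θs)) +
      p.weight (i + 1) • (θ (i + 1) ω - (θ i ω - p.rate (i + 1) • g (i + 1) ω (θ i ω))) -
      (p.batch (i + 1) : ℝ) • (gradient F (θ i ω) - fderiv ℝ (gradient F) θs (θ i ω - θs)) -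
      (p.batch (i + 1) : ℝ) •
        ((P[fun ω => g (i + 1) ω (θ i ω) | 𝓕 i]) ω - gradient F (θ i ω)) -
      (p.batch (i + 1) : ℝ) • ((g (i + 1) ω (θ i ω) - g (i + 1) ω θs) -
        (P[fun ω => g (i + 1) ω (θ i ω) - g (i + 1) ω θs | 𝓕 i]) ω) -
      (p.batch (i + 1) : ℝ) •
        (g (i + 1) ω θs - (P[fun ω => g (i + 1) ω θs | 𝓕 i]) ω) := by
    intro i
    have hr := hp.rate_pos (t := i + 1) (by omega)
    have e : (p.batch (i + 1) : ℝ) = p.weight (i + 1) * p.rate (i + 1) := by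
      unfold Params.weight; field_simp
    rw [e1 i, Pi.sub_apply, e]
    module
  have hsum : ∑ i ∈ Finset.range t, (p.batch (i + 1) : ℝ) •
      fderiv ℝ (gradient F) θs (θ i ω - θs) = rest p P 𝓕 g F θs θ t ω -
        ∑ i ∈ Finset.range t, (p.batch (i + 1) : ℝ) •
          (g (i + 1) ω θs - (P[fun ω => g (i + 1) ω θs | 𝓕 i]) ω) := by
    rw [Finset.sum_congr rfl fun i _ => hstep i]
    simp only [Finset.sum_sub_distrib, Finset.sum_add_distrib]
    rw [sum_smul_sub_succ p.weight (fun i => θ i ω - θs) (Params.weight_zero (hp.alpha_pos ha)) t]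
    rfl
  have havg : average p θ t ω - θs = (p.total t : ℝ)⁻¹ •
      ∑ i ∈ Finset.range t, (p.batch (i + 1) : ℝ) • (θ i ω - θs) := by
    have : θs = (p.total t : ℝ)⁻¹ • ∑ i ∈ Finset.range t, (p.batch (i + 1) : ℝ) • θs := by
      rw [← Finset.sum_smul, sum_range_succ_eq_sum_Icc (fun i => (p.batch i : ℝ)),
        ← Params.cast_total, smul_smul, inv_mul_cancel₀ hN.ne', one_smul]
    nth_rewrite 1 [this]
    unfold average
    rw [← smul_sub, ← Finset.sum_sub_distrib]
    simp only [smul_sub]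
  rw [havg]
  congr 1
  have h3 := congrArg T hsum
  rw [map_sum, map_sub, map_sum] at h3
  simp only [map_smul, hleft, map_sub] at h3
  rw [h3]
  congr 1
  exact Finset.sum_congr rfl fun i _ => by rw [← e2 i]

end Model

/-! ### Assembling the bound for the averaged error -/

namespace Params

variable {p : Params}

lemma orderMain_nonneg (p : Params) (t : ℕ) : 0 ≤ p.orderMain t :=
  le_max_of_le_left (by positivity)

lemma orderDep_nonneg (p : Params) (t : ℕ) : 0 ≤ p.orderDep t := by
  unfold orderDep; positivity

lemma orderBias_nonneg (p : Params) (t : ℕ) : 0 ≤ p.orderBias t :=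
  le_max_of_le_left (by positivity)

lemma isSoftO_mul_log {K : ℝ} (hK : 0 ≤ K) (hp : p.Valid) {v : ℕ → ℝ} (hv : ∀ t, 0 ≤ v t) :
    p.IsSoftO (fun t => K * (1 + Real.log (p.total t : ℝ)) * v t) v := by
  refine ⟨K, 1, fun t ht => ?_⟩
  have h1 : (1 : ℝ) ≤ p.total t := (by exact_mod_cast ht : (1 : ℝ) ≤ t).trans (hp.natCast_le_total t)
  have := Real.log_nonneg h1
  have := hv t
  rw [pow_one, abs_of_nonneg (by positivity)]

end Params

namespace Model

variable {d : ℕ} {Ω : Type*} [mΩ : MeasurableSpace Ω]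
  {p : Params} {P : Measure Ω} {𝓕 : Filtration ℕ mΩ}
  {Θ : Set (EuclideanSpace ℝ (Fin d))}
  {g : ℕ → Ω → EuclideanSpace ℝ (Fin d) → EuclideanSpace ℝ (Fin d)}
  {F : EuclideanSpace ℝ (Fin d) → ℝ} {θs : EuclideanSpace ℝ (Fin d)}
  {θ : ℕ → Ω → EuclideanSpace ℝ (Fin d)} [IsProbabilityMeasure P]

open Matrix in
/-- The error of the averaged iterate is bounded by that of the average of the centred scores, up to the
remainder of the linearization. -/
lemma average_error_le (h : Model p P 𝓕 Θ g F θs θ) (ha : 0 < p.decay) {t : ℕ} (ht : 1 ≤ t)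
    {Q : ℝ} (hm : MemLp (rest p P 𝓕 g F θs θ t) 2 P)
    (hQ : lpNorm (rest p P 𝓕 g F θs θ t) 2 P ≤ p.total t * Q) :
    MemLp (average p θ t) 2 P ∧ √(∫ ω, ‖average p θ t ω - θs‖ ^ 2 ∂P) ≤
      √(∑ i ∈ Finset.range t, (p.batch (i + 1) : ℝ) ^ 2 *
        ∫ ω, ‖toEuclideanCLM (𝕜 := ℝ) (hessianMatrix F θs)⁻¹ (g (i + 1) ω θs)‖ ^ 2 ∂P) /
        p.total t + p.mu⁻¹ * Q := by
  have hN := h.valid.total_pos ht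
  have hmu := h.valid.mu_pos
  have heq := h.average_sub_eq ha ht
  obtain ⟨-, -, hbd⟩ := h.hessian_inverse
  set T := toEuclideanCLM (𝕜 := ℝ) (hessianMatrix F θs)⁻¹ with hT
  have hTm : MemLp (fun ω => T (rest p P 𝓕 g F θs θ t ω)) 2 P := T.comp_memLp' hm
  have hTl := lpNorm_clm_le (inv_nonneg.2 hmu.le) hm
    (Y := fun ω => T (rest p P 𝓕 g F θs θ t ω)) fun ω => hbd _
  have hS := lpNorm_sum_sub_condExp_le 𝓕 (X := fun i ω => T (g (i + 1) ω θs))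
    (fun i => (p.batch (i + 1) : ℝ))
    (fun i => T.continuous.comp_stronglyMeasurable (h.score_stronglyMeasurable i))
    (fun i => T.comp_memLp' (memLp_two_of_four (h.score_memLp i))) t
  have hD := hTm.sub hS.1
  have hDl := lpNorm_sub_le (g := fun ω => ∑ i ∈ Finset.range t, (p.batch (i + 1) : ℝ) •
    (T (g (i + 1) ω θs) - (P[fun ω => T (g (i + 1) ω θs) | 𝓕 i]) ω)) hTm
    (by norm_num : (1 : ENNReal) ≤ 2)
  have hA := (hD.const_smul (p.total t : ℝ)⁻¹).ae_eq heq.symm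
  refine ⟨?_, ?_⟩
  · refine (hA.add (memLp_const θs)).ae_eq (Eventually.of_forall fun ω => ?_)
    simp
  · rw [← lpNorm_two_eq_sqrt hA.aestronglyMeasurable,
      lpNorm_two_congr_ae hA.aestronglyMeasurable heq]
    refine (lpNorm_const_smul (p := 2) (μ := P) (p.total t : ℝ)⁻¹ _).trans_le ?_
    rw [coe_nnnorm, Real.norm_of_nonneg (by positivity)]
    have h1 := hDl.trans (add_le_add (hTl.trans (mul_le_mul_of_nonneg_left hQ
      (inv_nonneg.2 hmu.le))) hS.2)
    refine (mul_le_mul_of_nonneg_left h1 (by positivity)).trans_eq ?_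
    field_simp
    ring

end Model

/-! ### The two algorithms as instances of the common setting -/

section Instances

variable {d : ℕ} {Ξ Ω : Type*} {p : Params}

lemma batchGrad_eq_gradient {f : EuclideanSpace ℝ (Fin d) → Ξ → ℝ} {ξ : ℕ → ℕ → Ω → Ξ}
    (hf : ∀ x, Differentiable ℝ fun η => f η x) (t : ℕ) (ω : Ω) (η : EuclideanSpace ℝ (Fin d)) :
    batchGrad p f ξ t ω η = gradient (batchLoss p f ξ t ω) η := by
  have hs : HasFDerivAt (fun η => ∑ i ∈ Finset.Icc 1 (p.batch t), f η (ξ t i ω))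
      (∑ i ∈ Finset.Icc 1 (p.batch t), fderiv ℝ (fun η => f η (ξ t i ω)) η) η :=
    HasFDerivAt.fun_sum fun i _ => (hf _ η).hasFDerivAt
  have h1 : fderiv ℝ (batchLoss p f ξ t ω) η = (p.batch t : ℝ)⁻¹ •
      ∑ i ∈ Finset.Icc 1 (p.batch t), fderiv ℝ (fun η => f η (ξ t i ω)) η :=
    (hs.const_mul (p.batch t : ℝ)⁻¹).fderiv
  unfold batchGrad gradient
  rw [h1, map_smul, map_sum]

variable [mΩ : MeasurableSpace Ω] {P : Measure Ω}
  {𝓕 : Filtration ℕ mΩ} {Θ : Set (EuclideanSpace ℝ (Fin d))}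
  {g : ℕ → Ω → EuclideanSpace ℝ (Fin d) → EuclideanSpace ℝ (Fin d)}
  {θs : EuclideanSpace ℝ (Fin d)} {θ : ℕ → Ω → EuclideanSpace ℝ (Fin d)}

lemma measurable_batchGrad {f : EuclideanSpace ℝ (Fin d) → Ξ → ℝ} {ξ : ℕ → ℕ → Ω → Ξ}
    (hf : ∀ x, Differentiable ℝ fun η => f η x)
    (hm : ∀ t : ℕ, 1 ≤ t → ∀ η, Measurable[𝓕 t] fun ω => batchLoss p f ξ t ω η) (t : ℕ)
    (ht : 1 ≤ t) (ϑ : Ω → EuclideanSpace ℝ (Fin d)) (hϑ : Measurable[𝓕 t] ϑ) :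
    Measurable[𝓕 t] fun ω => batchGrad p f ξ t ω (ϑ ω) := by
  simp only [batchGrad_eq_gradient hf]
  refine measurable_gradient_comp (fun ω η => ?_) (hm t ht) hϑ
  unfold batchLoss
  exact (DifferentiableAt.fun_sum fun i _ => hf _ η).const_mul _

lemma BoundedGradients.mem_interior (h : BoundedGradients p P Θ g θs) (hmem : θs ∈ Θ) :
    θs ∈ interior Θ := by
  by_contra hint
  have := h.le_dist θs ⟨subset_closure hmem, hint⟩
  rw [sub_self, norm_zero] at this
  exact absurd h.DTheta_pos (not_lt.2 this)

/-- The displacement is at most the distance to `θ_t`, which lies in `Θ`; that distance is `γ ‖g‖ ≤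
γ G`. It is nonzero only if `θ_{t+1}` lies on the boundary, where `1 ≤ ‖θ_{t+1} - θ*‖² / D_Θ²`. -/
lemma BoundedGradients.overshoot (h : BoundedGradients p P Θ g θs) (hp : p.Valid)
    (hΘ : Convex ℝ Θ) (hrec : IsPSSG p Θ g θ) (t : ℕ) : ∀ᵐ ω ∂P,
    ‖θ (t + 1) ω - (θ t ω - p.rate (t + 1) • g (t + 1) ω (θ t ω))‖ ≤
      p.rate (t + 1) * (|p.G| / p.DTheta ^ 2 * ‖θ (t + 1) ω - θs‖ ^ 2) := by
  have hr := (hp.rate_pos (t := t + 1) (by omega)).le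
  filter_upwards [h.bounded (t + 1) (by omega)] with ω hω
  have hmem : θ t ω ∈ Θ := by
    cases t with
    | zero => exact hrec.1 ω
    | succ t => exact (hrec.2 t ω).1
  have hproj := hrec.2 t ω
  by_cases hne : θ (t + 1) ω = θ t ω - p.rate (t + 1) • g (t + 1) ω (θ t ω)
  · rw [hne, sub_self, norm_zero]
    positivity
  have hD := h.le_dist _ (hproj.mem_frontier hΘ hne)
  have h1 := hproj.2 (θ t ω) hmem
  rw [norm_sub_rev, sub_sub_cancel_left, norm_neg, norm_smul, Real.norm_of_nonneg hr] at h1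
  have hg : ‖g (t + 1) ω (θ t ω)‖ ≤ |p.G| := by
    have := hω _ hmem
    rw [← sq_abs p.G] at this
    exact le_of_pow_le_pow_left₀ (by norm_num) (abs_nonneg _) this
  refine h1.trans (mul_le_mul_of_nonneg_left (hg.trans ?_) hr)
  have hD0 := h.DTheta_pos
  rw [div_mul_eq_mul_div, le_div_iff₀ (by positivity)]
  gcongr

end Instances

end Streaming

/-! ### The theorem -/

theorem mainTheorem2 (p : Streaming.Params) (hp : p.Valid) (hmu : 0 < p.muNu)
    (hab : p.alpha - p.rho * p.beta ∈ Set.Ioo (1 / 2 : ℝ) 1) :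
    -- the remainders depend only on the constants in `p`
    ∃ R R' Ψ : ℕ → ℝ,
      p.IsSoftO R (fun t => max
        ((p.total t : ℝ) ^
          (-((2 + p.rho * (2 * p.sigma + p.beta) - p.alpha) / (2 * (1 + p.rho)))))
        ((p.total t : ℝ) ^
          (-((p.rho * (2 * p.sigma - p.beta) + p.alpha) / (1 + p.rho))))) ∧
      p.IsSoftO R' (fun t =>
        (p.total t : ℝ) ^ (-((p.delta + p.rho * p.nu) / (2 * (1 + p.rho))))) ∧
      p.IsSoftO Ψ (fun t =>
        max ((p.total t : ℝ) ^ (-(p.rho * (p.sigma + p.nu) / (2 * (1 + p.rho)))))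
        (max ((p.total t : ℝ) ^
          (-((1 + p.rho * (p.beta + p.nu) - p.alpha) / (1 + p.rho))))
        (max ((p.total t : ℝ) ^ (-((1 + 2 * p.rho * p.nu) / (2 * (1 + p.rho)))))
        (max ((p.total t : ℝ) ^ (-((p.delta / 2 + p.rho * p.nu) / (2 * (1 + p.rho)))))
          ((p.total t : ℝ) ^ (-(2 * p.rho * p.nu / (1 + p.rho)))))))) ∧
      ∀ (d : ℕ) (Ξ : Type*) [MeasurableSpace Ξ] (π : MeasureTheory.Measure Ξ)
        [MeasureTheory.IsProbabilityMeasure π]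
        (Ω : Type*) [mΩ : MeasurableSpace Ω] (P : MeasureTheory.Measure Ω)
        [MeasureTheory.IsProbabilityMeasure P]
        (𝓕 : MeasureTheory.Filtration ℕ mΩ)
        -- the loss, the data, the constraint set, the minimizer, the iterates
        (f : EuclideanSpace ℝ (Fin d) → Ξ → ℝ) (ξ : ℕ → ℕ → Ω → Ξ)
        (Θ : Set (EuclideanSpace ℝ (Fin d))) (θs : EuclideanSpace ℝ (Fin d))
        (θ : ℕ → Ω → EuclideanSpace ℝ (Fin d))
        (S : Matrix (Fin d) (Fin d) ℝ) (St : ℕ → Matrix (Fin d) (Fin d) ℝ),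
        (∀ x, Differentiable ℝ (fun η => f η x)) →
        (∀ η, MeasureTheory.Integrable (f η) π) →
        -- the mini-batch losses are adapted
        (∀ t : ℕ, 1 ≤ t → ∀ η, Measurable[𝓕 t] (fun ω => Streaming.batchLoss p f ξ t ω η)) →
        IsClosed Θ → Convex ℝ Θ → θs ∈ Θ →
        -- unique global minimizer
        (∀ η, η ≠ θs → Streaming.objective f π θs < Streaming.objective f π η) →
        Streaming.QuasiStronglyConvex p Θ (Streaming.objective f π) θs →
        Streaming.Smooth p Θ (Streaming.objective f π) θs →
        Streaming.DependenceBias p 4 P 𝓕 Θ (Streaming.batchGrad p f ξ)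
          (Streaming.objective f π) θs →
        Streaming.ExpectedSmooth p 4 P 𝓕 Θ (Streaming.batchGrad p f ξ) θs →
        Streaming.GradientNoise p 4 P (Streaming.batchGrad p f ξ) θs →
        Streaming.ScoreCovariance p P (Streaming.batchGrad p f ξ) θs S St →
        -- the initial point
        Measurable[𝓕 0] (θ 0) → MeasureTheory.MemLp (θ 0) 4 P →
        (∫ ω, ‖θ 0 ω - θs‖ ^ 4 ∂P) ≤ p.Delta0 →
        -- either no projection, or projection and bounded gradients
        ((Θ = Set.univ ∧ Streaming.IsSSG p (Streaming.batchGrad p f ξ) θ) ∨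
          (Streaming.IsPSSG p Θ (Streaming.batchGrad p f ξ) θ ∧
            Streaming.BoundedGradients p P Θ (Streaming.batchGrad p f ξ) θs)) →
        ∀ t : ℕ, 1 ≤ t →
          MeasureTheory.MemLp (Streaming.average p θ t) 2 P ∧
          Real.sqrt (∫ ω, ‖Streaming.average p θ t ω - θs‖ ^ 2 ∂P) ≤
            (if p.sigma = 1 / 2 then
              Real.sqrt (Streaming.Lam (Streaming.objective f π) θs S) /
                Real.sqrt (p.total t : ℝ) else 0)
            + (if p.sigma < 1 / 2 then
              Real.sqrt 2 * Real.sqrt (Streaming.Lam (Streaming.objective f π) θs S)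
                * (p.Crho : ℝ) ^ ((1 - 2 * p.sigma) / (2 * (1 + p.rho)))
                / (p.total t : ℝ) ^ ((1 + 2 * p.rho * p.sigma) / (2 * (1 + p.rho))) else 0)
            + Real.sqrt 2 * Real.sqrt p.Csigma'
                * (p.Crho : ℝ) ^ ((1 - 2 * (p.sigma + p.sigma')) / (2 * (1 + p.rho)))
                / (p.mu * (p.total t : ℝ) ^
                  ((1 + 2 * p.rho * (p.sigma + p.sigma')) / (2 * (1 + p.rho))))
            + R t
            + (if p.Dnu ≠ 0 then R' t else 0)
            + (if p.Bnu ≠ 0 then Ψ t else 0) := by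
  have ha : 1 / 2 < p.decay := hab.1
  have ha0 : 0 < p.decay := by linarith
  have ha1 : p.decay < 1 := hab.2
  obtain ⟨K, hK0, hK⟩ := Streaming.Model.exists_error_bound p hp hmu ha0 ha1
  obtain ⟨W, hW0, hW⟩ := hp.exists_weight_sum_le ha0 ha1
  obtain ⟨C, hC0, hC⟩ := hp.exists_remainder_le ha0 ha1
  have hmu0 := hp.mu_pos
  have hCh := hp.Chess_nonneg
  have hD := hp.Dnu_nonneg
  have hB := hp.Bnu_nonneg
  have hκ := hp.Ckappa_pos
  set A : ℝ := K * W + (|p.G| / p.DTheta ^ 2) * K ^ 2 * (16 * p.Crho) +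
    p.Chess * K ^ 2 * (16 * p.Crho) + 4 * p.Crho * (2 * p.Dnu * K + p.Bnu) +
    p.Ckappa * K * (24 * p.Crho) with hA
  have hA0 : 0 ≤ A := by positivity
  have hM0 : 0 ≤ p.mu⁻¹ * A * C := by positivity
  -- The three remainders share one constant: `1 / μ` from `H⁻¹`, `A` from `rest_le`, `C` from the
  -- passage to powers of `N_t`. A single logarithm suffices.
  refine ⟨fun t => p.mu⁻¹ * A * C * (1 + Real.log (p.total t : ℝ)) * p.orderMain t,
    fun t => p.mu⁻¹ * A * C * (1 + Real.log (p.total t : ℝ)) * p.orderDep t,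
    fun t => p.mu⁻¹ * A * C * (1 + Real.log (p.total t : ℝ)) * p.orderBias t,
    Streaming.Params.isSoftO_mul_log hM0 hp p.orderMain_nonneg,
    Streaming.Params.isSoftO_mul_log hM0 hp p.orderDep_nonneg,
    Streaming.Params.isSoftO_mul_log hM0 hp p.orderBias_nonneg, ?_⟩
  intro d Ξ _ π _ Ω mΩ P _ 𝓕 f ξ Θ θs θ S St hf _ hadapt hcl hconv hmem hmin hquasi hsmooth
    hdep hexp hnoise hcov hinit hinit4 hinitle hrec t ht
  have hisMin : ∀ η, Streaming.objective f π θs ≤ Streaming.objective f π η := fun η => by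
    by_cases hη : η = θs
    · rw [hη]
    · exact (hmin η hη).le
  have h : Streaming.Model p P 𝓕 Θ (Streaming.batchGrad p f ξ) (Streaming.objective f π) θs θ := by
    rcases hrec with ⟨hΘ, hrec⟩ | ⟨hrec, hbdd⟩
    -- On the whole space every point is interior and is its own projection, so the displacement
    -- vanishes.
    · refine ⟨hp, hmu, hcl, hconv, by rw [hΘ, interior_univ]; trivial, hisMin, hquasi, hsmooth,
        hdep, hexp, hnoise, Streaming.measurable_batchGrad hf hadapt, hinit, hinit4, hinitle,
        ⟨fun ω => hΘ ▸ Set.mem_univ _, fun s ω => ?_⟩, fun s => Filter.Eventually.of_forall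
          fun ω => ?_⟩
      · rw [← hrec s ω]
        exact Streaming.isProjection_self (hΘ ▸ Set.mem_univ _)
      · rw [← hrec s ω, sub_self, norm_zero]
        have := hp.rate_pos (t := s + 1) (by omega)
        positivity
    · exact ⟨hp, hmu, hcl, hconv, hbdd.mem_interior hmem, hisMin, hquasi, hsmooth, hdep, hexp,
        hnoise, Streaming.measurable_batchGrad hf hadapt, hinit, hinit4, hinitle, hrec,
        hbdd.overshoot hp hconv hrec⟩
  have hrest := h.rest_le ha hK0 (hK h) hW ht
  have havg := h.average_error_le ha0 ht hrest.1 (Q := A * ((1 + Real.log t) * p.remainder t))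
    (hrest.2.trans_eq (by rw [← hA]; ring))
  refine ⟨havg.1, havg.2.trans ((add_le_add_left (h.leading_le hcov ht) _).trans ?_)⟩
  have ht1 : (1 : ℝ) ≤ t := by exact_mod_cast ht
  have hlog : 1 + Real.log t ≤ 1 + Real.log (p.total t : ℝ) :=
    add_le_add_right (Real.log_le_log (by linarith) (hp.natCast_le_total t)) 1
  have hlog0 : 0 ≤ 1 + Real.log (t : ℝ) := by linarith [Real.log_nonneg ht1]
  have hO := p.orderMain_nonneg t
  have hO' := p.orderDep_nonneg t
  have hO'' := p.orderBias_nonneg t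
  have hfin : p.mu⁻¹ * (A * ((1 + Real.log t) * p.remainder t)) ≤
      p.mu⁻¹ * (A * ((1 + Real.log (p.total t : ℝ)) * (C * p.orderMain t +
        (if p.Dnu ≠ 0 then C * p.orderDep t else 0) +
        (if p.Bnu ≠ 0 then C * p.orderBias t else 0)))) := by
    have h1 : 0 ≤ C * p.orderMain t + (if p.Dnu ≠ 0 then C * p.orderDep t else 0) +
        (if p.Bnu ≠ 0 then C * p.orderBias t else 0) := by
      have e1 : 0 ≤ C * p.orderMain t := by positivity
      have e2 : 0 ≤ C * p.orderDep t := by positivity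
      have e3 : 0 ≤ C * p.orderBias t := by positivity
      split_ifs <;> linarith
    refine mul_le_mul_of_nonneg_left (mul_le_mul_of_nonneg_left ?_ hA0) (by positivity)
    exact (mul_le_mul_of_nonneg_left (hC t ht) hlog0).trans (mul_le_mul_of_nonneg_right hlog h1)
  simp only [add_assoc]
  gcongr
  refine hfin.trans_eq ?_
  split_ifs <;> ring
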